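/- Throughout, $0<\alpha<\tfrac12$ and $0<\kappa<\tfrac12$ are fixed, $\rho$ is the Dickman--de Bruijn function (the continuous function on $[0,\infty)$ with $\rho(u)=1$ for $0\le u\le 1$ and $u\rho'(u)=-\rho(u-1)$ for $u>1$), $\phi$ is Euler's function, $p$ always denotes a prime, and for $2\le Q\le x$ we write $u=\frac{\log x}{\log Q}$. Put $$C_1=\frac{\alpha\kappa}{41},\qquad C_2=\frac{5}{656}\cdot\frac{\alpha\kappa\left(1-\frac{\alpha\kappa}{20}\right)}{20}.$$ **Classes of functions.** $\mathcal M$ is the set of nonnegative multiplicative functions $f$ for which there are a constant $A_1$ with $f(p^l)\le A_1^l$ for all primes $p$ and all $l\ge 1$, and, for every $\epsilon>0$, a constant $A_2(\epsilon)$ with $f(n)\le A_2(\epsilon)n^{\epsilon}$ for all $n\ge1$. For $\beta>0$ (and a given large $x$), $\mathcal M(\beta)$ is the set of nonnegative multiplicative functions $f$ with $f(p^l)\le A_1^l(\log\log x)^{\beta l}$ for all primes $p$ and all $l\ge1$, and, for every $\epsilon>0$, $f(n)\le\max\{A_2(\epsilon)n^{\epsilon},A_3(\epsilon)(\log x)^{\epsilon}\}$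 for all $n\ge1$. $\mathcal M_Q$ and $\mathcal M_Q(\beta)$ are the subsets of those $f$ that vanish at every $n$ having a prime factor $p>Q$. **Theorem.** Let $x$ be sufficiently large, $x^\kappa\le y\le x$, let $k$ be a positive integer with $k<y^{1-\alpha}$, and let $(a,k)=1$. (1) Let $K>C_1/\alpha$ be fixed and $(\log x)^{K}\le Q\le x$. If $f\in\mathcal M_Q$, then $$\sum_{\substack{x\le n<x+y\\ n\equiv a\ (\mathrm{mod}\ k)}}f(n)\ll\rho(u)^{C_1}\frac{x}{\phi(k)\log x}\exp\Bigg(\sum_{\substack{p\le Q\\ p\nmid k}}\frac{f(p)}{p}\Bigg).$$ (2) There exists $\beta$ with $0<\beta<\frac{\alpha\kappa}{41}$, depending only on $\alpha$ and $\kappa$, such that the following holds. Let $\epsilon>0$ and $K>C_2/\alpha$ be fixed, and let $(\log x)^{K}\le Q\le\min\{x,\exp\left(\frac{\log x\,\log\log\log x}{\log\log x}\right)\}$. If $f\in\mathcal M_Q(\beta)$, then $$\sum_{\substack{x\le n<x+y\\ n\equiv a\ (\mathrm{mod}\ k)}}f(n)\ll\rho(u)^{C_2}\frac{x}{\phi(k)(\log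 x)^{1-\epsilon}}\exp\Bigg(\sum_{\substack{p\le Q\\ p\nmid k}}\frac{f(p)}{p}\Bigg).$$ Here "sufficiently large" and the implied constants depend only on $\alpha$, $\kappa$, $K$, the constant $A_1$ and the function $A_2(\cdot)$, and in (2) also on $\epsilon$ and $A_3(\cdot)$; they are uniform in $y,k,a,Q,f$. -/

import Mathlib

/-- The `n`-th approximation to the Dickman function, obtained by iterating
`g ↦ (u ↦ 1 if u ≤ 1, and 1 - ∫_1^u g(t-1)/t dt if u > 1)` from the constant `1`.
It agrees with the Dickman function on `[0, n + 1]`. -/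
noncomputable def dickmanAux : ℕ → ℝ → ℝ
  | 0, _ => 1
  | n + 1, u => if u ≤ 1 then 1 else 1 - ∫ t in (1 : ℝ)..u, dickmanAux n (t - 1) / t

/-- The Dickman–de Bruijn function `ρ` (used for `u ≥ 0`): `ρ = 1` on `[0, 1]` and
`u ρ'(u) = -ρ(u - 1)` for `u > 1`, `ρ` continuous; see `dickman_eq_one` and `dickman_eq`. -/
noncomputable def dickman (u : ℝ) : ℝ := dickmanAux ⌊u⌋₊ u

theorem dickmanAux_succ_eq (n : ℕ) (u : ℝ) (hu : u ≤ n + 1) :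
    dickmanAux (n + 1) u = dickmanAux n u := by
  induction n generalizing u with
  | zero =>
    have h : u ≤ 1 := by simpa using hu
    simp [dickmanAux, h]
  | succ n ih =>
    rw [dickmanAux, dickmanAux]
    split_ifs with h
    · rfl
    · congr 1
      refine intervalIntegral.integral_congr fun t ht => ?_
      rw [Set.uIcc_of_le (le_of_not_ge h)] at ht
      have : t - 1 ≤ (n : ℝ) + 1 := by
        have := ht.2
        push_cast at hu
        linarith
      simp only [ih _ this]

theorem dickmanAux_eq_dickman (n : ℕ) (u : ℝ) (hu : u < n + 1) :
    dickmanAux n u = dickman u := by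
  have hle : ⌊u⌋₊ ≤ n := by
    rcases lt_or_ge u 0 with h | h
    · simp [Nat.floor_of_nonpos h.le]
    · exact Nat.lt_succ_iff.mp ((Nat.floor_lt h).2 (by push_cast; exact hu))
  have key : ∀ m, ⌊u⌋₊ ≤ m → dickmanAux m u = dickman u := by
    intro m hm
    induction m, hm using Nat.le_induction with
    | base => rfl
    | succ m hm ih =>
      rw [dickmanAux_succ_eq m u, ih]
      have h1 : u < (⌊u⌋₊ : ℝ) + 1 := Nat.lt_floor_add_one u
      have h2 : (⌊u⌋₊ : ℝ) ≤ m := by exact_mod_cast hm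
      linarith
  exact key n hle

theorem dickman_eq_one (u : ℝ) (hu : u ≤ 1) : dickman u = 1 := by
  rw [dickman]
  cases ⌊u⌋₊ <;> simp [dickmanAux, hu]

theorem dickman_eq (u : ℝ) (hu : 1 ≤ u) :
    dickman u = 1 - ∫ t in (1 : ℝ)..u, dickman (t - 1) / t := by
  have h1 : u < (⌊u⌋₊ : ℝ) + 1 := Nat.lt_floor_add_one u
  rw [← dickmanAux_eq_dickman (⌊u⌋₊ + 1) u (by push_cast; linarith), dickmanAux]
  split_ifs with h
  · have : u = 1 := le_antisymm h hu
    simp [this]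
  · congr 1
    refine intervalIntegral.integral_congr fun t ht => ?_
    rw [Set.uIcc_of_le hu] at ht
    have : t - 1 < (⌊u⌋₊ : ℝ) + 1 := by linarith [ht.2]
    simp only [dickmanAux_eq_dickman _ _ this]

/-- `f` is supported on the `Q`-smooth numbers: `f n ≠ 0` only if every prime `p ∣ n` satisfies
`p ≤ Q` (`Nat.smoothNumbers N` uses primes `p < N`). -/
def SmoothSupported (Q : ℝ) (f : ArithmeticFunction ℝ) : Prop :=
  Function.support f ⊆ Nat.smoothNumbers (⌊Q⌋₊ + 1)

/-- Shiu's class `M` with the constants `A₁` and `A₂ = A₂(ε)` made explicit. -/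
structure ShiuClass (A₁ : ℝ) (A₂ : ℝ → ℝ) (f : ArithmeticFunction ℝ) : Prop where
  multiplicative : f.IsMultiplicative
  nonneg : ∀ n, 0 ≤ f n
  prime_pow_le : ∀ p l : ℕ, p.Prime → 1 ≤ l → f (p ^ l) ≤ A₁ ^ l
  growth : ∀ ε : ℝ, 0 < ε → ∀ n : ℕ, 1 ≤ n → f n ≤ A₂ ε * (n : ℝ) ^ ε

/-- The class `M(β)` at the parameter `x`, with the constants `A₁`, `A₂ = A₂(ε)`, `A₃ = A₃(ε)`
made explicit. -/
structure LargeShiuClass (β A₁ : ℝ) (A₂ A₃ : ℝ → ℝ) (x : ℝ) (f : ArithmeticFunction ℝ) :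
    Prop where
  multiplicative : f.IsMultiplicative
  nonneg : ∀ n, 0 ≤ f n
  prime_pow_le : ∀ p l : ℕ, p.Prime → 1 ≤ l →
    f (p ^ l) ≤ A₁ ^ l * Real.log (Real.log x) ^ (β * l)
  growth : ∀ ε : ℝ, 0 < ε → ∀ n : ℕ, 1 ≤ n →
    f n ≤ max (A₂ ε * (n : ℝ) ^ ε) (A₃ ε * Real.log x ^ ε)

/-- The sum of `f n` over the integers `x ≤ n < x + y` with `n ≡ a (mod k)`. -/
noncomputable def progressionSum (f : ArithmeticFunction ℝ) (x y : ℝ) (k a : ℕ) : ℝ :=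
  ∑ n ∈ (Finset.Ico ⌈x⌉₊ ⌈x + y⌉₊).filter (fun n => n ≡ a [MOD k]), f n

/-- The sum of `f p / p` over the primes `p ≤ Q` not dividing `k`. -/
noncomputable def primeSum (f : ArithmeticFunction ℝ) (Q : ℝ) (k : ℕ) : ℝ :=
  ∑ p ∈ (Finset.Icc 1 ⌊Q⌋₊).filter (fun p => p.Prime ∧ ¬ p ∣ k), f p / (p : ℝ)

/-- The exponent `C₁ = ακ/41`. -/
noncomputable def expC₁ (α κ : ℝ) : ℝ := α * κ / 41

/-- The exponent `C₂ = (5/656) · ακ(1 - ακ/20)/20`. -/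
noncomputable def expC₂ (α κ : ℝ) : ℝ := 5 / 656 * (α * κ * (1 - α * κ / 20) / 20)

/-! The bound is stated with `x` in place of `y`. Since `f` is nonnegative and `y ≤ x`, the sum may
be enlarged to all `n ≡ a` in `[x, 2x)`, and `k < y^(1-α)` relaxed to `k < x^(1-α)`. After that `κ <
1/2` matters only by keeping numbers small: both exponents are at most `α/82`. The core result
`exists_sum_progression_le` treats any exponent `0 < c ≤ α/82` with `K > c/α`, and any
multiplicative `f` with `f(p^l) ≤ H^l` and `f(n) ≤ G n^ε'`, with linear dependence on `G`.

For `Q ≤ log x` (`exists_sum_progression_le_of_le_log`), Rankin's trick shows that there are only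
`x^(small)` smooth integers to count, while the right-hand side is at least about `x^(α - c/K)`; the
condition `K > c/α` makes this a genuine power.

For `Q ≥ log x` (`exists_sum_progression_le_of_log_le`) the argument is Shiu's. Put `L = (α/2) log
x`. Multiplying the prime powers of `n` in increasing order until `e^L` would be passed gives `n = b
d`, with `b ≤ e^L` and a next prime `q`; classify `n` by `r = ⌊L / log q⌋`, with `r = 1` when `q >
e^(L/2)`. By `smoothClass_trichotomy`, every `n` outside the classes has a large square divisor or a
large, very smooth divisor; such `n` are so rare that counting them suffices. In class `r`,
Selberg's sieve (`card_rough_modEq_le`) counts the cofactors `d`, `f(d)` is at most `H^(4(r+1)/α)`,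
and Rankin's trick on `b ≥ e^(L/2)` with primes up to `e^(L/r)` (`exists_sum_smooth_div_le`) saves
`exp(-(r log r)/4)`.

Because `q ≤ Q`, the class is empty unless `u ≤ (2/α)(r+1)`. The lower bound `exists_exp_le_dickman`
then shows that inserting `ρ(u)^c` costs at most `(4/82) r log r + O(r)` in the exponent, and `H ≤ A
u^(α/100)` costs at most `(r log r)/25 + O(r)`. As `1/4 - 4/82 - 1/25 > 0`, the classes sum
geometrically (`exists_forall_class_factor_le`, `exists_sum_class_le`).

In part (1), `H` is constant. In part (2), `H` is of size `(log log x)^β`, and the upper limit on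
`Q` forces `u ≥ √(log log x)`, so a small `β` keeps `H` below `A u^(α/100)`; the factor `(log x)^δ`
allowed in the growth of `f` goes into `G` and is paid for by `(log x)^ε`. -/

section
open Set

/-! ### The Dickman function: regularity and a lower bound. -/

theorem continuousAt_dickmanAux (n : ℕ) : ∀ u : ℝ, ContinuousAt (dickmanAux n) u := by
  induction n with
  | zero => intro u; exact continuousAt_const
  | succ n ih =>
    have hc : Continuous (dickmanAux n) := continuous_iff_continuousAt.2 ih
    have hi : ContinuousOn (fun t : ℝ => dickmanAux n (t - 1) / t) (Ioi 0) := by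
      refine ContinuousOn.div (by fun_prop) continuousOn_id fun t ht => ?_
      exact (ne_of_gt ht)
    -- Clamping the upper limit at 1 removes the case distinction, so continuity at the junction
    -- needs no separate argument.
    have heq : dickmanAux (n + 1) =
        fun u => 1 - ∫ t in (1 : ℝ)..(max u 1), dickmanAux n (t - 1) / t := by
      funext u
      rw [dickmanAux]
      split_ifs with h
      · simp [max_eq_right h]
      · rw [max_eq_left (le_of_not_ge h)]
    intro u
    rw [heq]
    refine ContinuousAt.sub continuousAt_const ?_
    have hd : ContinuousAt (fun v : ℝ => ∫ t in (1 : ℝ)..v, dickmanAux n (t - 1) / t)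
        (max u 1) := by
      have h0 : (0 : ℝ) < max u 1 := lt_max_of_lt_right one_pos
      refine HasDerivAt.continuousAt (intervalIntegral.integral_hasDerivAt_right
        (ContinuousOn.intervalIntegrable (hi.mono ?_)) ?_ (hi.continuousAt (Ioi_mem_nhds h0)))
      · intro t ht
        rw [uIcc_of_le (le_max_right _ _)] at ht
        exact lt_of_lt_of_le one_pos ht.1
      · exact hi.stronglyMeasurableAtFilter isOpen_Ioi _ h0
    exact ContinuousAt.comp (f := fun u : ℝ => max u 1) hd (by fun_prop)

theorem continuous_dickman : Continuous dickman := by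
  refine continuous_iff_continuousAt.2 fun u => ?_
  refine (continuousAt_dickmanAux (⌊u⌋₊ + 1) u).congr ?_
  have h1 : u < (⌊u⌋₊ : ℝ) + 1 := Nat.lt_floor_add_one u
  filter_upwards [Iio_mem_nhds (show u < ((⌊u⌋₊ + 1 : ℕ) : ℝ) + 1 by push_cast; linarith)]
    with v hv
  exact dickmanAux_eq_dickman _ _ hv

theorem hasDerivAt_dickman {u : ℝ} (hu : 1 < u) :
    HasDerivAt dickman (-(dickman (u - 1) / u)) u := by
  have hi : ContinuousOn (fun t : ℝ => dickman (t - 1) / t) (Ioi 0) :=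
    ContinuousOn.div (continuous_dickman.comp (by fun_prop)).continuousOn continuousOn_id
      fun t ht => ne_of_gt ht
  have h0 : (0 : ℝ) < u := by linarith
  have hd : HasDerivAt (fun v : ℝ => 1 - ∫ t in (1 : ℝ)..v, dickman (t - 1) / t)
      (-(dickman (u - 1) / u)) u := by
    refine HasDerivAt.const_sub _ (intervalIntegral.integral_hasDerivAt_right
        (ContinuousOn.intervalIntegrable (hi.mono ?_)) ?_ (hi.continuousAt (Ioi_mem_nhds h0)))
    · intro t ht
      rw [uIcc_of_le hu.le] at ht
      exact lt_of_lt_of_le one_pos ht.1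
    · exact hi.stronglyMeasurableAtFilter isOpen_Ioi _ h0
  refine hd.congr_of_eventuallyEq ?_
  filter_upwards [Ioi_mem_nhds hu] with v hv
  exact dickman_eq v (le_of_lt hv)

/-- Both sides have derivative `ρ(u) - ρ(u-1)` beyond 1 and both equal 1 at `u = 1`. This form makes
positivity and the lower bound accessible. -/
theorem mul_dickman_eq_integral {u : ℝ} (hu : 1 ≤ u) :
    u * dickman u = ∫ t in (u - 1)..u, dickman t := by
  have hint : ∀ a b, IntervalIntegrable dickman MeasureTheory.volume a b :=
    fun a b => continuous_dickman.intervalIntegrable a b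
  have hF : ∀ v, HasDerivAt (fun v => ∫ t in (0 : ℝ)..v, dickman t) (dickman v) v := fun v =>
    intervalIntegral.integral_hasDerivAt_right (hint _ _)
      (continuous_dickman.stronglyMeasurableAtFilter _ _) continuous_dickman.continuousAt
  set F : ℝ → ℝ := fun v => ∫ t in (0 : ℝ)..v, dickman t with hFdef
  have hFc : Continuous F := continuous_iff_continuousAt.2 fun v => (hF v).continuousAt
  have hsub : ∀ v, (∫ t in (v - 1)..v, dickman t) = F v - F (v - 1) := fun v =>
    (intervalIntegral.integral_interval_sub_left (hint _ _) (hint _ _)).symm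
  have key : ∀ v ∈ Icc 1 u, v * dickman v - (F v - F (v - 1)) =
      1 * dickman 1 - (F 1 - F (1 - 1)) := by
    refine constant_of_has_deriv_right_zero (f := fun v => v * dickman v - (F v - F (v - 1))) ?_ ?_
    · have := continuous_dickman
      fun_prop
    · intro v hv
      rcases eq_or_lt_of_le hv.1 with h1 | h1
      · subst h1
        -- At 1 the function has a corner, so only the right derivative is available; the constancy
        -- criterion asks for no more.
        have hd : HasDerivWithinAt dickman (-(dickman ((1 : ℝ) - 1) / 1)) (Ici 1) 1 := by
          have hi : ContinuousOn (fun t : ℝ => dickman (t - 1) / t) (Ioi 0) :=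
            ContinuousOn.div (continuous_dickman.comp (by fun_prop)).continuousOn continuousOn_id
              fun t ht => ne_of_gt ht
          have hd : HasDerivAt (fun v : ℝ => 1 - ∫ t in (1 : ℝ)..v, dickman (t - 1) / t)
              (-(dickman ((1 : ℝ) - 1) / 1)) 1 :=
            HasDerivAt.const_sub _ (intervalIntegral.integral_hasDerivAt_right
              (by simp) (hi.stronglyMeasurableAtFilter isOpen_Ioi _ (show (0:ℝ) < 1 by norm_num))
              (hi.continuousAt (Ioi_mem_nhds one_pos)))
          exact hd.hasDerivWithinAt.congr (fun v hv => dickman_eq v hv) (dickman_eq 1 le_rfl)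
        have h2 := (((hasDerivAt_id (1 : ℝ)).hasDerivWithinAt (s := Ici 1)).mul hd).sub
          (((hF 1).hasDerivWithinAt (s := Ici 1)).sub
            ((HasDerivAt.comp_sub_const (1 : ℝ) 1 (hF _)).hasDerivWithinAt))
        convert h2 using 1
        · rfl
        · simp only [id]
          ring
      · have h2 := ((hasDerivAt_id v).mul (hasDerivAt_dickman h1)).sub ((hF v).sub
          (HasDerivAt.comp_sub_const v 1 (hF _)))
        convert h2.hasDerivWithinAt using 1
        · rfl
        · simp only [id]
          field_simp
          ring
  have h1 := key u (right_mem_Icc.2 hu)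
  have h2 : F 1 - F (1 - 1) = 1 := by
    rw [← hsub]
    have : ∫ t in (1 - 1 : ℝ)..1, dickman t = ∫ t in (1 - 1 : ℝ)..1, (1 : ℝ) := by
      refine intervalIntegral.integral_congr fun t ht => ?_
      rw [uIcc_of_le (by norm_num)] at ht
      exact dickman_eq_one t ht.2
    rw [this]; simp
  rw [h2, dickman_eq_one 1 le_rfl] at h1
  rw [hsub]
  linarith

/-- At the first point `m` with `ρ(m) ≤ 0`, the integral of `ρ` over `[m-1, m]` would be positive
and yet equal to `m ρ(m)`. -/
theorem dickman_pos (u : ℝ) : 0 < dickman u := by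
  by_contra hneg
  push Not at hneg
  set S : Set ℝ := Icc 1 u ∩ {v | dickman v ≤ 0} with hS
  have hu1 : 1 < u := by
    by_contra h
    rw [dickman_eq_one u (not_lt.1 h)] at hneg
    norm_num at hneg
  have hSc : IsCompact S :=
    isCompact_Icc.inter_right (isClosed_le continuous_dickman continuous_const)
  obtain ⟨m, hm, hmin⟩ := hSc.exists_isLeast ⟨u, ⟨hu1.le, le_rfl⟩, hneg⟩
  have hpos : ∀ v, v < m → 0 < dickman v := by
    intro v hv
    rcases le_or_gt v 1 with h | h
    · rw [dickman_eq_one v h]; norm_num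
    · by_contra hc
      exact absurd (hmin ⟨⟨h.le, hv.le.trans hm.1.2⟩, not_lt.1 hc⟩) (not_le.2 hv)
  have h1 := mul_dickman_eq_integral hm.1.1
  have h2 : 0 < ∫ t in (m - 1)..m, dickman t :=
    intervalIntegral.intervalIntegral_pos_of_pos_on
      (continuous_dickman.intervalIntegrable _ _) (fun t ht => hpos t ht.2) (by linarith)
  have h3 : m * dickman m ≤ 0 :=
    mul_nonpos_of_nonneg_of_nonpos (by linarith [hm.1.1]) hm.2
  linarith

theorem antitone_dickman : Antitone dickman := by
  have h1 : AntitoneOn dickman (Ici 1) := by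
    refine antitoneOn_of_deriv_nonpos (convex_Ici 1) continuous_dickman.continuousOn ?_ ?_
    · intro v hv
      rw [interior_Ici] at hv
      exact (hasDerivAt_dickman hv).differentiableAt.differentiableWithinAt
    · intro v hv
      rw [interior_Ici] at hv
      rw [(hasDerivAt_dickman hv).deriv, neg_nonpos]
      exact div_nonneg (dickman_pos _).le (by linarith [mem_Ioi.1 hv])
  intro a b hab
  rcases le_total b 1 with hb | hb
  · rw [dickman_eq_one a (hab.trans hb), dickman_eq_one b hb]
  rcases le_total a 1 with ha | ha
  · rw [dickman_eq_one a ha, ← dickman_eq_one 1 le_rfl]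
    exact h1 self_mem_Ici hb hb
  · exact h1 ha hb hab

/-- In `u ρ(u) = ∫ ρ` keep only the first stretch of length `θ`, on which monotonicity bounds `ρ`
below by its value at the right end. -/
theorem dickman_shift {u θ : ℝ} (hu : 1 ≤ u) (hθ : 0 < θ) (hθ1 : θ < 1) :
    θ / u * dickman (u - (1 - θ)) ≤ dickman u := by
  have h0 : 0 < u := by linarith
  rw [div_mul_eq_mul_div, div_le_iff₀ h0, mul_comm (dickman u), mul_dickman_eq_integral hu]
  have hint : ∀ a b, IntervalIntegrable dickman MeasureTheory.volume a b :=
    fun a b => continuous_dickman.intervalIntegrable a b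
  have h1 : ∫ t in (u - 1)..(u - (1 - θ)), dickman (u - (1 - θ)) ≤
      ∫ t in (u - 1)..(u - (1 - θ)), dickman t := by
    refine intervalIntegral.integral_mono_on (by linarith) (by simp) (hint _ _) fun t ht => ?_
    exact antitone_dickman ht.2
  have h2 : (0 : ℝ) ≤ ∫ t in (u - (1 - θ))..u, dickman t :=
    intervalIntegral.integral_nonneg (by linarith) fun t _ => (dickman_pos t).le
  rw [intervalIntegral.integral_const, smul_eq_mul] at h1
  rw [← intervalIntegral.integral_add_adjacent_intervals (hint (u - 1) (u - (1 - θ))) (hint _ u)]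
  have h3 : u - (1 - θ) - (u - 1) = θ := by ring
  rw [h3] at h1
  linarith

/-- Iterating the shift inequality: each step back by `1 - θ` costs a factor at least `θ/u`, until
the interval where `ρ = 1` is reached. -/
theorem dickman_ge_pow {u θ : ℝ} (hu : 1 ≤ u) (hθ : 0 < θ) (hθ1 : θ < 1) (n : ℕ) :
    ∀ v ≤ u, v ≤ 1 + n * (1 - θ) → (θ / u) ^ n ≤ dickman v := by
  have h0 : 0 < u := by linarith
  have hle : θ / u ≤ 1 := by rw [div_le_one h0]; linarith
  induction n with
  | zero =>
    intro v _ hv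
    rw [dickman_eq_one v (by simpa using hv)]; simp
  | succ n ih =>
    intro v hvu hv
    rcases le_total v 1 with h1 | h1
    · rw [dickman_eq_one v h1]
      exact pow_le_one₀ (by positivity) hle
    · have h2 := ih (v - (1 - θ)) (by linarith) (by push_cast at hv; linarith)
      calc (θ / u) ^ (n + 1) = θ / u * (θ / u) ^ n := by ring
        _ ≤ θ / v * dickman (v - (1 - θ)) := by
          refine mul_le_mul ?_ h2 (by positivity) (div_nonneg hθ.le (by linarith))
          exact div_le_div_of_nonneg_left hθ.le (by linarith) hvu
        _ ≤ dickman v := dickman_shift h1 hθ hθ1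

/-- Lower bound `ρ(u) ≥ exp(-(1 + δ) u log u - O_δ(u))`. -/
theorem exists_exp_le_dickman {δ : ℝ} (hδ : 0 < δ) :
    ∃ C : ℝ, 0 < C ∧ ∀ u : ℝ, 1 ≤ u →
      Real.exp (-((1 + δ) * u * Real.log u + C * u)) ≤ dickman u := by
  -- With this `θ` the step length `1 - θ` is `1/(1+δ)`, so about `(1+δ)u` steps suffice and the
  -- leading constant is `1+δ`.
  set θ : ℝ := δ / (1 + δ) with hθd
  have hθ : 0 < θ := by positivity
  have hθ1 : θ < 1 := by rw [hθd, div_lt_one (by positivity)]; linarith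
  have h1θ : 1 / (1 - θ) = 1 + δ := by
    rw [hθd]; field_simp; ring
  have hl : Real.log θ < 0 := Real.log_neg hθ hθ1
  refine ⟨1 + (2 + δ) * (-Real.log θ), by nlinarith, fun u hu => ?_⟩
  have h0 : 0 < u := by linarith
  have hlu : 0 ≤ Real.log u := Real.log_nonneg hu
  set n : ℕ := ⌈u * (1 + δ)⌉₊ with hn
  have hn1 : u * (1 + δ) ≤ n := Nat.le_ceil _
  have hn2 : (n : ℝ) < u * (1 + δ) + 1 := Nat.ceil_lt_add_one (by positivity)
  have h1 := dickman_ge_pow hu hθ hθ1 n u le_rfl (by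
    have h3 : (1 - θ) * (1 + δ) = 1 := by rw [← h1θ]; field_simp [show 1 - θ ≠ 0 by linarith]
    have : u * (1 + δ) * (1 - θ) ≤ n * (1 - θ) := mul_le_mul_of_nonneg_right hn1 (by linarith)
    nlinarith)
  refine le_trans ?_ h1
  rw [← Real.exp_log (show 0 < (θ / u) ^ n by positivity), Real.exp_le_exp, Real.log_pow,
    Real.log_div hθ.ne' h0.ne']
  have hlu2 : Real.log u ≤ u := (Real.log_le_sub_one_of_pos h0).trans (by linarith)
  have h4 : (n : ℝ) * (Real.log u - Real.log θ) ≤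
      (u * (1 + δ) + 1) * (Real.log u - Real.log θ) :=
    mul_le_mul_of_nonneg_right hn2.le (by linarith)
  nlinarith [mul_nonneg (sub_nonneg.2 hu) (neg_pos.2 hl).le]

end

/-! ### Sums over primes and over smooth numbers. -/

section
open Finset

/-- Mertens' upper bound: the product of `p^⌊N/p⌋` divides `N!`, which is at most `N^N`, and
Chebyshev's bound for `θ(N)` pays for removing the floors. -/
theorem sum_log_div_prime_le (N : ℕ) (hN : 1 ≤ N) :
    ∑ p ∈ (Icc 1 N).filter Nat.Prime, Real.log p / p ≤ Real.log N + Real.log 4 := by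
  have hN0 : (0 : ℝ) < N := by exact_mod_cast hN
  have hdvd : (∏ p ∈ (Icc 1 N).filter Nat.Prime, p ^ (N / p)) ∣ N.factorial := by
    refine Finset.prod_dvd_of_isRelPrime ?_ ?_
    · intro p hp q hq hpq
      rw [mem_coe, mem_filter] at hp hq
      exact Nat.coprime_iff_isRelPrime.1 (Nat.coprime_pow_primes _ _ hp.2 hq.2 hpq)
    · intro p hp
      rw [mem_filter] at hp
      have h1 : p ^ (N / p) * (N / p).factorial ∣ N.factorial := by
        have h2 := Nat.factorial_dvd_factorial (Nat.mul_div_le N p)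
        refine Dvd.dvd.trans ?_ h2
        generalize N / p = m
        induction m with
        | zero => simp
        | succ m ih =>
          have hp0 := hp.2.pos
          have h3 : (p * m).factorial * (p * (m + 1)) ∣ (p * (m + 1)).factorial := by
            have : p * (m + 1) = (p * (m + 1) - 1) + 1 := by
              have : 0 < p * (m + 1) := by positivity
              omega
            rw [this, Nat.factorial_succ, mul_comm, ← this]
            refine mul_dvd_mul_left _ (Nat.factorial_dvd_factorial ?_)
            rw [Nat.mul_succ]; omega
          refine Dvd.dvd.trans ?_ h3
          rw [pow_succ, Nat.factorial_succ]
          calc p ^ m * p * ((m + 1) * m.factorial) = (p ^ m * m.factorial) * (p * (m + 1)) := by ring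
            _ ∣ _ := mul_dvd_mul_right ih _
      exact (dvd_mul_right _ _).trans h1
  have hle : (∑ p ∈ (Icc 1 N).filter Nat.Prime, ((N / p : ℕ) : ℝ) * Real.log p) ≤ N * Real.log N := by
    have h1 := Nat.le_of_dvd (Nat.factorial_pos N) hdvd
    have h2 : (∏ p ∈ (Icc 1 N).filter Nat.Prime, p ^ (N / p)) ≤ N ^ N :=
      h1.trans (Nat.factorial_le_pow N)
    have h3 : ((∏ p ∈ (Icc 1 N).filter Nat.Prime, p ^ (N / p) : ℕ) : ℝ) ≤ ((N ^ N : ℕ) : ℝ) := by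
      exact_mod_cast h2
    have h4 := Real.log_le_log (by
      rw [Nat.cast_pos]; exact Finset.prod_pos fun p hp => pow_pos (mem_filter.1 hp).2.pos _) h3
    push_cast at h4
    rw [Real.log_pow, Real.log_prod (fun p hp => by
      have := (mem_filter.1 hp).2.pos; positivity)] at h4
    simpa [Real.log_pow] using h4
  have hth : (∑ p ∈ (Icc 1 N).filter Nat.Prime, Real.log p) ≤ Real.log 4 * N := by
    have := Chebyshev.theta_le_log4_mul_x (x := (N : ℝ)) (Nat.cast_nonneg N)
    rw [Chebyshev.theta_eq_sum_Icc, Nat.floor_natCast] at this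
    refine le_trans (Finset.sum_le_sum_of_subset_of_nonneg ?_ ?_) this
    · exact Finset.filter_subset_filter _ (Finset.Icc_subset_Icc_left (by norm_num))
    · intro p hp _; exact Real.log_natCast_nonneg p
  have hkey : (N : ℝ) * ∑ p ∈ (Icc 1 N).filter Nat.Prime, Real.log p / p ≤
      N * Real.log N + Real.log 4 * N := by
    refine le_trans ?_ (add_le_add hle hth)
    rw [Finset.mul_sum, ← Finset.sum_add_distrib]
    refine Finset.sum_le_sum fun p hp => ?_
    have hp0 : (0 : ℝ) < p := by exact_mod_cast (mem_filter.1 hp).2.pos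
    have h1 : (N : ℝ) / p ≤ ((N / p : ℕ) : ℝ) + 1 := by
      rw [← Nat.floor_div_eq_div (K := ℝ)]
      exact (Nat.lt_floor_add_one _).le
    have h2 : (0 : ℝ) ≤ Real.log p := Real.log_natCast_nonneg p
    calc (N : ℝ) * (Real.log p / p) = N / p * Real.log p := by ring
      _ ≤ (((N / p : ℕ) : ℝ) + 1) * Real.log p := mul_le_mul_of_nonneg_right h1 h2
      _ = _ := by ring
  rw [mul_comm (Real.log 4), ← mul_add] at hkey
  exact le_of_mul_le_mul_left hkey hN0

theorem sum_rpow_neg_le {s : ℝ} (hs0 : 0 < s) (hs1 : s < 1) (N : ℕ) :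
    ∑ m ∈ Icc 1 N, (m : ℝ) ^ (-s) ≤ 1 / (1 - s) * (N : ℝ) ^ (1 - s) := by
  induction N with
  | zero => simp [Real.zero_rpow (by linarith : (1 - s) ≠ 0)]
  | succ N ih =>
    rw [Finset.sum_Icc_succ_top (by omega)]
    have h0 : (0 : ℝ) < ((N + 1 : ℕ) : ℝ) := by positivity
    set M : ℝ := ((N + 1 : ℕ) : ℝ) with hM
    have hNM : (N : ℝ) = M * (1 + (-(1 / M))) := by
      rw [hM]; push_cast; field_simp; ring
    have hM1 : 1 ≤ M := by rw [hM]; push_cast; linarith [(Nat.cast_nonneg N : (0 : ℝ) ≤ N)]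
    have hm1 : -1 ≤ -(1 / M) := by
      rw [neg_le_neg_iff, div_le_one h0]; exact hM1
    have h1 := _root_.rpow_one_add_le_one_add_mul_self hm1 (p := 1 - s) (by linarith) (by linarith)
    have h2 : (N : ℝ) ^ (1 - s) ≤ M ^ (1 - s) * (1 + (1 - s) * (-(1 / M))) := by
      rw [hNM, Real.mul_rpow h0.le (by linarith)]
      exact mul_le_mul_of_nonneg_left h1 (by positivity)
    have h3 : M ^ (1 - s) * (1 / M) = M ^ (-s) := by
      rw [show (1 - s) = -s + 1 by ring, Real.rpow_add h0, Real.rpow_one]; field_simp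
    have h4 : (0 : ℝ) < 1 - s := by linarith
    have h5 : (N : ℝ) ^ (1 - s) ≤ M ^ (1 - s) - (1 - s) * M ^ (-s) := by
      rw [← h3]; linarith
    have h6 : 1 / (1 - s) * (N : ℝ) ^ (1 - s) ≤ 1 / (1 - s) * M ^ (1 - s) - M ^ (-s) := by
      calc 1 / (1 - s) * (N : ℝ) ^ (1 - s) ≤ 1 / (1 - s) * (M ^ (1 - s) - (1 - s) * M ^ (-s)) :=
            mul_le_mul_of_nonneg_left h5 (by positivity)
        _ = _ := by field_simp
    linarith

theorem sum_factored_le_prod_tsum {g : ℕ → ℝ} (hg : ∀ n, 0 ≤ g n) (hg1 : g 1 = 1)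
    (hmul : ∀ {m n : ℕ}, m.Coprime n → g (m * n) = g m * g n)
    (hsum : ∀ {p : ℕ}, p.Prime → Summable fun n => g (p ^ n))
    (T B : Finset ℕ) (hB : ∀ b ∈ B, b ∈ Nat.factoredNumbers T) :
    ∑ b ∈ B, g b ≤ ∏ p ∈ T.filter Nat.Prime, ∑' n, g (p ^ n) := by
  classical
  obtain ⟨h1, h2⟩ := EulerProduct.summable_and_hasSum_factoredNumbers_prod_filter_prime_tsum
    (f := g) hg1 hmul (fun hp => (hsum hp).congr fun n => by
      rw [Real.norm_of_nonneg (hg _)]) T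
  have h4 : ∑ b ∈ B, g b = ∑ b ∈ B.subtype (· ∈ Nat.factoredNumbers T), g b := by
    rw [Finset.sum_subtype_eq_sum_filter, Finset.filter_true_of_mem hB]
  rw [h4]
  exact sum_le_hasSum _ (fun b _ => hg b) h2

/-- The sum is dominated by an Euler product over primes up to `w`; each factor is at most `exp(A
p^(-s))`, and the sum over primes is bounded by that over all integers. This crude form is what
every later count of very smooth numbers uses. -/
theorem exists_sum_smooth_rpow_le {s : ℝ} (hs0 : 0 < s) (hs1 : s < 1) :
    ∃ C : ℝ, 0 < C ∧ ∀ (w : ℝ) (B : Finset ℕ), 0 ≤ w →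
      (∀ b ∈ B, b ≠ 0 ∧ ∀ p : ℕ, p.Prime → p ∣ b → (p : ℝ) ≤ w) →
      ∑ b ∈ B, (b : ℝ) ^ (-s) ≤ Real.exp (C * w ^ (1 - s)) := by
  have h2s : (2 : ℝ) ^ (-s) < 1 := Real.rpow_lt_one_of_one_lt_of_neg (by norm_num) (by linarith)
  set A : ℝ := 1 / (1 - (2 : ℝ) ^ (-s)) with hA
  have hA0 : 0 < A := by have : 0 < 1 - (2 : ℝ) ^ (-s) := by linarith
                         positivity
  have h1s : 0 < 1 - s := by linarith
  refine ⟨A * (1 / (1 - s)), by positivity, fun w B hw hB => ?_⟩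
  have hpow : ∀ p n : ℕ, (((p ^ n : ℕ) : ℝ)) ^ (-s) = ((p : ℝ) ^ (-s)) ^ n := by
    intro p n
    push_cast
    rw [← Real.rpow_natCast, ← Real.rpow_natCast, ← Real.rpow_mul (by positivity),
      ← Real.rpow_mul (by positivity), mul_comm]
  have hlt : ∀ p : ℕ, p.Prime → (p : ℝ) ^ (-s) ≤ 2 ^ (-s) := fun p hp =>
    Real.rpow_le_rpow_of_nonpos (by norm_num) (by exact_mod_cast hp.two_le) (by linarith)
  have h1 := sum_factored_le_prod_tsum (g := fun n => (n : ℝ) ^ (-s)) (fun n => by positivity)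
    (by simp) (fun {m n} _ => by
      push_cast; exact Real.mul_rpow (by positivity) (by positivity))
    (fun {p} hp => by
      simp_rw [hpow]
      exact summable_geometric_of_lt_one (by positivity) ((hlt p hp).trans_lt h2s))
    (Icc 1 ⌊w⌋₊) B (fun b hb => by
      rw [Nat.mem_factoredNumbers']
      intro p hp hpb
      exact mem_Icc.2 ⟨hp.one_le, Nat.le_floor ((hB b hb).2 p hp hpb)⟩)
  refine h1.trans ?_
  have h3 : ∀ p ∈ (Icc 1 ⌊w⌋₊).filter Nat.Prime, ∑' n, (((p ^ n : ℕ) : ℝ)) ^ (-s) ≤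
      Real.exp (A * (p : ℝ) ^ (-s)) := by
    intro p hp
    have hpp := (mem_filter.1 hp).2
    have hl := hlt p hpp
    simp_rw [hpow]
    rw [tsum_geometric_of_lt_one (by positivity) (hl.trans_lt h2s)]
    set t : ℝ := (p : ℝ) ^ (-s) with ht
    have ht0 : 0 ≤ t := by positivity
    have ht1 : 0 < 1 - t := by linarith
    refine le_trans ?_ (Real.add_one_le_exp _)
    have : (1 - t)⁻¹ = 1 / (1 - t) * t + 1 := by field_simp; ring
    rw [this]
    gcongr
    rw [hA]
    exact one_div_le_one_div_of_le (by linarith) (by linarith)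
  refine (Finset.prod_le_prod (fun p _ => tsum_nonneg fun n => by positivity) h3).trans ?_
  rw [← Real.exp_sum, Real.exp_le_exp, ← Finset.mul_sum, mul_assoc]
  refine mul_le_mul_of_nonneg_left ?_ hA0.le
  calc ∑ p ∈ (Icc 1 ⌊w⌋₊).filter Nat.Prime, (p : ℝ) ^ (-s) ≤
        ∑ p ∈ (Icc 1 ⌊w⌋₊), (p : ℝ) ^ (-s) :=
        Finset.sum_le_sum_of_subset_of_nonneg (Finset.filter_subset _ _) fun _ _ _ => by positivity
    _ ≤ 1 / (1 - s) * (⌊w⌋₊ : ℝ) ^ (1 - s) := sum_rpow_neg_le hs0 hs1 _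
    _ ≤ _ := by
      gcongr
      exact Nat.floor_le hw

/-- The largest divisor of `n` composed of primes satisfying `S`. -/
noncomputable def primePart (S : ℕ → Prop) (n : ℕ) : ℕ :=
  open Classical in ∏ p ∈ n.primeFactors.filter S, p ^ n.factorization p

theorem primePart_ne_zero (S : ℕ → Prop) (n : ℕ) : primePart S n ≠ 0 := by
  classical
  exact Finset.prod_ne_zero_iff.2 fun p hp =>
    pow_ne_zero _ (Nat.prime_of_mem_primeFactors (mem_filter.1 hp).1).ne_zero

theorem primePart_mul_primePart_not (S : ℕ → Prop) {n : ℕ} (hn : n ≠ 0) :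
    primePart S n * primePart (fun p => ¬ S p) n = n := by
  classical
  rw [primePart, primePart, Finset.prod_filter_mul_prod_filter_not]
  exact Nat.prod_factorization_pow_eq_self hn

theorem of_prime_dvd_primePart {S : ℕ → Prop} {n p : ℕ} (hp : p.Prime) (h : p ∣ primePart S n) :
    S p ∧ p ∣ n := by
  classical
  obtain ⟨q, hq, hpq⟩ := (hp.prime.dvd_finsetProd_iff _).1 h
  rw [mem_filter] at hq
  have := (Nat.prime_dvd_prime_iff_eq hp (Nat.prime_of_mem_primeFactors hq.1)).1
    (hp.dvd_of_dvd_pow hpq)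
  subst this
  exact ⟨hq.2, Nat.dvd_of_mem_primeFactors hq.1⟩

theorem coprime_primePart (S : ℕ → Prop) (n : ℕ) :
    (primePart S n).Coprime (primePart (fun p => ¬ S p) n) := by
  refine Nat.Coprime.symm (Nat.coprime_of_dvd fun p hp h1 h2 => ?_)
  exact (of_prime_dvd_primePart hp h1).1 (of_prime_dvd_primePart hp h2).1

/-- An integer is determined by its `S`-part and its complementary part, so the sum is part of the
expanded product of the two sums. -/
theorem sum_le_sum_image_mul_sum_image {g : ℕ → ℝ} (hg : ∀ n, 0 ≤ g n)
    (hmul : ∀ {m n : ℕ}, m.Coprime n → g (m * n) = g m * g n) (S : ℕ → Prop) (B : Finset ℕ)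
    (hB : ∀ b ∈ B, b ≠ 0) :
    ∑ b ∈ B, g b ≤ (∑ b ∈ B.image (primePart S), g b) *
      ∑ b ∈ B.image (primePart fun p => ¬ S p), g b := by
  rw [Finset.sum_mul_sum, ← Finset.sum_product']
  have h1 : ∑ b ∈ B, g b = ∑ b ∈ B, g (primePart S b) * g (primePart (fun p => ¬ S p) b) := by
    refine Finset.sum_congr rfl fun b hb => ?_
    rw [← hmul (coprime_primePart S b), primePart_mul_primePart_not S (hB b hb)]
  have hinj : Set.InjOn (fun b => (primePart S b, primePart (fun p => ¬ S p) b)) (B : Set ℕ) := by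
    intro a ha b hb hab
    rw [Prod.mk.injEq] at hab
    rw [← primePart_mul_primePart_not S (hB a ha), hab.1, hab.2,
      primePart_mul_primePart_not S (hB b hb)]
  rw [h1, ← Finset.sum_image (f := fun x : ℕ × ℕ => g x.1 * g x.2) hinj]
  refine Finset.sum_le_sum_of_subset_of_nonneg ?_ fun x _ _ => mul_nonneg (hg _) (hg _)
  intro x hx
  obtain ⟨b, hb, rfl⟩ := mem_image.1 hx
  exact mem_product.2 ⟨mem_image_of_mem _ hb, mem_image_of_mem _ hb⟩

/-- Writing `p^σ = (w^σ)^(log p / log w)`, Bernoulli's inequality gives `p^σ - 1 ≤ (log p / log w)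
w^σ`, which reduces the sum to Mertens' bound. The 3 comes from `log w + log 4 ≤ 3 log w` for `w ≥
2`. -/
theorem sum_prime_rpow_sub_one_div_le {σ w : ℝ} (hσ : 0 ≤ σ) (hw : 0 ≤ w) :
    ∑ p ∈ (Icc 1 ⌊w⌋₊).filter Nat.Prime, ((p : ℝ) ^ σ - 1) / p ≤ 3 * w ^ σ := by
  rcases lt_or_ge w 2 with h2 | h2
  · have h1 : (Icc 1 ⌊w⌋₊).filter Nat.Prime = ∅ := by
      refine Finset.filter_eq_empty_iff.2 fun p hp hpp => ?_
      have h3 : ⌊w⌋₊ < 2 := (Nat.floor_lt hw).2 (by exact_mod_cast h2)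
      have := (mem_Icc.1 hp).2
      have := hpp.two_le
      omega
    rw [h1, Finset.sum_empty]; positivity
  have hw0 : 0 < w := by linarith
  have hlw : Real.log 2 ≤ Real.log w := Real.log_le_log (by norm_num) h2
  have hl2 : 0 < Real.log 2 := Real.log_pos (by norm_num)
  have hlw0 : 0 < Real.log w := hl2.trans_le hlw
  have hf1 : 1 ≤ ⌊w⌋₊ := Nat.le_floor (by norm_num; linarith)
  have key : ∀ p ∈ (Icc 1 ⌊w⌋₊).filter Nat.Prime, ((p : ℝ) ^ σ - 1) / p ≤
      w ^ σ / Real.log w * (Real.log p / p) := by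
    intro p hp
    rw [mem_filter, mem_Icc] at hp
    have hp0 : (0 : ℝ) < p := by exact_mod_cast hp.2.pos
    have hpw : (p : ℝ) ≤ w := (Nat.cast_le.2 hp.1.2).trans (Nat.floor_le hw)
    have hp1 : (1 : ℝ) ≤ p := by exact_mod_cast hp.1.1
    have hlp : 0 ≤ Real.log p := Real.log_nonneg hp1
    have h1 : (p : ℝ) ^ σ = (1 + (w ^ σ - 1)) ^ (Real.log p / Real.log w) := by
      rw [show 1 + (w ^ σ - 1) = w ^ σ by ring, ← Real.rpow_mul hw, Real.rpow_def_of_pos hp0,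
        Real.rpow_def_of_pos hw0]
      congr 1
      field_simp
    have h3 : 1 ≤ w ^ σ := Real.one_le_rpow (by linarith) hσ
    have h4 := _root_.rpow_one_add_le_one_add_mul_self (s := w ^ σ - 1) (by linarith)
      (p := Real.log p / Real.log w) (by positivity)
      (by rw [div_le_one hlw0]; exact Real.log_le_log hp0 hpw)
    rw [← h1] at h4
    rw [← mul_div_assoc, div_le_div_iff_of_pos_right hp0]
    have h5 : (0 : ℝ) ≤ Real.log p / Real.log w := by positivity
    calc (p : ℝ) ^ σ - 1 ≤ Real.log p / Real.log w * (w ^ σ - 1) := by linarith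
      _ ≤ Real.log p / Real.log w * w ^ σ := mul_le_mul_of_nonneg_left (by linarith) h5
      _ = _ := by ring
  refine (Finset.sum_le_sum key).trans ?_
  rw [← Finset.mul_sum]
  have h6 := sum_log_div_prime_le ⌊w⌋₊ hf1
  have h7 : Real.log (⌊w⌋₊ : ℝ) ≤ Real.log w :=
    Real.log_le_log (by exact_mod_cast hf1) (Nat.floor_le hw)
  have h8 : Real.log 4 = 2 * Real.log 2 := by
    rw [show (4 : ℝ) = 2 ^ 2 by norm_num, Real.log_pow]; norm_num
  calc w ^ σ / Real.log w * ∑ p ∈ (Icc 1 ⌊w⌋₊).filter Nat.Prime, Real.log p / p ≤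
      w ^ σ / Real.log w * (3 * Real.log w) :=
        mul_le_mul_of_nonneg_left (by linarith) (by positivity)
    _ = _ := by field_simp

/-- The Rankin-shifted sum is compared with `exp(∑ f(p)/p)`, and the loss must be only linear in `H`
in the exponent, since `H` may grow. Primes up to `(2H)^2` are handled by the growth bound on `f`;
beyond them the Euler factors are controlled by a geometric series in `H p^(-7/8)`. -/
theorem exists_sum_smooth_mul_rpow_le : ∃ C : ℝ, 0 < C ∧
    ∀ (f : ArithmeticFunction ℝ) (H G : ℝ), f.IsMultiplicative → (∀ n, 0 ≤ f n) → 1 ≤ H → 1 ≤ G →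
    (∀ p l : ℕ, p.Prime → 1 ≤ l → f (p ^ l) ≤ H ^ l) →
    (∀ n : ℕ, 1 ≤ n → f n ≤ G * (n : ℝ) ^ (1 / 8 : ℝ)) →
    ∀ (k : ℕ) (σ w : ℝ) (B : Finset ℕ), 0 ≤ σ → σ ≤ 1 / 8 → 1 ≤ w →
    (∀ b ∈ B, b ≠ 0 ∧ b.Coprime k ∧ ∀ p : ℕ, p.Prime → p ∣ b → (p : ℝ) ≤ w) →
    ∑ b ∈ B, f b * (b : ℝ) ^ (σ - 1) ≤ G * Real.exp (C * H * w ^ σ + primeSum f w k) := by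
  classical
  obtain ⟨C, hC, hsm⟩ := exists_sum_smooth_rpow_le (s := 3 / 4) (by norm_num) (by norm_num)
  have hZs : Summable fun n : ℕ => (n : ℝ) ^ (-(5 / 4) : ℝ) :=
    Real.summable_nat_rpow.2 (by norm_num)
  set Z : ℝ := ∑' n : ℕ, (n : ℝ) ^ (-(5 / 4) : ℝ) with hZ
  have hZ0 : 0 ≤ Z := tsum_nonneg fun n => by positivity
  refine ⟨2 * C + Z + 3, by positivity, ?_⟩
  intro f H G hf hf0 hH hG hpp hgr k σ w B hσ0 hσ1 hw hB
  set g : ℕ → ℝ := fun n => f n * (n : ℝ) ^ (σ - 1) with hgdef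
  have hg0 : ∀ n, 0 ≤ g n := fun n => mul_nonneg (hf0 n) (by positivity)
  have hgmul : ∀ {m n : ℕ}, m.Coprime n → g (m * n) = g m * g n := by
    intro m n hmn
    simp only [hgdef]
    rw [hf.map_mul_of_coprime hmn, Nat.cast_mul, Real.mul_rpow (by positivity) (by positivity)]
    ring
  have hg1 : g 1 = 1 := by simp [hgdef, hf.map_one]
  have hggr : ∀ n : ℕ, 1 ≤ n → g n ≤ G * (n : ℝ) ^ (-(3 / 4) : ℝ) := by
    intro n hn
    have hn0 : (0 : ℝ) < n := by exact_mod_cast hn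
    have hn1 : (1 : ℝ) ≤ n := by exact_mod_cast hn
    calc g n ≤ G * (n : ℝ) ^ (1 / 8 : ℝ) * (n : ℝ) ^ (σ - 1) :=
          mul_le_mul_of_nonneg_right (hgr n hn) (by positivity)
      _ = G * (n : ℝ) ^ (1 / 8 + (σ - 1)) := by rw [mul_assoc, ← Real.rpow_add hn0]
      _ ≤ _ := by
        gcongr
        linarith
  have hgpp : ∀ p n : ℕ, p.Prime → 1 ≤ n → g (p ^ n) ≤ (H * (p : ℝ) ^ (-(7 / 8) : ℝ)) ^ n := by
    intro p n hp hn
    have hp1 : (1 : ℝ) ≤ p := by exact_mod_cast hp.one_le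
    have h1 : (((p ^ n : ℕ) : ℝ)) ^ (σ - 1) = ((p : ℝ) ^ (σ - 1)) ^ n := by
      push_cast
      rw [← Real.rpow_natCast, ← Real.rpow_natCast, ← Real.rpow_mul (by positivity),
        ← Real.rpow_mul (by positivity), mul_comm]
    simp only [hgdef]
    rw [h1, mul_pow]
    refine mul_le_mul (hpp p n hp hn) ?_ (by positivity) (by positivity)
    gcongr
    linarith
  have hsum : ∀ {p : ℕ}, p.Prime → Summable fun n => g (p ^ n) := by
    intro p hp
    have hlt : (p : ℝ) ^ (-(3 / 4) : ℝ) < 1 :=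
      Real.rpow_lt_one_of_one_lt_of_neg (by exact_mod_cast hp.one_lt) (by norm_num)
    refine Summable.of_nonneg_of_le (fun n => hg0 _) (fun n => ?_)
      ((summable_geometric_of_lt_one (by positivity) hlt).mul_left G)
    refine (hggr _ (Nat.one_le_pow _ _ hp.pos)).trans (le_of_eq ?_)
    push_cast
    rw [← Real.rpow_natCast, ← Real.rpow_natCast, ← Real.rpow_mul (by positivity),
        ← Real.rpow_mul (by positivity), mul_comm (n : ℝ)]
  -- Beyond this threshold `2H ≤ √p`, which makes the geometric ratio at most 1/2; below it the
  -- smooth sum costs only `exp(2CH)`.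
  set S : ℕ → Prop := fun p => (p : ℝ) ≤ (2 * H) ^ 2 with hS
  have hsplit := sum_le_sum_image_mul_sum_image hg0 hgmul S B fun b hb => (hB b hb).1
  -- the part composed of small primes
  have hsmall : ∑ b ∈ B.image (primePart S), g b ≤ G * Real.exp (2 * C * H) := by
    have h1 := hsm ((2 * H) ^ 2) (B.image (primePart S)) (by positivity) (by
      intro b hb
      obtain ⟨a, ha, rfl⟩ := mem_image.1 hb
      exact ⟨primePart_ne_zero _ _, fun p hp hpb => (of_prime_dvd_primePart hp hpb).1⟩)
    have h2 : ((2 * H) ^ 2) ^ (1 - 3 / 4 : ℝ) ≤ 2 * H := by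
      rw [← Real.rpow_natCast, ← Real.rpow_mul (by positivity)]
      calc (2 * H) ^ (((2 : ℕ) : ℝ) * (1 - 3 / 4)) ≤ (2 * H) ^ (1 : ℝ) :=
            Real.rpow_le_rpow_of_exponent_le (by linarith) (by norm_num)
        _ = _ := Real.rpow_one _
    calc ∑ b ∈ B.image (primePart S), g b ≤
        ∑ b ∈ B.image (primePart S), G * (b : ℝ) ^ (-(3 / 4) : ℝ) := by
          refine Finset.sum_le_sum fun b hb => hggr b ?_
          obtain ⟨a, ha, rfl⟩ := mem_image.1 hb
          exact Nat.one_le_iff_ne_zero.2 (primePart_ne_zero _ _)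
      _ ≤ G * Real.exp (2 * C * H) := by
        rw [← Finset.mul_sum]
        refine mul_le_mul_of_nonneg_left (h1.trans (Real.exp_le_exp.2 ?_)) (by linarith)
        nlinarith
  -- the part composed of large primes
  set T : Finset ℕ := (Icc 1 ⌊w⌋₊).filter fun p => (p.Prime ∧ ¬ p ∣ k) ∧ ¬ S p with hT
  have hw0 : 0 ≤ w := by linarith
  have hlarge : ∑ b ∈ B.image (primePart fun p => ¬ S p), g b ≤
      Real.exp ((Z + 3) * H * w ^ σ + primeSum f w k) := by
    have h1 := sum_factored_le_prod_tsum hg0 hg1 hgmul hsum T (B.image (primePart fun p => ¬ S p))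
      (by
        intro b hb
        obtain ⟨a, ha, rfl⟩ := mem_image.1 hb
        rw [Nat.mem_factoredNumbers']
        intro p hp hpb
        obtain ⟨hps, hpa⟩ := of_prime_dvd_primePart hp hpb
        obtain ⟨-, hc, hle⟩ := hB a ha
        refine mem_filter.2 ⟨mem_Icc.2 ⟨hp.one_le, Nat.le_floor (hle p hp hpa)⟩, ⟨hp, ?_⟩, hps⟩
        intro hpk
        exact hp.one_lt.ne' (Nat.dvd_one.1 (hc ▸ Nat.dvd_gcd hpa hpk)))
    refine h1.trans ?_
    have h2 : T.filter Nat.Prime = T :=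
      Finset.filter_true_of_mem fun p hp => (mem_filter.1 hp).2.1.1
    rw [h2]
    have hloc : ∀ p ∈ T, ∑' n, g (p ^ n) ≤ Real.exp (f p / p + H * (((p : ℝ) ^ σ - 1) / p) +
        H * (p : ℝ) ^ (-(5 / 4) : ℝ)) := by
      intro p hp
      obtain ⟨hp1, ⟨hpp', -⟩, hps⟩ := mem_filter.1 hp
      have hp0 : (0 : ℝ) < p := by exact_mod_cast hpp'.pos
      have hp1 : (1 : ℝ) ≤ p := by exact_mod_cast hpp'.one_le
      have hps : (2 * H) ^ 2 ≤ (p : ℝ) := (not_le.1 hps).le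
      have hps2 : 2 * H ≤ (p : ℝ) ^ (1 / 2 : ℝ) := by
        rw [← Real.sqrt_eq_rpow]; exact Real.le_sqrt_of_sq_le hps
      set t : ℝ := H * (p : ℝ) ^ (-(7 / 8) : ℝ) with ht
      have ht0 : 0 ≤ t := by positivity
      have hth : t ≤ 1 / 2 := by
        have : (p : ℝ) ^ (-(7 / 8) : ℝ) ≤ (p : ℝ) ^ (-(1 / 2) : ℝ) :=
          Real.rpow_le_rpow_of_exponent_le hp1 (by norm_num)
        calc t ≤ H * (p : ℝ) ^ (-(1 / 2) : ℝ) := mul_le_mul_of_nonneg_left this (by linarith)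
          _ ≤ ((p : ℝ) ^ (1 / 2 : ℝ) / 2) * (p : ℝ) ^ (-(1 / 2) : ℝ) := by
            gcongr; linarith
          _ = 1 / 2 := by
            rw [div_mul_eq_mul_div, ← Real.rpow_add hp0]; norm_num
      have htail : ∑' n, g (p ^ (n + 2)) ≤ 2 * t ^ 2 := by
        have h3 : ∀ n, g (p ^ (n + 2)) ≤ t ^ 2 * t ^ n := fun n =>
          (hgpp p (n + 2) hpp' (by omega)).trans (by rw [← ht, pow_add, mul_comm])
        have hs' := (summable_nat_add_iff 2).2 (hsum hpp')
        refine (hs'.tsum_le_tsum h3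
          ((summable_geometric_of_lt_one ht0 (by linarith)).mul_left _)).trans ?_
        rw [tsum_mul_left, tsum_geometric_of_lt_one ht0 (by linarith), mul_comm]
        refine mul_le_mul_of_nonneg_right ?_ (by positivity)
        rw [inv_le_comm₀ (by linarith) (by norm_num)]
        linarith
      -- One of the two factors `H` is absorbed by `p^(-1/2)`, keeping the dependence on `H` linear,
      -- and the remaining exponent `5/4` still gives a convergent sum.
      have ht2 : 2 * t ^ 2 ≤ H * (p : ℝ) ^ (-(5 / 4) : ℝ) := by
        have h4 : ((p : ℝ) ^ (-(7 / 8) : ℝ)) ^ 2 =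
            (p : ℝ) ^ (-(1 / 2) : ℝ) * (p : ℝ) ^ (-(5 / 4) : ℝ) := by
          rw [← Real.rpow_natCast, ← Real.rpow_mul hp0.le, ← Real.rpow_add hp0]; norm_num
        have h5 : 2 * H * (p : ℝ) ^ (-(1 / 2) : ℝ) ≤ 1 := by
          calc 2 * H * (p : ℝ) ^ (-(1 / 2) : ℝ) ≤
              (p : ℝ) ^ (1 / 2 : ℝ) * (p : ℝ) ^ (-(1 / 2) : ℝ) :=
                mul_le_mul_of_nonneg_right hps2 (by positivity)
            _ = 1 := by rw [← Real.rpow_add hp0]; norm_num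
        rw [ht, mul_pow, h4]
        calc 2 * (H ^ 2 * ((p : ℝ) ^ (-(1 / 2) : ℝ) * (p : ℝ) ^ (-(5 / 4) : ℝ))) =
            (2 * H * (p : ℝ) ^ (-(1 / 2) : ℝ)) * (H * (p : ℝ) ^ (-(5 / 4) : ℝ)) := by ring
          _ ≤ 1 * (H * (p : ℝ) ^ (-(5 / 4) : ℝ)) :=
            mul_le_mul_of_nonneg_right h5 (by positivity)
          _ = _ := one_mul _
      rw [← (hsum hpp').sum_add_tsum_nat_add 2, Finset.sum_range_succ, Finset.sum_range_one,
        pow_zero, pow_one, hg1]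
      have hgp : g p ≤ f p / p + H * (((p : ℝ) ^ σ - 1) / p) := by
        have h6 : f p ≤ H := by simpa using hpp p 1 hpp' le_rfl
        have h7 : 1 ≤ (p : ℝ) ^ σ := Real.one_le_rpow hp1 hσ0
        have h8 : g p = f p / p + f p * (((p : ℝ) ^ σ - 1) / p) := by
          simp only [hgdef]
          rw [Real.rpow_sub hp0, Real.rpow_one]; field_simp; ring
        rw [h8]
        have : 0 ≤ ((p : ℝ) ^ σ - 1) / p := div_nonneg (by linarith) hp0.le
        gcongr
      refine le_trans ?_ (Real.add_one_le_exp _)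
      linarith
    refine (Finset.prod_le_prod (fun p _ => tsum_nonneg fun n => hg0 _) hloc).trans ?_
    rw [← Real.exp_sum, Real.exp_le_exp, Finset.sum_add_distrib, Finset.sum_add_distrib,
      ← Finset.mul_sum, ← Finset.mul_sum]
    have h3 : ∑ p ∈ T, f p / (p : ℝ) ≤ primeSum f w k := by
      refine Finset.sum_le_sum_of_subset_of_nonneg ?_ fun p _ _ =>
        div_nonneg (hf0 p) (Nat.cast_nonneg p)
      intro p hp
      rw [mem_filter] at hp ⊢
      exact ⟨hp.1, hp.2.1⟩
    have h4 : ∑ p ∈ T, ((p : ℝ) ^ σ - 1) / p ≤ 3 * w ^ σ := by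
      refine le_trans (Finset.sum_le_sum_of_subset_of_nonneg ?_ ?_)
        (sum_prime_rpow_sub_one_div_le hσ0 hw0)
      · intro p hp
        rw [mem_filter] at hp ⊢
        exact ⟨hp.1, hp.2.1.1⟩
      · intro p hp _
        have hp1 : (1 : ℝ) ≤ p := by exact_mod_cast (mem_filter.1 hp).2.one_le
        exact div_nonneg (by linarith [Real.one_le_rpow hp1 hσ0]) (by linarith)
    have h5 : ∑ p ∈ T, (p : ℝ) ^ (-(5 / 4) : ℝ) ≤ Z :=
      hZs.sum_le_tsum _ fun n _ => by positivity
    have h6 : 1 ≤ w ^ σ := Real.one_le_rpow hw hσ0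
    have h7 : H * ∑ p ∈ T, ((p : ℝ) ^ σ - 1) / p ≤ H * (3 * w ^ σ) := by gcongr
    have h8 : H * ∑ p ∈ T, (p : ℝ) ^ (-(5 / 4) : ℝ) ≤ H * (Z * w ^ σ) := by
      gcongr
      nlinarith
    nlinarith
  have h6 : 1 ≤ w ^ σ := Real.one_le_rpow hw hσ0
  calc ∑ b ∈ B, f b * (b : ℝ) ^ (σ - 1) ≤ _ := hsplit
    _ ≤ G * Real.exp (2 * C * H) * Real.exp ((Z + 3) * H * w ^ σ + primeSum f w k) :=
      mul_le_mul hsmall hlarge (Finset.sum_nonneg fun n _ => hg0 n) (by positivity)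
    _ ≤ _ := by
      rw [mul_assoc, ← Real.exp_add]
      refine mul_le_mul_of_nonneg_left (Real.exp_le_exp.2 ?_) (by linarith)
      have : 2 * C * H * 1 ≤ 2 * C * H * w ^ σ := mul_le_mul_of_nonneg_left h6 (by positivity)
      nlinarith

/-! ### Counting in progressions and Selberg's sieve. -/

theorem abs_card_modEq_dvd_sub_le {k a m M N : ℕ} (hk : 0 < k) (hm : 0 < m) (hkm : k.Coprime m)
    (hMN : M ≤ N) :
    |((((Ico M N).filter fun n => n ≡ a [MOD k] ∧ m ∣ n).card : ℕ) : ℝ) -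
      ((N : ℝ) - M) / (k * m)| ≤ 1 := by
  obtain ⟨c, hc1, hc2⟩ := Nat.chineseRemainder hkm a 0
  have hfil : ((Ico M N).filter fun n => n ≡ a [MOD k] ∧ m ∣ n) =
      (Ico M N).filter fun n => n ≡ c [MOD (k * m)] := by
    refine Finset.filter_congr fun n _ => ?_
    rw [← Nat.modEq_and_modEq_iff_modEq_mul hkm, ← Nat.modEq_zero_iff_dvd]
    exact ⟨fun h => ⟨h.1.trans hc1.symm, h.2.trans hc2.symm⟩,
      fun h => ⟨h.1.trans hc1, h.2.trans hc2⟩⟩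
  have hr : 0 < k * m := Nat.mul_pos hk hm
  have hcard := Nat.Ico_filter_modEq_card M N hr c
  have hr' : (0 : ℚ) < ((k * m : ℕ) : ℚ) := by exact_mod_cast hr
  rw [hfil]
  set q : ℕ := ((Ico M N).filter fun n => n ≡ c [MOD (k * m)]).card with hq
  have hmono : ⌈((M : ℚ) - c) / ((k * m : ℕ) : ℚ)⌉ ≤ ⌈((N : ℚ) - c) / ((k * m : ℕ) : ℚ)⌉ := by
    refine Int.ceil_le_ceil ?_
    have : (M : ℚ) ≤ N := by exact_mod_cast hMN
    gcongr
  rw [max_eq_left (by linarith)] at hcard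
  set u : ℚ := ((M : ℚ) - c) / ((k * m : ℕ) : ℚ) with hu
  set v : ℚ := ((N : ℚ) - c) / ((k * m : ℕ) : ℚ) with hv
  have h1 := Int.le_ceil u
  have h2 := Int.ceil_lt_add_one u
  have h3 := Int.le_ceil v
  have h4 := Int.ceil_lt_add_one v
  have h5 : v - u = ((N : ℚ) - M) / (k * m) := by rw [hu, hv]; push_cast; ring
  have h6 : (q : ℚ) = (⌈v⌉ : ℚ) - ⌈u⌉ := by exact_mod_cast hcard
  have h7 : |(q : ℚ) - ((N : ℚ) - M) / (k * m)| ≤ 1 := by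
    rw [← h5, h6, abs_le]; constructor <;> linarith
  have h8 := (Rat.cast_le (K := ℝ)).2 h7
  push_cast at h8
  exact h8

/-- Separate from each `n` the part composed of primes dividing `k`; the Euler product over those
primes is exactly `k/φ(k)`. -/
theorem sum_inv_le_totient {k R : ℕ} (hk : 0 < k) :
    ∑ n ∈ Icc 1 R, (1 : ℝ) / n ≤
      k / k.totient * ∑ n ∈ (Icc 1 R).filter (Nat.Coprime k), (1 : ℝ) / n := by
  classical
  set g : ℕ → ℝ := fun n => 1 / (n : ℝ) with hg
  have hg0 : ∀ n, 0 ≤ g n := fun n => by positivity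
  have hmul : ∀ {m n : ℕ}, m.Coprime n → g (m * n) = g m * g n := by
    intro m n _
    simp only [hg]; push_cast; rw [div_mul_div_comm, one_mul]
  have hpow : ∀ p n : ℕ, g (p ^ n) = ((p : ℝ)⁻¹) ^ n := by
    intro p n
    simp only [hg]; push_cast; rw [inv_pow, one_div]
  have h1 := sum_le_sum_image_mul_sum_image hg0 hmul (· ∣ k) (Icc 1 R)
    (fun b hb => by have := (mem_Icc.1 hb).1; omega)
  have hlt : ∀ p : ℕ, p.Prime → (p : ℝ)⁻¹ < 1 := fun p hp =>
    inv_lt_one_of_one_lt₀ (by exact_mod_cast hp.one_lt)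
  have h2 := sum_factored_le_prod_tsum hg0 (by simp [hg]) hmul
    (fun {p} hp => by
      simp_rw [hpow]
      exact summable_geometric_of_lt_one (by positivity) (hlt p hp))
    k.primeFactors ((Icc 1 R).image (primePart (· ∣ k))) (by
      intro b hb
      obtain ⟨n, hn, rfl⟩ := mem_image.1 hb
      rw [Nat.mem_factoredNumbers']
      intro p hp hpb
      exact Nat.mem_primeFactors.2 ⟨hp, (of_prime_dvd_primePart hp hpb).1, hk.ne'⟩)
  have hφ0 : (0 : ℝ) < k.totient := by exact_mod_cast Nat.totient_pos.2 hk
  have hk0 : (0 : ℝ) < k := by exact_mod_cast hk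
  have h3 : ∏ p ∈ k.primeFactors.filter Nat.Prime, ∑' n, g (p ^ n) = k / k.totient := by
    rw [Finset.filter_true_of_mem fun p hp => Nat.prime_of_mem_primeFactors hp]
    have h4 : ∀ p ∈ k.primeFactors, ∑' n, g (p ^ n) = (1 - (p : ℝ)⁻¹)⁻¹ := by
      intro p hp
      simp_rw [hpow]
      exact tsum_geometric_of_lt_one (by positivity) (hlt p (Nat.prime_of_mem_primeFactors hp))
    rw [Finset.prod_congr rfl h4, Finset.prod_inv_distrib]
    have h5 := Nat.totient_eq_mul_prod_factors k
    have h6 : (k.totient : ℝ) = k * ∏ p ∈ k.primeFactors, (1 - (p : ℝ)⁻¹) := by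
      have h7 := congrArg (Rat.cast : ℚ → ℝ) h5
      push_cast at h7
      exact h7
    rw [h6, div_mul_eq_div_div, div_self hk0.ne', one_div]
  rw [h3] at h2
  refine h1.trans (mul_le_mul h2 ?_ (Finset.sum_nonneg fun n _ => hg0 n) (by positivity))
  refine Finset.sum_le_sum_of_subset_of_nonneg ?_ fun n _ _ => hg0 n
  intro b hb
  obtain ⟨n, hn, rfl⟩ := mem_image.1 hb
  have hn0 : n ≠ 0 := by have := (mem_Icc.1 hn).1; omega
  have hdvd : primePart (fun p => ¬ p ∣ k) n ∣ n :=
    ⟨primePart (· ∣ k) n, by rw [mul_comm]; exact (primePart_mul_primePart_not _ hn0).symm⟩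
  refine mem_filter.2 ⟨mem_Icc.2 ⟨Nat.one_le_iff_ne_zero.2 (primePart_ne_zero _ _), ?_⟩, ?_⟩
  · exact (Nat.le_of_dvd (by omega) hdvd).trans (mem_Icc.1 hn).2
  · refine Nat.coprime_of_dvd fun p hp hpk hpb => ?_
    exact (of_prime_dvd_primePart hp hpb).1 hpk

theorem sum_inv_sq_le_two (R : ℕ) : ∑ m ∈ Icc 1 R, (1 : ℝ) / (m : ℝ) ^ 2 ≤ 2 := by
  have h : ∀ R : ℕ, 1 ≤ R → ∑ m ∈ Icc 1 R, (1 : ℝ) / (m : ℝ) ^ 2 ≤ 2 - 1 / R := by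
    intro R hR
    induction R, hR using Nat.le_induction with
    | base => norm_num
    | succ n hn ih =>
      rw [Finset.sum_Icc_succ_top (by omega)]
      have hn0 : (0 : ℝ) < n := by exact_mod_cast hn
      have h1 : (1 : ℝ) / ((n + 1 : ℕ) : ℝ) ^ 2 ≤ 1 / n - 1 / ((n + 1 : ℕ) : ℝ) := by
        push_cast
        rw [div_sub_div _ _ hn0.ne' (by positivity), div_le_div_iff₀ (by positivity) (by positivity)]
        nlinarith
      linarith
  rcases Nat.eq_zero_or_pos R with h0 | h0
  · subst h0; simp
  · have := h R h0
    have h1 : (0 : ℝ) ≤ 1 / R := by positivity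
    linarith

/-- The squarefree numbers up to `R` that are coprime to `k`. -/
def sieveSupport (k R : ℕ) : Finset ℕ :=
  (Icc 1 R).filter fun l => Squarefree l ∧ k.Coprime l

/-- The normalising factor of the Selberg weights. -/
noncomputable def sieveMass (k R : ℕ) : ℝ := ∑ l ∈ sieveSupport k R, (1 : ℝ) / l

/-- Each integer is a square times a squarefree number; the reciprocal squares contribute at most 2,
and restricting to integers prime to `k` costs `k/φ(k)`. -/
theorem log_le_sieveMass {k R : ℕ} (hk : 0 < k) (hR : 1 ≤ R) :
    Real.log R ≤ 2 * (k / k.totient) * sieveMass k R := by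
  classical
  have hk0 : (0 : ℝ) ≤ (k : ℝ) / k.totient := by positivity
  have h1 : Real.log R ≤ ∑ n ∈ Icc 1 R, (1 : ℝ) / n := by
    have := log_add_one_le_harmonic R
    rw [harmonic_eq_sum_Icc] at this
    push_cast at this
    simp only [one_div]
    refine le_trans (Real.log_le_log (by exact_mod_cast hR) (by linarith)) this
  have h2 : ∑ n ∈ (Icc 1 R).filter (Nat.Coprime k), (1 : ℝ) / n ≤ sieveMass k R * 2 := by
    refine le_trans ?_ (mul_le_mul_of_nonneg_left (sum_inv_sq_le_two R)
      (Finset.sum_nonneg fun _ _ => by positivity))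
    rw [sieveMass, Finset.sum_mul_sum, ← Finset.sum_product']
    have hex : ∀ n : ℕ, ∃ x : ℕ × ℕ, n ≠ 0 → x.2 ^ 2 * x.1 = n ∧ Squarefree x.1 := by
      intro n
      obtain ⟨l, m, hlm, hl⟩ := Nat.sq_mul_squarefree n
      exact ⟨(l, m), fun _ => ⟨hlm, hl⟩⟩
    choose F hF using hex
    set A := (Icc 1 R).filter (Nat.Coprime k) with hA
    have hA0 : ∀ n ∈ A, n ≠ 0 := fun n hn => by
      have := (mem_Icc.1 (mem_filter.1 hn).1).1; omega
    have hinj : Set.InjOn F (A : Set ℕ) := by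
      intro n hn m hm hnm
      rw [← (hF n (hA0 n hn)).1, ← (hF m (hA0 m hm)).1, hnm]
    have h3 : ∑ n ∈ A, (1 : ℝ) / n = ∑ n ∈ A, 1 / ((F n).1 : ℝ) * (1 / ((F n).2 : ℝ) ^ 2) := by
      refine Finset.sum_congr rfl fun n hn => ?_
      conv_lhs => rw [← (hF n (hA0 n hn)).1]
      push_cast
      rw [div_mul_div_comm, one_mul, mul_comm]
    rw [h3, ← Finset.sum_image (f := fun x : ℕ × ℕ => 1 / (x.1 : ℝ) * (1 / (x.2 : ℝ) ^ 2)) hinj]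
    refine Finset.sum_le_sum_of_subset_of_nonneg ?_ fun x _ _ => by positivity
    intro x hx
    obtain ⟨n, hn, rfl⟩ := mem_image.1 hx
    obtain ⟨he, hs⟩ := hF n (hA0 n hn)
    have hn0 := hA0 n hn
    rw [hA, mem_filter, mem_Icc] at hn
    have hd1 : (F n).1 ∣ n := ⟨_, by rw [mul_comm]; exact he.symm⟩
    have hd2 : (F n).2 ∣ n := ((dvd_pow_self _ two_ne_zero).mul_right _).trans (dvd_of_eq he)
    have hnp : 0 < n := Nat.pos_of_ne_zero hn0
    refine mem_product.2 ⟨mem_filter.2 ⟨mem_Icc.2 ⟨Nat.pos_of_dvd_of_pos hd1 hnp,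
      (Nat.le_of_dvd hnp hd1).trans hn.1.2⟩, hs, hn.2.coprime_dvd_right hd1⟩,
      mem_Icc.2 ⟨Nat.pos_of_dvd_of_pos hd2 hnp, (Nat.le_of_dvd hnp hd2).trans hn.1.2⟩⟩
  calc Real.log R ≤ _ := h1
    _ ≤ _ := sum_inv_le_totient hk
    _ ≤ k / k.totient * (sieveMass k R * 2) := mul_le_mul_of_nonneg_left h2 hk0
    _ = _ := by ring

/-- The Selberg weights of level `R`, for sieving by primes not dividing `k`. -/
noncomputable def selbergWeight (k R d : ℕ) : ℝ :=
  d * ∑ l ∈ (sieveSupport k R).filter (d ∣ ·),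
    (ArithmeticFunction.moebius (l / d) : ℝ) *
      ((ArithmeticFunction.moebius l : ℝ) / (l * sieveMass k R))

theorem sieveMass_pos {k R : ℕ} (hR : 1 ≤ R) : 0 < sieveMass k R := by
  have h1 : (1 : ℕ) ∈ sieveSupport k R := by
    simp [sieveSupport, hR]
  refine Finset.sum_pos (fun l hl => ?_) ⟨1, h1⟩
  have : 0 < l := (mem_Icc.1 (mem_filter.1 hl).1).1
  positivity

theorem moebius_sq_of_mem_sieveSupport {k R l : ℕ} (hl : l ∈ sieveSupport k R) :
    (ArithmeticFunction.moebius l : ℝ) * ArithmeticFunction.moebius l = 1 := by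
  have h := ArithmeticFunction.moebius_sq_eq_one_of_squarefree (mem_filter.1 hl).2.1
  rw [← sq]
  exact_mod_cast h

theorem selbergWeight_one {k R : ℕ} (hR : 1 ≤ R) : selbergWeight k R 1 = 1 := by
  rw [selbergWeight, Finset.filter_true_of_mem fun l _ => one_dvd l, Nat.cast_one, one_mul]
  have h1 : ∀ l ∈ sieveSupport k R, (ArithmeticFunction.moebius (l / 1) : ℝ) *
      ((ArithmeticFunction.moebius l : ℝ) / (l * sieveMass k R)) =
      (1 : ℝ) / l * (sieveMass k R)⁻¹ := by
    intro l hl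
    rw [Nat.div_one, ← mul_div_assoc, moebius_sq_of_mem_sieveSupport hl]
    field_simp
  rw [Finset.sum_congr rfl h1, ← Finset.sum_mul]
  exact mul_inv_cancel₀ (sieveMass_pos hR).ne'

theorem abs_moebius_cast_le_one (n : ℕ) : |(ArithmeticFunction.moebius n : ℝ)| ≤ 1 := by
  exact_mod_cast ArithmeticFunction.abs_moebius_le_one (n := n)

/-- Bounding all Möbius values by 1 leaves at most `sieveMass / sieveMass`. This is weaker than the
classical bound by 1, but the sieve level is a small power, so the error `R^4` is harmless. -/
theorem abs_selbergWeight_le {k R : ℕ} (hR : 1 ≤ R) (d : ℕ) : |selbergWeight k R d| ≤ d := by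
  have hT := sieveMass_pos (k := k) hR
  rw [selbergWeight, abs_mul, Nat.abs_cast]
  refine mul_le_of_le_one_right (Nat.cast_nonneg d) ?_
  refine (Finset.abs_sum_le_sum_abs _ _).trans ?_
  calc ∑ l ∈ (sieveSupport k R).filter (d ∣ ·), |(ArithmeticFunction.moebius (l / d) : ℝ) *
      ((ArithmeticFunction.moebius l : ℝ) / (l * sieveMass k R))| ≤
      ∑ l ∈ (sieveSupport k R).filter (d ∣ ·), (1 : ℝ) / l * (sieveMass k R)⁻¹ := by
        refine Finset.sum_le_sum fun l _ => ?_
        rw [abs_mul, abs_div, abs_of_nonneg (show (0 : ℝ) ≤ l * sieveMass k R by positivity)]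
        calc |(ArithmeticFunction.moebius (l / d) : ℝ)| *
            (|(ArithmeticFunction.moebius l : ℝ)| / (l * sieveMass k R)) ≤
            1 * (1 / (l * sieveMass k R)) := by
              gcongr
              · exact abs_moebius_cast_le_one _
              · exact abs_moebius_cast_le_one _
          _ = _ := by rw [one_mul, one_div, mul_inv, one_div]
    _ ≤ ∑ l ∈ sieveSupport k R, (1 : ℝ) / l * (sieveMass k R)⁻¹ :=
        Finset.sum_le_sum_of_subset_of_nonneg (Finset.filter_subset _ _) fun _ _ _ => by positivity
    _ = 1 := by
        rw [← Finset.sum_mul]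
        exact mul_inv_cancel₀ hT.ne'

theorem coprime_of_selbergWeight_ne_zero {k R d : ℕ} (h : selbergWeight k R d ≠ 0) :
    k.Coprime d := by
  rw [selbergWeight] at h
  obtain ⟨l, hl, -⟩ := Finset.exists_ne_zero_of_sum_ne_zero (right_ne_zero_of_mul h)
  rw [mem_filter, sieveSupport, mem_filter] at hl
  exact hl.1.2.2.coprime_dvd_right hl.2

theorem sum_moebius_div_eq {R m l : ℕ} (hm : 1 ≤ m) (hl : 1 ≤ l) (hlR : l ≤ R) :
    ∑ d ∈ (Icc 1 R).filter (fun d => m ∣ d ∧ d ∣ l), (ArithmeticFunction.moebius (l / d) : ℝ) =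
      if l = m then 1 else 0 := by
  by_cases hml : m ∣ l
  · obtain ⟨t, rfl⟩ := hml
    have ht : 1 ≤ t := Nat.one_le_iff_ne_zero.2 (by rintro rfl; simp at hl)
    have himg : (Icc 1 R).filter (fun d => m ∣ d ∧ d ∣ m * t) = t.divisors.image (m * ·) := by
      ext d
      simp only [mem_filter, mem_Icc, mem_image, Nat.mem_divisors]
      constructor
      · rintro ⟨-, ⟨e, rfl⟩, h2⟩
        exact ⟨e, ⟨Nat.dvd_of_mul_dvd_mul_left hm h2, by omega⟩, rfl⟩
      · rintro ⟨e, ⟨he, -⟩, rfl⟩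
        have he0 : 0 < e := Nat.pos_of_dvd_of_pos he ht
        have h3 := mul_dvd_mul_left m he
        exact ⟨⟨Nat.mul_pos hm he0, (Nat.le_of_dvd hl h3).trans hlR⟩, dvd_mul_right _ _, h3⟩
    rw [himg, Finset.sum_image (fun a _ b _ hab => Nat.eq_of_mul_eq_mul_left hm hab)]
    have h1 : ∀ e ∈ t.divisors, (ArithmeticFunction.moebius (m * t / (m * e)) : ℝ) =
        (ArithmeticFunction.moebius (t / e) : ℝ) := fun e _ => by
      rw [Nat.mul_div_mul_left _ _ hm]
    rw [Finset.sum_congr rfl h1, Nat.sum_div_divisors t fun e => (ArithmeticFunction.moebius e : ℝ)]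
    have h2 := congrArg (fun F : ArithmeticFunction ℝ => F t)
      (ArithmeticFunction.coe_moebius_mul_coe_zeta (R := ℝ))
    simp only [ArithmeticFunction.coe_mul_zeta_apply, ArithmeticFunction.intCoe_apply,
      ArithmeticFunction.one_apply] at h2
    rw [h2]
    have : (m * t = m) ↔ t = 1 := by
      constructor
      · intro h; exact Nat.eq_of_mul_eq_mul_left hm (by rw [h, mul_one])
      · rintro rfl; exact mul_one m
    simp only [this]
  · rw [Finset.filter_false_of_mem fun d _ h => hml (h.1.trans h.2), Finset.sum_empty, if_neg]
    rintro rfl; exact hml dvd_rfl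

/-- Möbius inversion: the weights were defined so that these divisor sums, which diagonalize the
quadratic form, take the prescribed values `μ(m)/(m · sieveMass)`. -/
theorem sum_selbergWeight_div {k R m : ℕ} (hm : 1 ≤ m) :
    ∑ d ∈ (Icc 1 R).filter (m ∣ ·), selbergWeight k R d / d =
      if m ∈ sieveSupport k R then
        (ArithmeticFunction.moebius m : ℝ) / (m * sieveMass k R) else 0 := by
  have h1 : ∀ d ∈ (Icc 1 R).filter (m ∣ ·), selbergWeight k R d / d =
      ∑ l ∈ sieveSupport k R, if d ∣ l then (ArithmeticFunction.moebius (l / d) : ℝ) *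
      ((ArithmeticFunction.moebius l : ℝ) / (l * sieveMass k R)) else 0 := by
    intro d hd
    have hd0 : (d : ℝ) ≠ 0 := by
      have := (mem_Icc.1 (mem_filter.1 hd).1).1
      positivity
    rw [selbergWeight, mul_div_cancel_left₀ _ hd0, Finset.sum_filter]
  rw [Finset.sum_congr rfl h1, Finset.sum_comm]
  have h2 : ∀ l ∈ sieveSupport k R, (∑ d ∈ (Icc 1 R).filter (m ∣ ·),
      if d ∣ l then (ArithmeticFunction.moebius (l / d) : ℝ) *
      ((ArithmeticFunction.moebius l : ℝ) / (l * sieveMass k R)) else 0) =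
      if l = m then (ArithmeticFunction.moebius l : ℝ) / (l * sieveMass k R) else 0 := by
    intro l hl
    have hl1 := mem_Icc.1 (mem_filter.1 hl).1
    rw [← Finset.sum_filter, Finset.filter_filter, ← Finset.sum_mul,
      sum_moebius_div_eq hm hl1.1 hl1.2]
    split_ifs <;> simp
  rw [Finset.sum_congr rfl h2, Finset.sum_ite_eq']

/-- Since `1/lcm(d,e) = gcd(d,e)/(de)` and `gcd = ∑ φ(m)` over common divisors, the form becomes `∑
φ(m) (∑_{m ∣ d} λ_d/d)^2`. Using `1/m` where the optimal weights have `1/φ(m)` costs nothing here,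
because `φ(m) ≤ m`. -/
theorem selberg_quadratic_form_le {k R : ℕ} (hR : 1 ≤ R) :
    ∑ d ∈ Icc 1 R, ∑ e ∈ Icc 1 R,
      selbergWeight k R d * selbergWeight k R e / (Nat.lcm d e : ℝ) ≤ 1 / sieveMass k R := by
  have hT := sieveMass_pos (k := k) hR
  set w : ℕ → ℝ := fun d => selbergWeight k R d / d with hw
  have h1 : ∀ d ∈ Icc 1 R, ∀ e ∈ Icc 1 R,
      selbergWeight k R d * selbergWeight k R e / (Nat.lcm d e : ℝ) =
      ∑ m ∈ Icc 1 R, if m ∣ d ∧ m ∣ e then (m.totient : ℝ) * (w d * w e) else 0 := by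
    intro d hd e he
    rw [mem_Icc] at hd he
    have hd0 : (0 : ℝ) < d := by exact_mod_cast hd.1
    have he0 : (0 : ℝ) < e := by exact_mod_cast he.1
    have hg0 : 0 < Nat.gcd d e := Nat.gcd_pos_of_pos_left _ hd.1
    have h2 : ∑ m ∈ (Icc 1 R).filter (fun m => m ∣ d ∧ m ∣ e), m.totient = Nat.gcd d e := by
      rw [← Nat.sum_totient (Nat.gcd d e)]
      refine Finset.sum_congr ?_ fun _ _ => rfl
      ext m
      rw [mem_filter, Nat.mem_divisors, Nat.dvd_gcd_iff, mem_Icc]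
      constructor
      · rintro ⟨-, h⟩; exact ⟨h, hg0.ne'⟩
      · rintro ⟨h, -⟩
        exact ⟨⟨Nat.pos_of_dvd_of_pos h.1 hd.1, (Nat.le_of_dvd hd.1 h.1).trans hd.2⟩, h⟩
    have h3 : (Nat.gcd d e : ℝ) * (Nat.lcm d e : ℝ) = d * e := by
      exact_mod_cast Nat.gcd_mul_lcm d e
    have hl0 : (0 : ℝ) < (Nat.lcm d e : ℝ) := by exact_mod_cast Nat.lcm_pos hd.1 he.1
    rw [← Finset.sum_filter, ← Finset.sum_mul]
    have h4 : ∑ m ∈ (Icc 1 R).filter (fun m => m ∣ d ∧ m ∣ e), (m.totient : ℝ) = Nat.gcd d e := by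
      exact_mod_cast h2
    rw [h4, hw]
    rw [div_mul_div_comm, ← h3]
    have hg0' : (0 : ℝ) < (Nat.gcd d e : ℝ) := by exact_mod_cast hg0
    field_simp
  have h5 : ∑ d ∈ Icc 1 R, ∑ e ∈ Icc 1 R,
      selbergWeight k R d * selbergWeight k R e / (Nat.lcm d e : ℝ) =
      ∑ m ∈ Icc 1 R, (m.totient : ℝ) * (∑ d ∈ (Icc 1 R).filter (m ∣ ·), w d) ^ 2 := by
    rw [Finset.sum_congr rfl fun d hd => Finset.sum_congr rfl fun e he => h1 d hd e he]
    rw [Finset.sum_congr rfl fun d _ => Finset.sum_comm, Finset.sum_comm]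
    refine Finset.sum_congr rfl fun m _ => ?_
    rw [sq, Finset.sum_mul_sum, Finset.mul_sum, Finset.sum_filter]
    refine Finset.sum_congr rfl fun d _ => ?_
    by_cases hmd : m ∣ d
    · simp only [hmd, true_and, if_true]
      rw [← Finset.sum_filter, Finset.mul_sum]
    · simp [hmd]
  rw [h5]
  have h6 : ∀ m ∈ Icc 1 R, (m.totient : ℝ) * (∑ d ∈ (Icc 1 R).filter (m ∣ ·), w d) ^ 2 ≤
      if m ∈ sieveSupport k R then (1 : ℝ) / m * (1 / sieveMass k R ^ 2) else 0 := by
    intro m hm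
    have hm0 : (0 : ℝ) < m := by exact_mod_cast (mem_Icc.1 hm).1
    rw [hw, sum_selbergWeight_div (mem_Icc.1 hm).1]
    split_ifs with h
    · have h7 : ((ArithmeticFunction.moebius m : ℝ) / (m * sieveMass k R)) ^ 2 =
          1 / (m ^ 2 * sieveMass k R ^ 2) := by
        rw [div_pow, sq, moebius_sq_of_mem_sieveSupport h, mul_pow]
      rw [h7]
      have h8 : (m.totient : ℝ) ≤ m := by exact_mod_cast Nat.totient_le m
      calc (m.totient : ℝ) * (1 / (m ^ 2 * sieveMass k R ^ 2)) ≤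
          m * (1 / (m ^ 2 * sieveMass k R ^ 2)) := by gcongr
        _ = _ := by field_simp
    · simp
  refine (Finset.sum_le_sum h6).trans (le_of_eq ?_)
  rw [← Finset.sum_filter, Finset.filter_mem_eq_inter,
    Finset.inter_eq_right.2 (show sieveSupport k R ⊆ Icc 1 R from Finset.filter_subset _ _),
    ← Finset.sum_mul]
  change sieveMass k R * _ = _
  field_simp

/-- Selberg's upper bound sieve for the multiples `n` of `b` in an arithmetic progression such that
`n / b` has no prime factor up to `R`. -/
theorem card_rough_modEq_le {k a b M N R : ℕ} (hk : 0 < k) (hb : 0 < b) (hkb : k.Coprime b)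
    (hMN : M ≤ N) (hR : 2 ≤ R) (S : Finset ℕ) (hS : ∀ n ∈ S, n ∈ Ico M N ∧ n ≡ a [MOD k] ∧ b ∣ n ∧
      ∀ p : ℕ, p.Prime → p ≤ R → ¬ p ∣ n / b) :
    (S.card : ℝ) ≤
      2 * ((N : ℝ) - M) / (b * k.totient * Real.log R) + (R : ℝ) ^ 4 := by
  have hR1 : 1 ≤ R := by omega
  have hT := sieveMass_pos (k := k) hR1
  set lam := selbergWeight k R with hlam
  set A := (Ico M N).filter fun n => n ≡ a [MOD k] ∧ b ∣ n with hA
  have hb0 : (0 : ℝ) < b := by exact_mod_cast hb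
  have hk0 : (0 : ℝ) < k := by exact_mod_cast hk
  have hMN' : (0 : ℝ) ≤ (N : ℝ) - M := sub_nonneg.2 (by exact_mod_cast hMN)
  have h1 : (S.card : ℝ) ≤
      ∑ n ∈ A, (∑ d ∈ (Icc 1 R).filter (· ∣ n / b), lam d) ^ 2 := by
    rw [Finset.card_eq_sum_ones, Nat.cast_sum]
    refine le_trans (Finset.sum_le_sum fun n hn => ?_)
      (Finset.sum_le_sum_of_subset_of_nonneg (s := S) ?_ fun n _ _ => sq_nonneg _)
    · have h2 : (Icc 1 R).filter (· ∣ n / b) = {1} := by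
        ext d
        rw [mem_filter, mem_Icc, mem_singleton]
        constructor
        · rintro ⟨⟨h3, h4⟩, h5⟩
          by_contra hd1
          obtain ⟨p, hp, hpd⟩ := Nat.exists_prime_and_dvd hd1
          exact (hS n hn).2.2.2 p hp ((Nat.le_of_dvd h3 hpd).trans h4) (hpd.trans h5)
        · rintro rfl; exact ⟨⟨le_rfl, hR1⟩, one_dvd _⟩
      rw [h2, Finset.sum_singleton, hlam, selbergWeight_one hR1]
      norm_num
    · intro n hn
      obtain ⟨h3, h4, h5, -⟩ := hS n hn
      exact mem_filter.2 ⟨h3, h4, h5⟩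
  have h2 : ∑ n ∈ A, (∑ d ∈ (Icc 1 R).filter (· ∣ n / b), lam d) ^ 2 =
      ∑ d ∈ Icc 1 R, ∑ e ∈ Icc 1 R, lam d * lam e *
        ((((Ico M N).filter fun n => n ≡ a [MOD k] ∧ b * Nat.lcm d e ∣ n).card : ℕ) : ℝ) := by
    have h3 : ∀ n ∈ A, (∑ d ∈ (Icc 1 R).filter (· ∣ n / b), lam d) ^ 2 =
        ∑ d ∈ Icc 1 R, ∑ e ∈ Icc 1 R, if b * Nat.lcm d e ∣ n then lam d * lam e else 0 := by
      intro n hn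
      have hbn := (mem_filter.1 hn).2.2
      rw [sq, Finset.sum_mul_sum, Finset.sum_filter]
      refine Finset.sum_congr rfl fun d _ => ?_
      rw [Finset.sum_filter]
      simp only [← Nat.dvd_div_iff_mul_dvd hbn, Nat.lcm_dvd_iff]
      by_cases hd : d ∣ n / b <;> simp [hd]
    rw [Finset.sum_congr rfl h3, Finset.sum_comm]
    refine Finset.sum_congr rfl fun d _ => ?_
    rw [Finset.sum_comm]
    refine Finset.sum_congr rfl fun e _ => ?_
    rw [← Finset.sum_filter, Finset.sum_const, nsmul_eq_mul, mul_comm, hA, Finset.filter_filter]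
    congr 3
    refine Finset.filter_congr fun n _ => ?_
    exact ⟨fun h => ⟨h.1.1, h.2⟩, fun h => ⟨⟨h.1, (dvd_mul_right _ _).trans h.2⟩, h.2⟩⟩
  have h3 : ∀ d ∈ Icc 1 R, ∀ e ∈ Icc 1 R, lam d * lam e *
        ((((Ico M N).filter fun n => n ≡ a [MOD k] ∧ b * Nat.lcm d e ∣ n).card : ℕ) : ℝ) ≤
      ((N : ℝ) - M) / (k * b) * (lam d * lam e / (Nat.lcm d e : ℝ)) + (d : ℝ) * e := by
    intro d hd e he
    rw [mem_Icc] at hd he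
    have hde : |lam d * lam e| ≤ (d : ℝ) * e := by
      rw [abs_mul]
      exact mul_le_mul (abs_selbergWeight_le hR1 d) (abs_selbergWeight_le hR1 e) (abs_nonneg _)
        (Nat.cast_nonneg d)
    by_cases h0 : lam d * lam e = 0
    · rw [h0]; simp; positivity
    -- The weights live on integers prime to `k`, so whenever the coefficient is nonzero the
    -- congruence and divisibility conditions are independent.
    have hc : k.Coprime (b * Nat.lcm d e) := by
      refine hkb.mul_right (Nat.Coprime.coprime_dvd_right (Nat.lcm_dvd_mul d e) ?_)
      exact (coprime_of_selbergWeight_ne_zero (left_ne_zero_of_mul h0)).mul_right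
        (coprime_of_selbergWeight_ne_zero (right_ne_zero_of_mul h0))
    have hl0 : 0 < Nat.lcm d e := Nat.lcm_pos hd.1 he.1
    have h4 := abs_card_modEq_dvd_sub_le (a := a) hk (Nat.mul_pos hb hl0) hc hMN
    set q : ℝ := ((((Ico M N).filter fun n => n ≡ a [MOD k] ∧ b * Nat.lcm d e ∣ n).card : ℕ) : ℝ)
    have h5 : lam d * lam e * (q - ((N : ℝ) - M) / (k * (b * Nat.lcm d e : ℕ))) ≤ (d : ℝ) * e := by
      refine (le_abs_self _).trans ?_
      rw [abs_mul]
      calc |lam d * lam e| * _ ≤ |lam d * lam e| * 1 := by gcongr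
        _ ≤ _ := by rwa [mul_one]
    have hl0' : (0 : ℝ) < (Nat.lcm d e : ℝ) := by exact_mod_cast hl0
    have h6 : ((N : ℝ) - M) / (k * b) * (lam d * lam e / (Nat.lcm d e : ℝ)) =
        lam d * lam e * (((N : ℝ) - M) / (k * (b * Nat.lcm d e : ℕ))) := by
      push_cast; field_simp
    rw [h6]
    linarith
  have h4 : ∑ d ∈ Icc 1 R, ∑ e ∈ Icc 1 R, (d : ℝ) * e ≤ (R : ℝ) ^ 4 := by
    rw [← Finset.sum_mul_sum]
    have h5 : ∑ d ∈ Icc 1 R, (d : ℝ) ≤ (R : ℝ) ^ 2 := by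
      calc ∑ d ∈ Icc 1 R, (d : ℝ) ≤ ∑ d ∈ Icc 1 R, (R : ℝ) :=
            Finset.sum_le_sum fun d hd => by exact_mod_cast (mem_Icc.1 hd).2
        _ = _ := by rw [Finset.sum_const, Nat.card_Icc, nsmul_eq_mul, sq]; simp
    calc _ ≤ (R : ℝ) ^ 2 * (R : ℝ) ^ 2 := by gcongr
      _ = _ := by ring
  have h5 := selberg_quadratic_form_le (k := k) hR1
  have hφ0 : (0 : ℝ) < k.totient := by exact_mod_cast Nat.totient_pos.2 hk
  have hlR : 0 < Real.log R := Real.log_pos (by exact_mod_cast hR)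
  have h6 : ((N : ℝ) - M) / (k * b) * (1 / sieveMass k R) ≤
      2 * ((N : ℝ) - M) / (b * k.totient * Real.log R) := by
    have h7 := log_le_sieveMass hk hR1
    rw [div_mul_div_comm, mul_one, div_le_div_iff₀ (by positivity) (by positivity)]
    have h8 : k.totient * Real.log R ≤ 2 * k * sieveMass k R := by
      calc k.totient * Real.log R ≤ k.totient * (2 * (k / k.totient) * sieveMass k R) := by gcongr
        _ = _ := by field_simp
    calc ((N : ℝ) - M) * (b * k.totient * Real.log R) =
        ((N : ℝ) - M) * b * (k.totient * Real.log R) := by ring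
      _ ≤ ((N : ℝ) - M) * b * (2 * k * sieveMass k R) := by gcongr
      _ = _ := by ring
  rw [h2] at h1
  refine h1.trans ((Finset.sum_le_sum fun d hd => Finset.sum_le_sum fun e he =>
    h3 d hd e he).trans ?_)
  simp only [Finset.sum_add_distrib, ← Finset.mul_sum]
  refine add_le_add (le_trans ?_ h6) (by simpa only [← Finset.mul_sum] using h4)
  exact mul_le_mul_of_nonneg_left h5 (by positivity)

/-! ### Splitting an integer at a given size into smooth and rough parts. -/

theorem primePart_eq (S : ℕ → Prop) [DecidablePred S] (n : ℕ) :
    primePart S n = ∏ p ∈ n.primeFactors.filter S, p ^ n.factorization p := by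
  rw [primePart]
  congr

theorem primePart_congr {S T : ℕ → Prop} {n : ℕ} (h : ∀ p ∈ n.primeFactors, (S p ↔ T p)) :
    primePart S n = primePart T n := by
  classical
  rw [primePart_eq, primePart_eq, Finset.filter_congr h]

/-- Take `q` least such that the part of `n` made of primes up to `q` exceeds `z`. Minimality bounds
the part `b` below `q` by `z` and forces `q` to divide `n`. -/
theorem exists_smooth_rough_splitting {n : ℕ} {z : ℝ} (hn : n ≠ 0) (hz1 : 1 ≤ z) (hzn : z < n) :
    ∃ b d q e : ℕ, b * d = n ∧ b.Coprime d ∧ (b : ℝ) ≤ z ∧ q.Prime ∧ q ∣ n ∧ q ^ e ∣ n ∧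
      z < (b : ℝ) * (q : ℝ) ^ e ∧ (∀ p : ℕ, p.Prime → p ∣ b → p < q) ∧
      ∀ p : ℕ, p.Prime → p ∣ d → q ≤ p := by
  classical
  have hex : ∃ t : ℕ, z < primePart (· ≤ t) n := by
    refine ⟨n, ?_⟩
    have : primePart (· ≤ n) n = n := by
      rw [primePart_eq, Finset.filter_true_of_mem fun p hp => Nat.le_of_mem_primeFactors hp]
      exact Nat.prod_factorization_pow_eq_self hn
    rwa [this]
  set q := Nat.find hex with hq
  have hq1 : z < primePart (· ≤ q) n := Nat.find_spec hex
  have hbz : (primePart (· < q) n : ℝ) ≤ z := by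
    rcases Nat.eq_zero_or_pos q with h0 | h0
    · rw [h0]; simpa [primePart] using hz1
    · have h1 := Nat.find_min hex (m := q - 1) (by omega)
      rw [not_lt] at h1
      rwa [primePart_congr (T := (· ≤ q - 1)) fun p _ => by omega]
  have hqn : q ∈ n.primeFactors := by
    by_contra hqn
    have : primePart (· ≤ q) n = primePart (· < q) n := by
      refine primePart_congr fun p hp => ?_
      have : p ≠ q := by rintro rfl; exact hqn hp
      omega
    rw [this] at hq1
    linarith
  have hqp := Nat.prime_of_mem_primeFactors hqn
  have hmul : primePart (· ≤ q) n = primePart (· < q) n * q ^ n.factorization q := by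
    rw [primePart_eq, primePart_eq]
    have : n.primeFactors.filter (· ≤ q) = insert q (n.primeFactors.filter (· < q)) := by
      ext p
      rw [mem_insert, mem_filter, mem_filter, le_iff_lt_or_eq]
      constructor
      · rintro ⟨h1, h2 | h2⟩
        · exact Or.inr ⟨h1, h2⟩
        · exact Or.inl h2
      · rintro (rfl | h)
        · exact ⟨hqn, Or.inr rfl⟩
        · exact ⟨h.1, Or.inl h.2⟩
    rw [this, Finset.prod_insert (by simp), mul_comm]
  refine ⟨primePart (· < q) n, primePart (fun p => ¬ p < q) n, q, n.factorization q,
    primePart_mul_primePart_not _ hn, coprime_primePart _ _, hbz, hqp,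
    Nat.dvd_of_mem_primeFactors hqn, Nat.ordProj_dvd n q, ?_,
    fun p hp h => (of_prime_dvd_primePart hp h).1,
    fun p hp h => not_lt.1 (of_prime_dvd_primePart hp h).1⟩
  rw [hmul] at hq1
  exact_mod_cast hq1

/-- For the least `j` with `q^j > y` one has `q^j ≤ y^2` and `j ≥ 2`. Then `s = q^⌊j/2⌋` works,
because `2⌊j/2⌋ ≤ j ≤ 3⌊j/2⌋`. -/
theorem exists_large_square_dvd {n q e : ℕ} {y : ℝ} (hq : q.Prime) (hy : 1 ≤ y) (hqy : (q : ℝ) ≤ y)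
    (he : q ^ e ∣ n) (hye : y < (q : ℝ) ^ e) :
    ∃ s : ℕ, s ^ 2 ∣ n ∧ ((s ^ 2 : ℕ) : ℝ) ≤ y ^ 2 ∧ y < (s : ℝ) ^ 3 := by
  classical
  have hex : ∃ j : ℕ, y < (q : ℝ) ^ j := ⟨e, hye⟩
  set j := Nat.find hex with hj
  have hj1 : y < (q : ℝ) ^ j := Nat.find_spec hex
  have hje : j ≤ e := Nat.find_min' hex hye
  have hj2 : 2 ≤ j := by
    by_contra h
    have : j = 0 ∨ j = 1 := by omega
    rcases this with h0 | h0 <;> rw [h0] at hj1 <;> norm_num at hj1 <;> linarith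
  have hq1 : (1 : ℝ) ≤ q := by exact_mod_cast hq.one_le
  have hj3 : (q : ℝ) ^ j ≤ y ^ 2 := by
    have h1 := Nat.find_min hex (m := j - 1) (by omega)
    rw [not_lt] at h1
    have : j = (j - 1) + 1 := by omega
    rw [this, pow_succ, sq]
    exact mul_le_mul h1 hqy (by positivity) (by linarith)
  refine ⟨q ^ (j / 2), ?_, ?_, ?_⟩
  · rw [← pow_mul]
    exact (pow_dvd_pow q (by omega)).trans he
  · refine le_trans ?_ hj3
    rw [← pow_mul]
    push_cast
    exact pow_le_pow_right₀ hq1 (by omega)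
  · refine lt_of_lt_of_le hj1 ?_
    push_cast
    rw [← pow_mul]
    exact pow_le_pow_right₀ hq1 (by omega)

/-- With `Ω(d)` prime factors, all at least `w`, one has `w^Ω(d) ≤ Y`, while multiplicativity gives
`f(d) ≤ H^Ω(d)`. -/
theorem map_rough_le {f : ArithmeticFunction ℝ} {H w Y : ℝ} (hf : f.IsMultiplicative)
    (hf0 : ∀ n, 0 ≤ f n) (hH : 1 ≤ H)
    (hpp : ∀ p l : ℕ, p.Prime → 1 ≤ l → f (p ^ l) ≤ H ^ l) (hw : 1 < w) {d : ℕ} (hd : d ≠ 0)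
    (hdw : ∀ p : ℕ, p.Prime → p ∣ d → w ≤ p) (hdY : (d : ℝ) ≤ Y) :
    f d ≤ H ^ (Real.log Y / Real.log w) := by
  have hd0 : (0 : ℝ) < d := by exact_mod_cast Nat.pos_of_ne_zero hd
  have h1 : f d ≤ H ^ (∑ p ∈ d.primeFactors, d.factorization p) := by
    rw [hf.multiplicative_factorization f hd, ← Finset.prod_pow_eq_pow_sum]
    refine Finset.prod_le_prod (fun p _ => hf0 _) fun p hp => ?_
    have hpr := Nat.prime_of_mem_primeFactors hp
    exact hpp p _ hpr (hpr.factorization_pos_of_dvd hd (Nat.dvd_of_mem_primeFactors hp))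
  have h2 : w ^ (∑ p ∈ d.primeFactors, d.factorization p) ≤ d := by
    have h3 : (d : ℝ) = ∏ p ∈ d.primeFactors, (p : ℝ) ^ d.factorization p := by
      exact_mod_cast (Nat.prod_factorization_pow_eq_self hd).symm
    rw [h3, ← Finset.prod_pow_eq_pow_sum]
    refine Finset.prod_le_prod (fun p _ => by positivity) fun p hp => ?_
    exact pow_le_pow_left₀ (by linarith)
      (hdw p (Nat.prime_of_mem_primeFactors hp) (Nat.dvd_of_mem_primeFactors hp)) _
  refine h1.trans ?_
  rw [← Real.rpow_natCast]
  refine Real.rpow_le_rpow_of_exponent_le hH ?_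
  rw [le_div_iff₀ (Real.log_pos hw), ← Real.log_pow]
  exact Real.log_le_log (by positivity) (h2.trans hdY)

/-! ### Sums over integers with prescribed smooth or square divisors. -/

/-- The integers of `[x, 2x)` congruent to `a` modulo `k`. -/
noncomputable def progression (x : ℝ) (k a : ℕ) : Finset ℕ :=
  (Ico ⌈x⌉₊ ⌈x + x⌉₊).filter fun n => n ≡ a [MOD k]

theorem le_of_mem_progression {x : ℝ} {k a n : ℕ} (hn : n ∈ progression x k a) :
    x ≤ n ∧ (n : ℝ) ≤ 2 * x := by
  rw [progression, mem_filter, mem_Ico] at hn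
  exact ⟨Nat.ceil_le.1 hn.1.1, by linarith [Nat.lt_ceil.1 hn.1.2]⟩

theorem coprime_of_mem_progression {x : ℝ} {k a n : ℕ} (hak : a.Coprime k)
    (hn : n ∈ progression x k a) : n.Coprime k := by
  have h := (mem_filter.1 hn).2
  have := Nat.ModEq.gcd_eq h
  rw [Nat.Coprime, this]
  exact hak

theorem ceil_sub_ceil_le {x : ℝ} (hx : 1 ≤ x) :
    ((⌈x + x⌉₊ : ℕ) : ℝ) - (⌈x⌉₊ : ℕ) ≤ 2 * x := by
  have h1 := Nat.ceil_lt_add_one (a := x + x) (by linarith)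
  have h2 := Nat.le_ceil x
  linarith

theorem card_dvd_progression_le {x : ℝ} {k a m : ℕ} (hx : 1 ≤ x) (hk : 0 < k) (hak : a.Coprime k)
    (hm : 0 < m) (hkm : (k : ℝ) * m ≤ x) :
    ((((progression x k a).filter (m ∣ ·)).card : ℕ) : ℝ) ≤ 3 * x / k * (1 / m) := by
  have hk0 : (0 : ℝ) < k := by exact_mod_cast hk
  have hm0 : (0 : ℝ) < m := by exact_mod_cast hm
  by_cases hc : k.Coprime m
  · have h1 := abs_card_modEq_dvd_sub_le (a := a) hk hm hc
      (show ⌈x⌉₊ ≤ ⌈x + x⌉₊ from Nat.ceil_le_ceil (by linarith))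
    rw [progression, Finset.filter_filter]
    have h2 := (abs_le.1 h1).2
    have h3 : (((⌈x + x⌉₊ : ℕ) : ℝ) - (⌈x⌉₊ : ℕ)) / (k * m) ≤ 2 * x / (k * m) := by
      gcongr; exact ceil_sub_ceil_le hx
    have h4 : 1 ≤ x / (k * m) := by rw [le_div_iff₀ (by positivity)]; linarith
    have h5 : 3 * x / k * (1 / m) = 2 * x / (k * m) + x / (k * m) := by field_simp; ring
    rw [h5]; linarith
  · rw [Finset.filter_false_of_mem]
    · simp; positivity
    · intro n hn hmn
      exact hc ((coprime_of_mem_progression hak hn).symm.coprime_dvd_right hmn)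

theorem card_exists_dvd_progression_le {x : ℝ} {k a : ℕ} (hx : 1 ≤ x) (hk : 0 < k)
    (hak : a.Coprime k) (S D : Finset ℕ) (hS : S ⊆ progression x k a)
    (hD : ∀ m ∈ D, 0 < m ∧ (k : ℝ) * m ≤ x) (hSD : ∀ n ∈ S, ∃ m ∈ D, m ∣ n) :
    (S.card : ℝ) ≤ 3 * x / k * ∑ m ∈ D, 1 / (m : ℝ) := by
  classical
  have h1 : S ⊆ D.biUnion fun m => (progression x k a).filter (m ∣ ·) := by
    intro n hn
    obtain ⟨m, hm, hmn⟩ := hSD n hn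
    exact mem_biUnion.2 ⟨m, hm, mem_filter.2 ⟨hS hn, hmn⟩⟩
  have h2 := (Finset.card_le_card h1).trans Finset.card_biUnion_le
  rw [Finset.mul_sum]
  calc (S.card : ℝ) ≤ ((∑ m ∈ D, ((progression x k a).filter (m ∣ ·)).card : ℕ) : ℝ) := by
        exact_mod_cast h2
    _ ≤ _ := by
      push_cast
      exact Finset.sum_le_sum fun m hm => card_dvd_progression_le hx hk hak (hD m hm).1 (hD m hm).2

/-- Group the `n` by their smooth part `b`: the cofactor contributes at most a power of `H`, and the
sieve bounds the number of cofactors. The assumption `k z w ≤ x` leaves room for the sieve error for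
every `b ≤ z`. -/
theorem sum_smooth_mul_rough_le {f : ArithmeticFunction ℝ} {H w x z : ℝ} {k a : ℕ}
    (hf : f.IsMultiplicative) (hf0 : ∀ n, 0 ≤ f n) (hH : 1 ≤ H)
    (hpp : ∀ p l : ℕ, p.Prime → 1 ≤ l → f (p ^ l) ≤ H ^ l) (hw : 2 ^ 16 ≤ w) (hx : 1 ≤ x)
    (hk : 0 < k) (hak : a.Coprime k) (hkx : k * z * w ≤ x)
    (S B : Finset ℕ) (hS : S ⊆ progression x k a)
    (hB : ∀ b ∈ B, b ≠ 0 ∧ (b : ℝ) ≤ z)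
    (hSB : ∀ n ∈ S, ∃ b d : ℕ, b ∈ B ∧ b * d = n ∧ b.Coprime d ∧
      ∀ p : ℕ, p.Prime → p ∣ d → w < p) :
    ∑ n ∈ S, f n ≤ 65 * x / (k.totient * Real.log w) *
      H ^ (Real.log (2 * x) / Real.log w) * ∑ b ∈ B, f b / b := by
  classical
  have hw1 : (1 : ℝ) < w := lt_of_lt_of_le (by norm_num) hw
  have hw0 : (0 : ℝ) < w := by linarith
  have hlw : 0 < Real.log w := Real.log_pos hw1
  have hφ0 : (0 : ℝ) < k.totient := by exact_mod_cast Nat.totient_pos.2 hk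
  have hφk : (k.totient : ℝ) ≤ k := by exact_mod_cast Nat.totient_le k
  have hk0 : (0 : ℝ) < k := by exact_mod_cast hk
  choose! bb dd hbb hbd hcop hrough using hSB
  set D : ℝ := H ^ (Real.log (2 * x) / Real.log w) with hD
  have hD0 : 0 ≤ D := by positivity
  -- the level of the sieve
  set R : ℕ := ⌊w ^ (1 / 8 : ℝ)⌋₊ with hR
  have hw16 : (2 : ℝ) ≤ w ^ (1 / 16 : ℝ) := by
    have := Real.rpow_le_rpow (z := (1 / 16 : ℝ)) (by norm_num) hw (by norm_num)
    rwa [← Real.rpow_natCast, ← Real.rpow_mul (by norm_num),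
      show ((16 : ℕ) : ℝ) * (1 / 16) = 1 by norm_num, Real.rpow_one] at this
  have hw8 : w ^ (1 / 8 : ℝ) = w ^ (1 / 16 : ℝ) * w ^ (1 / 16 : ℝ) := by
    rw [← Real.rpow_add hw0]; norm_num
  have hRle : (R : ℝ) ≤ w ^ (1 / 8 : ℝ) := Nat.floor_le (by positivity)
  have hRge : w ^ (1 / 16 : ℝ) ≤ R := by
    have := Nat.lt_floor_add_one (w ^ (1 / 8 : ℝ))
    rw [← hR] at this
    nlinarith
  have hR2 : 2 ≤ R := by exact_mod_cast hw16.trans hRge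
  have hlR : Real.log w / 16 ≤ Real.log R := by
    have := Real.log_le_log (by positivity) hRge
    rw [Real.log_rpow hw0] at this
    linarith
  have hRw : (R : ℝ) ≤ w := hRle.trans (by
    calc w ^ (1 / 8 : ℝ) ≤ w ^ (1 : ℝ) := Real.rpow_le_rpow_of_exponent_le hw1.le (by norm_num)
      _ = w := Real.rpow_one w)
  have hR4 : (R : ℝ) ^ 4 ≤ w / Real.log w := by
    have h1 : (R : ℝ) ^ 4 ≤ w ^ (1 / 2 : ℝ) := by
      calc (R : ℝ) ^ 4 ≤ (w ^ (1 / 8 : ℝ)) ^ 4 := by gcongr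
        _ = _ := by rw [← Real.rpow_natCast, ← Real.rpow_mul hw0.le]; norm_num
    have h2 : Real.log w ≤ w ^ (1 / 2 : ℝ) := by
      have h3 := Real.log_le_sub_one_of_pos (show 0 < w ^ (1 / 2 : ℝ) / 2 by positivity)
      rw [Real.log_div (by positivity) (by norm_num), Real.log_rpow hw0] at h3
      have := Real.log_two_lt_d9
      linarith
    rw [le_div_iff₀ hlw]
    calc (R : ℝ) ^ 4 * Real.log w ≤ w ^ (1 / 2 : ℝ) * w ^ (1 / 2 : ℝ) := by gcongr
      _ = w := by rw [← Real.rpow_add hw0]; norm_num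
  rw [← Finset.sum_fiberwise_of_maps_to (g := bb) hbb, Finset.mul_sum]
  refine Finset.sum_le_sum fun b hb => ?_
  obtain ⟨hb0, hbz⟩ := hB b hb
  have hb0' : (0 : ℝ) < b := by exact_mod_cast Nat.pos_of_ne_zero hb0
  set F := S.filter (fun n => bb n = b) with hF
  have hterm : ∀ n ∈ F, f n ≤ f b * D := by
    intro n hn
    obtain ⟨hnS, rfl⟩ := mem_filter.1 hn
    have hnx := le_of_mem_progression (hS hnS)
    have hn0 : n ≠ 0 := by rintro rfl; norm_num at hnx; linarith
    have hd0 : dd n ≠ 0 := by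
      intro h; rw [← hbd n hnS, h, mul_zero] at hn0; exact hn0 rfl
    have hfn : f n = f (bb n) * f (dd n) := by
      conv_lhs => rw [← hbd n hnS]
      exact hf.map_mul_of_coprime (hcop n hnS)
    rw [hfn]
    refine mul_le_mul_of_nonneg_left ?_ (hf0 _)
    refine map_rough_le hf hf0 hH hpp hw1 hd0 (fun p hp h => (hrough n hnS p hp h).le) ?_
    refine le_trans ?_ hnx.2
    exact_mod_cast Nat.le_of_dvd (Nat.pos_of_ne_zero hn0) ⟨bb n, by rw [mul_comm, hbd n hnS]⟩
  have hcard : (F.card : ℝ) ≤ 65 * x / (k.totient * Real.log w) * (1 / b) := by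
    rcases F.eq_empty_or_nonempty with h0 | ⟨n₀, hn₀⟩
    · rw [h0]; simp; positivity
    have hkb : k.Coprime b := by
      obtain ⟨hnS, rfl⟩ := mem_filter.1 hn₀
      exact (coprime_of_mem_progression hak (hS hnS)).symm.coprime_dvd_right
        ⟨_, (hbd n₀ hnS).symm⟩
    have h1 := card_rough_modEq_le (a := a) hk (Nat.pos_of_ne_zero hb0) hkb
      (show ⌈x⌉₊ ≤ ⌈x + x⌉₊ from Nat.ceil_le_ceil (by linarith)) hR2 F (by
        intro n hn
        obtain ⟨hnS, rfl⟩ := mem_filter.1 hn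
        have hnP := mem_filter.1 (hS hnS)
        refine ⟨hnP.1, hnP.2, ⟨_, (hbd n hnS).symm⟩, fun p hp hpR hpd => ?_⟩
        have h2 : n / bb n = dd n := by
          exact Nat.div_eq_of_eq_mul_right (Nat.pos_of_ne_zero hb0) (hbd n hnS).symm
        rw [h2] at hpd
        have h3 := hrough n hnS p hp hpd
        have h4 : (p : ℝ) ≤ R := by exact_mod_cast hpR
        linarith)
    refine h1.trans ?_
    have h2 := ceil_sub_ceil_le hx
    have h3 : 2 * (((⌈x + x⌉₊ : ℕ) : ℝ) - (⌈x⌉₊ : ℕ)) / (b * k.totient * Real.log R) ≤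
        2 * (2 * x) / (b * k.totient * (Real.log w / 16)) := by
      gcongr
    have h4 : w / Real.log w ≤ x / (b * k.totient * Real.log w) := by
      rw [div_le_div_iff₀ hlw (by positivity)]
      have h5 : w * (b * k.totient) ≤ x := by
        refine le_trans ?_ hkx
        calc w * (b * k.totient) ≤ w * (z * k) := by
              have : 0 ≤ z := hb0'.le.trans hbz
              gcongr
          _ = _ := by ring
      calc w * (b * k.totient * Real.log w) = w * (b * k.totient) * Real.log w := by ring
        _ ≤ _ := by gcongr
    -- `65 = 64 + 1`: the sieve's main term gives `2 · 2 · 16`, the 16 coming from `log R ≥ (log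
    -- w)/16`, and the error `R^4` gives 1.
    have h5 : 65 * x / (k.totient * Real.log w) * (1 / b) =
        2 * (2 * x) / (b * k.totient * (Real.log w / 16)) + x / (b * k.totient * Real.log w) := by
      field_simp; ring
    rw [h5]
    linarith
  calc ∑ n ∈ F, f n ≤ ∑ n ∈ F, f b * D := Finset.sum_le_sum hterm
    _ = F.card * (f b * D) := by rw [Finset.sum_const, nsmul_eq_mul]
    _ ≤ 65 * x / (k.totient * Real.log w) * (1 / b) * (f b * D) :=
        mul_le_mul_of_nonneg_right hcard (mul_nonneg (hf0 b) hD0)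
    _ = _ := by ring

/-! ### Rankin's trick and the comparison of exponents. -/

theorem primeSum_le_of_smoothSupported {f : ArithmeticFunction ℝ} {Q : ℝ} (hf0 : ∀ n, 0 ≤ f n)
    (hQ : SmoothSupported Q f) (w : ℝ) (k : ℕ) : primeSum f w k ≤ primeSum f Q k := by
  classical
  have h0 : ∀ n : ℕ, 0 ≤ f n / (n : ℝ) := fun n => div_nonneg (hf0 n) (Nat.cast_nonneg n)
  rw [primeSum, ← Finset.sum_filter_ne_zero]
  refine Finset.sum_le_sum_of_subset_of_nonneg ?_ fun n _ _ => h0 n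
  intro p hp
  simp only [mem_filter, mem_Icc] at hp ⊢
  refine ⟨⟨hp.1.1.1, ?_⟩, hp.1.2⟩
  have hfp : f p ≠ 0 := fun h => hp.2 (by rw [h, zero_div])
  have := Nat.mem_smoothNumbers'.1 (hQ hfp) p hp.1.2.1 dvd_rfl
  omega

theorem primeSum_nonneg {f : ArithmeticFunction ℝ} (hf0 : ∀ n, 0 ≤ f n) (Q : ℝ) (k : ℕ) :
    0 ≤ primeSum f Q k :=
  Finset.sum_nonneg fun n _ => div_nonneg (hf0 n) (Nat.cast_nonneg n)

/-- Rankin's trick for the weighted sum over the smooth numbers `b ≥ e^{L/2}` whose prime factors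
are at most `e^{L/r}`. -/
theorem exists_sum_smooth_div_le : ∃ C : ℝ, 0 < C ∧
    ∀ (f : ArithmeticFunction ℝ) (H G : ℝ), f.IsMultiplicative → (∀ n, 0 ≤ f n) → 1 ≤ H → 1 ≤ G →
    (∀ p l : ℕ, p.Prime → 1 ≤ l → f (p ^ l) ≤ H ^ l) →
    (∀ n : ℕ, 1 ≤ n → f n ≤ G * (n : ℝ) ^ (1 / 8 : ℝ)) →
    ∀ (Q : ℝ), SmoothSupported Q f → ∀ (k r : ℕ) (L : ℝ) (B : Finset ℕ), 1 ≤ r → 0 < L →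
    r * Real.log r ≤ L / 4 →
    (∀ b ∈ B, b ≠ 0 ∧ b.Coprime k ∧ ∀ p : ℕ, p.Prime → p ∣ b → (p : ℝ) ≤ Real.exp (L / r)) →
    (r = 1 ∨ ∀ b ∈ B, Real.exp (L / 2) ≤ b) →
    ∑ b ∈ B, f b / b ≤
      G * Real.exp (C * H * √r + primeSum f Q k - r * Real.log r / 4) := by
  obtain ⟨C, hC, hE⟩ := exists_sum_smooth_mul_rpow_le
  refine ⟨C, hC, ?_⟩
  intro f H G hf hf0 hH hG hpp hgr Q hQ k r L B hr hL hrL hB hBL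
  have hr0 : (0 : ℝ) < r := by exact_mod_cast hr
  have hr1 : (1 : ℝ) ≤ r := by exact_mod_cast hr
  have hlr : 0 ≤ Real.log r := Real.log_nonneg hr1
  -- Chosen so that `(e^(L/r))^σ = √r`, keeping the loss `O(H√r)`, while `b ≥ e^(L/2)` gains `exp((r
  -- log r)/4)`. For `r = 1` it vanishes, so no lower bound on `b` is needed.
  set σ : ℝ := r * Real.log r / (2 * L) with hσ
  have hσ0 : 0 ≤ σ := by positivity
  have hσ1 : σ ≤ 1 / 8 := by rw [hσ, div_le_iff₀ (by positivity)]; linarith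
  have h1 := hE f H G hf hf0 hH hG hpp hgr k σ (Real.exp (L / r)) B hσ0 hσ1
    (Real.one_le_exp (by positivity)) hB
  have h2 : Real.exp (L / r) ^ σ = √r := by
    rw [← Real.exp_mul, Real.sqrt_eq_rpow, Real.rpow_def_of_pos hr0]
    congr 1
    rw [hσ]; field_simp
  rw [h2] at h1
  have h3 : ∀ b ∈ B, f b / b ≤ Real.exp (-(r * Real.log r / 4)) * (f b * (b : ℝ) ^ (σ - 1)) := by
    intro b hb
    have hb0 : (0 : ℝ) < b := by exact_mod_cast Nat.pos_of_ne_zero (hB b hb).1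
    have h4 : Real.exp (r * Real.log r / 4) ≤ (b : ℝ) ^ σ := by
      rcases hBL with h5 | h5
      · have : σ = 0 := by rw [hσ, h5]; simp
        rw [this, h5]; simp
      · calc Real.exp (r * Real.log r / 4) = Real.exp (L / 2) ^ σ := by
              rw [← Real.exp_mul]; congr 1; rw [hσ]; field_simp; ring
          _ ≤ _ := Real.rpow_le_rpow (Real.exp_pos _).le (h5 b hb) hσ0
    rw [Real.rpow_sub hb0, Real.rpow_one, Real.exp_neg]
    have h6 : 1 ≤ (Real.exp (r * Real.log r / 4))⁻¹ * (b : ℝ) ^ σ := by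
      rw [inv_mul_eq_div, le_div_iff₀ (Real.exp_pos _), one_mul]; exact h4
    calc f b / b = 1 * (f b / b) := (one_mul _).symm
      _ ≤ (Real.exp (r * Real.log r / 4))⁻¹ * (b : ℝ) ^ σ * (f b / b) :=
        mul_le_mul_of_nonneg_right h6 (div_nonneg (hf0 b) hb0.le)
      _ = _ := by ring
  refine (Finset.sum_le_sum h3).trans ?_
  rw [← Finset.mul_sum]
  calc _ ≤ Real.exp (-(r * Real.log r / 4)) *
        (G * Real.exp (C * H * √r + primeSum f (Real.exp (L / r)) k)) := by gcongr
    _ ≤ Real.exp (-(r * Real.log r / 4)) * (G * Real.exp (C * H * √r + primeSum f Q k)) := by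
        have := primeSum_le_of_smoothSupported hf0 hQ (Real.exp (L / r)) k
        gcongr
    _ = _ := by rw [mul_left_comm, ← Real.exp_add]; congr 2; ring

/-- In units of `r log r`, the gain `1/4` exceeds the cost `1/25` of the power of `H` plus the cost
`4/82` of `ρ(u)^c` by more than `1/10`. All other losses are `O(r)`, so they and the extra factor
`2^r` are absorbed in a constant. -/
theorem exists_forall_class_factor_le {α c A C : ℝ} (hα0 : 0 < α) (hα : α < 1 / 2) (hc0 : 0 < c)
    (hc : c ≤ α / 82) (hA : 1 ≤ A) (hC : 0 < C) :
    ∃ B : ℝ, 0 < B ∧ ∀ (r : ℕ) (u H : ℝ), 1 ≤ r → 1 ≤ u → u ≤ 2 / α * (r + 1) → 1 ≤ H →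
      H ≤ A * u ^ (α / 100) →
      130 / α * (r + 1) * H ^ (4 * (r + 1) / α) * Real.exp (C * H * √r - r * Real.log r / 4) ≤
        B * (1 / 2) ^ r * dickman u ^ c := by
  obtain ⟨D, hD, hρ⟩ := exists_exp_le_dickman (δ := 1) one_pos
  set A₁ : ℝ := A * (4 / α) with hA₁
  have h4α : 1 ≤ 4 / α := by rw [le_div_iff₀ hα0]; linarith
  have hA₁1 : 1 ≤ A₁ := by nlinarith
  set ℓ : ℝ := Real.log (4 / α) with hℓ
  have hℓ0 : 0 ≤ ℓ := Real.log_nonneg h4α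
  have hlA : 0 ≤ Real.log A₁ := Real.log_nonneg hA₁1
  have hl2 : 0 < Real.log 2 := Real.log_pos (by norm_num)
  -- This collects the coefficients of all terms linear in `r`, including the `log 2` for the factor
  -- `(1/2)^r`.
  set M : ℝ := 4 + 8 * Real.log A₁ / α + C * A₁ + ℓ + 4 * D / α + Real.log 2 with hM
  have hM0 : 0 < M := by positivity
  refine ⟨130 / α * Real.exp (M * Real.exp (10 * M)), by positivity, ?_⟩
  intro r u H hr hu hur hH hHu
  have hr1 : (1 : ℝ) ≤ r := by exact_mod_cast hr
  set ρ : ℝ := (r : ℝ) with hρr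
  have hr0 : 0 < ρ := by linarith
  have hu0 : 0 < u := by linarith
  have hlr : 0 ≤ Real.log ρ := Real.log_nonneg hr1
  have hlrr : Real.log ρ ≤ ρ := (Real.log_le_sub_one_of_pos hr0).trans (by linarith)
  have hu4 : u ≤ 4 / α * ρ := by
    refine hur.trans ?_
    rw [div_mul_eq_mul_div, div_mul_eq_mul_div, div_le_div_iff_of_pos_right hα0]
    linarith
  have hlu : Real.log u ≤ ℓ + Real.log ρ := by
    rw [hℓ, ← Real.log_mul (by positivity) hr0.ne']
    exact Real.log_le_log hu0 hu4
  have hlu0 : 0 ≤ Real.log u := Real.log_nonneg hu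
  have hH0 : 0 < H := by linarith
  have hHr : H ≤ A₁ * ρ ^ (α / 100) := by
    refine hHu.trans ?_
    rw [hA₁, mul_assoc]
    refine mul_le_mul_of_nonneg_left ?_ (by linarith)
    calc u ^ (α / 100) ≤ (4 / α * ρ) ^ (α / 100) :=
          Real.rpow_le_rpow hu0.le hu4 (by positivity)
      _ = (4 / α) ^ (α / 100) * ρ ^ (α / 100) := Real.mul_rpow (by positivity) hr0.le
      _ ≤ (4 / α) ^ (1 : ℝ) * ρ ^ (α / 100) := by
          refine mul_le_mul_of_nonneg_right ?_ (by positivity)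
          exact Real.rpow_le_rpow_of_exponent_le h4α (by linarith)
      _ = _ := by rw [Real.rpow_one]
  have hlH : Real.log H ≤ Real.log A₁ + α / 100 * Real.log ρ := by
    rw [← Real.log_rpow hr0, ← Real.log_mul (by positivity) (by positivity)]
    exact Real.log_le_log hH0 hHr
  have hHs : H * √ρ ≤ A₁ * ρ := by
    have h1 : ρ ^ (α / 100) ≤ √ρ := by
      rw [Real.sqrt_eq_rpow]
      exact Real.rpow_le_rpow_of_exponent_le hr1 (by linarith)
    calc H * √ρ ≤ A₁ * √ρ * √ρ := by
          refine mul_le_mul_of_nonneg_right (hHr.trans ?_) (Real.sqrt_nonneg _)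
          exact mul_le_mul_of_nonneg_left h1 (by linarith)
      _ = A₁ * ρ := by rw [mul_assoc, Real.mul_self_sqrt hr0.le]
  have hpow : H ^ (4 * (ρ + 1) / α) ≤
      Real.exp (8 * Real.log A₁ / α * ρ + ρ * Real.log ρ / 25 + ρ) := by
    rw [Real.rpow_def_of_pos hH0, Real.exp_le_exp]
    calc Real.log H * (4 * (ρ + 1) / α) ≤
        (Real.log A₁ + α / 100 * Real.log ρ) * (4 * (ρ + 1) / α) :=
          mul_le_mul_of_nonneg_right hlH (by positivity)
      _ = 4 * Real.log A₁ / α * (ρ + 1) + (ρ + 1) * Real.log ρ / 25 := by field_simp; ring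
      _ ≤ 4 * Real.log A₁ / α * (ρ + ρ) + (ρ * Real.log ρ / 25 + ρ) := by
          refine add_le_add (mul_le_mul_of_nonneg_left (by linarith) (by positivity)) ?_
          linarith
      _ = _ := by ring
  have hdick : Real.exp (-(4 / 82 * (ρ * Real.log ρ) + ρ + ℓ * ρ + 4 * D / α * ρ)) ≤
      dickman u ^ c := by
    have h1 := Real.rpow_le_rpow (Real.exp_pos _).le (hρ u hu) hc0.le
    refine le_trans ?_ h1
    rw [← Real.exp_mul, Real.exp_le_exp, neg_mul, neg_le_neg_iff]
    have h2 : u * Real.log u ≤ 2 / α * (ρ + 1) * (ℓ + Real.log ρ) :=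
      mul_le_mul hur hlu hlu0 (by positivity)
    have h3 : c * ((1 + 1) * u * Real.log u) ≤ 4 / 82 * ((ρ + 1) * (ℓ + Real.log ρ)) := by
      calc c * ((1 + 1) * u * Real.log u) = c * (2 * (u * Real.log u)) := by ring
        _ ≤ α / 82 * (2 * (2 / α * (ρ + 1) * (ℓ + Real.log ρ))) := by
          refine mul_le_mul hc (by linarith) (by positivity) (by positivity)
        _ = _ := by field_simp; ring
    have h4 : c * (D * u) ≤ 4 * D / α * ρ := by
      calc c * (D * u) ≤ 1 * (D * (4 / α * ρ)) := by
            refine mul_le_mul (by linarith) ?_ (by positivity) zero_le_one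
            gcongr
        _ = _ := by ring
    have h5 : ℓ ≤ ℓ * ρ := le_mul_of_one_le_right hℓ0 hr1
    have h6 : (1 + 1 : ℝ) * u * Real.log u * c = c * ((1 + 1) * u * Real.log u) := by ring
    rw [add_mul, h6, mul_comm (D * u)]
    nlinarith
  have hr1e : ρ + 1 ≤ Real.exp ρ := Real.add_one_le_exp ρ
  have hhalf : ((1 : ℝ) / 2) ^ r = Real.exp (-(Real.log 2 * ρ)) := by
    rw [one_div, inv_pow, Real.exp_neg, Real.exp_mul, Real.exp_log two_pos, hρr,
      Real.rpow_natCast]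
  -- The left side is nonpositive once `log ρ ≥ 10 M`; otherwise `ρ ≤ e^(10M)`.
  have hfin : M * ρ - ρ * Real.log ρ / 10 ≤ M * Real.exp (10 * M) := by
    rcases le_total (10 * M) (Real.log ρ) with h | h
    · have h1 : 0 ≤ M * Real.exp (10 * M) := by positivity
      have h2 := mul_le_mul_of_nonneg_left h hr0.le
      linarith
    · have h1 : ρ ≤ Real.exp (10 * M) := by rwa [← Real.log_le_iff_le_exp hr0]
      have h2 : 0 ≤ ρ * Real.log ρ := by positivity
      have h3 := mul_le_mul_of_nonneg_left h1 hM0.le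
      linarith
  have hMρ : M * ρ = 4 * ρ + 8 * Real.log A₁ / α * ρ + C * (A₁ * ρ) + ℓ * ρ + 4 * D / α * ρ +
      Real.log 2 * ρ := by rw [hM]; ring
  calc 130 / α * (ρ + 1) * H ^ (4 * (ρ + 1) / α) * Real.exp (C * H * √ρ - ρ * Real.log ρ / 4) ≤
      130 / α * Real.exp ρ * Real.exp (8 * Real.log A₁ / α * ρ + ρ * Real.log ρ / 25 + ρ) *
        Real.exp (C * (A₁ * ρ) - ρ * Real.log ρ / 4) := by
        have : C * H * √ρ ≤ C * (A₁ * ρ) := by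
          rw [mul_assoc]; exact mul_le_mul_of_nonneg_left hHs hC.le
        gcongr
    _ = 130 / α * Real.exp (ρ + (8 * Real.log A₁ / α * ρ + ρ * Real.log ρ / 25 + ρ) +
        (C * (A₁ * ρ) - ρ * Real.log ρ / 4)) := by
        rw [mul_assoc, mul_assoc, ← Real.exp_add, ← Real.exp_add]; congr 2; ring
    _ ≤ 130 / α * Real.exp (M * Real.exp (10 * M) + -(Real.log 2 * ρ) +
        -(4 / 82 * (ρ * Real.log ρ) + ρ + ℓ * ρ + 4 * D / α * ρ)) := by
        refine mul_le_mul_of_nonneg_left (Real.exp_le_exp.2 ?_) (by positivity)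
        have h2 : 0 ≤ ρ * Real.log ρ := by positivity
        linarith
    _ = 130 / α * Real.exp (M * Real.exp (10 * M)) * ((1 : ℝ) / 2) ^ r *
        Real.exp (-(4 / 82 * (ρ * Real.log ρ) + ρ + ℓ * ρ + 4 * D / α * ρ)) := by
        rw [Real.exp_add, Real.exp_add, hhalf]; ring
    _ ≤ _ := by gcongr

theorem eventually_mul_exp_rpow_le {A C s η : ℝ} (hA : 0 < A) (hs : s < 1) (hη : 0 < η) :
    ∀ᶠ X : ℝ in Filter.atTop, A * X * Real.exp (C * X ^ s) ≤ Real.exp (η * X) := by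
  have h1 : (fun X : ℝ => Real.log A + Real.log X + C * X ^ s) =o[Filter.atTop] fun X : ℝ => X := by
    refine Asymptotics.IsLittleO.add (Asymptotics.IsLittleO.add ?_ Real.isLittleO_log_id_atTop) ?_
    · exact Asymptotics.isLittleO_const_id_atTop _
    · refine Asymptotics.IsLittleO.const_mul_left ?_ C
      refine Asymptotics.isLittleO_of_tendsto' ?_ ((tendsto_rpow_neg_atTop (y := 1 - s)
        (by linarith)).congr' ?_)
      · filter_upwards [Filter.eventually_gt_atTop 0] with X hX h
        exact absurd h hX.ne'
      · filter_upwards [Filter.eventually_gt_atTop 0] with X hX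
        rw [neg_sub, Real.rpow_sub hX, Real.rpow_one]
  filter_upwards [h1.bound hη, Filter.eventually_gt_atTop 0] with X hX hX0
  rw [Real.norm_of_nonneg hX0.le] at hX
  have h2 := (le_abs_self _).trans hX
  calc A * X * Real.exp (C * X ^ s) = Real.exp (Real.log A + Real.log X + C * X ^ s) := by
        rw [Real.exp_add, Real.exp_add, Real.exp_log hA, Real.exp_log hX0]
    _ ≤ _ := Real.exp_le_exp.2 h2

/-- With `X = log x` and `ℓ = log Q`, this bounds `ρ(u)^c` below by `x^(-c(1+δ)/K)` when `Q ≥ (log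
x)^K`: then `u log u ≤ X/K`, and the linear term in `u` is of lower order. -/
theorem eventually_exp_le_dickman_rpow {c δ K : ℝ} (hc : 0 < c) (hδ : 0 < δ) (hK : 0 < K) :
    ∀ᶠ X : ℝ in Filter.atTop, ∀ ℓ : ℝ, K * Real.log X ≤ ℓ → ℓ ≤ X →
      Real.exp (-(c * (1 + δ) / K * X)) ≤ dickman (X / ℓ) ^ c := by
  obtain ⟨D, hD, hρ⟩ := exists_exp_le_dickman (δ := δ / 2) (by positivity)
  filter_upwards [Real.tendsto_log_atTop.eventually_ge_atTop (1 / K),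
    Real.tendsto_log_atTop.eventually_ge_atTop (2 * D / δ), Filter.eventually_gt_atTop 0]
    with X h1 h2 hX0 ℓ hℓ hℓX
  have hlX : 0 < Real.log X := lt_of_lt_of_le (by positivity) h1
  have hKl : 1 ≤ K * Real.log X := by rw [div_le_iff₀ hK] at h1; linarith
  have hℓ0 : 0 < ℓ := by linarith
  have hu1 : 1 ≤ X / ℓ := by rw [le_div_iff₀ hℓ0]; linarith
  have huX : X / ℓ ≤ X / (K * Real.log X) := by gcongr
  have hlu : Real.log (X / ℓ) ≤ Real.log X :=
    Real.log_le_log (by positivity) (div_le_self hX0.le (by linarith))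
  have hlu0 : 0 ≤ Real.log (X / ℓ) := Real.log_nonneg hu1
  refine le_trans ?_ (Real.rpow_le_rpow (Real.exp_pos _).le (hρ _ hu1) hc.le)
  rw [← Real.exp_mul, Real.exp_le_exp, neg_mul, neg_le_neg_iff]
  have h3 : X / ℓ * Real.log (X / ℓ) ≤ X / K := by
    calc X / ℓ * Real.log (X / ℓ) ≤ X / (K * Real.log X) * Real.log X := by gcongr
      _ = _ := by field_simp
  have h4 : D * (X / ℓ) ≤ δ / 2 * (X / K) := by
    have h5 : D ≤ δ / 2 * Real.log X := by
      rw [div_le_iff₀ hδ] at h2; linarith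
    calc D * (X / ℓ) ≤ (δ / 2 * Real.log X) * (X / (K * Real.log X)) := by gcongr
      _ = _ := by field_simp
  calc ((1 + δ / 2) * (X / ℓ) * Real.log (X / ℓ) + D * (X / ℓ)) * c =
      ((1 + δ / 2) * (X / ℓ * Real.log (X / ℓ)) + D * (X / ℓ)) * c := by ring
    _ ≤ ((1 + δ / 2) * (X / K) + δ / 2 * (X / K)) * c := by gcongr
    _ = _ := by ring

/-- Every `s` here exceeds `e^(L/6)`; take `s^(-1/2)` as the saving and leave the convergent sum of
`s^(-3/2)`. -/
theorem exists_sum_inv_sq_le : ∃ Z : ℝ, 0 < Z ∧ ∀ (L : ℝ) (D : Finset ℕ),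
    (∀ s ∈ D, Real.exp (L / 2) < (s : ℝ) ^ 3) →
    ∑ s ∈ D, 1 / ((s ^ 2 : ℕ) : ℝ) ≤ Z * Real.exp (-(L / 12)) := by
  have hZs : Summable fun n : ℕ => (n : ℝ) ^ (-(3 / 2) : ℝ) :=
    Real.summable_nat_rpow.2 (by norm_num)
  have hZ0 : 0 ≤ ∑' n : ℕ, (n : ℝ) ^ (-(3 / 2) : ℝ) := tsum_nonneg fun n => by positivity
  refine ⟨(∑' n : ℕ, (n : ℝ) ^ (-(3 / 2) : ℝ)) + 1, by linarith, fun L D hD => ?_⟩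
  have h1 : ∀ s ∈ D, 1 / ((s ^ 2 : ℕ) : ℝ) ≤ (s : ℝ) ^ (-(3 / 2) : ℝ) * Real.exp (-(L / 12)) := by
    intro s hs
    have hs0 : (0 : ℝ) < s := by
      rcases Nat.eq_zero_or_pos s with h | h
      · have := hD s hs
        rw [h] at this
        norm_num at this
        linarith [Real.exp_pos (L / 2)]
      · exact_mod_cast h
    have h2 : (s : ℝ) ^ (-(1 / 2) : ℝ) ≤ Real.exp (-(L / 12)) := by
      have h3 : L / 2 ≤ 3 * Real.log s := by
        have := (Real.lt_log_iff_exp_lt (by positivity)).2 (hD s hs)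
        rw [Real.log_pow] at this
        push_cast at this
        linarith
      rw [Real.rpow_def_of_pos hs0, Real.exp_le_exp]
      linarith
    calc 1 / ((s ^ 2 : ℕ) : ℝ) = (s : ℝ) ^ (-(3 / 2) : ℝ) * (s : ℝ) ^ (-(1 / 2) : ℝ) := by
          rw [← Real.rpow_add hs0, show (-(3 / 2) + -(1 / 2) : ℝ) = -((2 : ℕ) : ℝ) by norm_num,
            Real.rpow_neg hs0.le, Real.rpow_natCast]
          push_cast; rw [one_div]
      _ ≤ _ := by gcongr
  refine (Finset.sum_le_sum h1).trans ?_
  rw [← Finset.sum_mul]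
  refine mul_le_mul_of_nonneg_right ?_ (Real.exp_pos _).le
  have := hZs.sum_le_tsum D fun n _ => by positivity
  linarith

/-- Rankin's trick with exponent `7/8`: the saving is `b^(-1/8)`. It is applied with `w = (log
x)^4`, where `w^(1/8)` is only `√(log x)`. -/
theorem exists_sum_smooth_inv_le : ∃ C : ℝ, 0 < C ∧ ∀ (L w : ℝ) (D : Finset ℕ), 0 ≤ w →
    (∀ b ∈ D, Real.exp (L / 2) < b ∧ ∀ p : ℕ, p.Prime → p ∣ b → (p : ℝ) ≤ w) →
    ∑ b ∈ D, 1 / (b : ℝ) ≤ Real.exp (C * w ^ (1 / 8 : ℝ)) * Real.exp (-(L / 16)) := by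
  obtain ⟨C, hC, h⟩ := exists_sum_smooth_rpow_le (s := 7 / 8) (by norm_num) (by norm_num)
  refine ⟨C, hC, fun L w D hw hD => ?_⟩
  have hb0 : ∀ b ∈ D, (0 : ℝ) < b := fun b hb => (Real.exp_pos _).trans (hD b hb).1
  have h1 : ∀ b ∈ D, 1 / (b : ℝ) ≤ (b : ℝ) ^ (-(7 / 8) : ℝ) * Real.exp (-(L / 16)) := by
    intro b hb
    have hb0 := hb0 b hb
    have h2 : (b : ℝ) ^ (-(1 / 8) : ℝ) ≤ Real.exp (-(L / 16)) := by
      have h3 : L / 2 < Real.log b := (Real.lt_log_iff_exp_lt hb0).2 (hD b hb).1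
      rw [Real.rpow_def_of_pos hb0, Real.exp_le_exp]
      linarith
    calc 1 / (b : ℝ) = (b : ℝ) ^ (-(7 / 8) : ℝ) * (b : ℝ) ^ (-(1 / 8) : ℝ) := by
          rw [← Real.rpow_add hb0, show (-(7 / 8) + -(1 / 8) : ℝ) = -1 by norm_num,
            Real.rpow_neg_one, one_div]
      _ ≤ _ := by gcongr
  refine (Finset.sum_le_sum h1).trans ?_
  rw [← Finset.sum_mul]
  refine mul_le_mul_of_nonneg_right ?_ (Real.exp_pos _).le
  have h4 := h w D hw fun b hb =>
    ⟨by have := hb0 b hb; intro h0; rw [h0] at this; simp at this, (hD b hb).2⟩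
  rwa [show (1 - 7 / 8 : ℝ) = 1 / 8 by norm_num] at h4

theorem le_totient_div {x α : ℝ} {k : ℕ} (hx : 0 < x) (hk : 0 < k) (hkx : (k : ℝ) < x ^ (1 - α)) :
    x ^ α ≤ x / k.totient := by
  have hφ0 : (0 : ℝ) < k.totient := by exact_mod_cast Nat.totient_pos.2 hk
  have hφk : (k.totient : ℝ) ≤ k := by exact_mod_cast Nat.totient_le k
  rw [le_div_iff₀ hφ0]
  calc x ^ α * k.totient ≤ x ^ α * x ^ (1 - α) := by
        refine mul_le_mul_of_nonneg_left (by linarith) (by positivity)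
    _ = x := by rw [← Real.rpow_add hx]; simp

theorem sum_progression_le_of_growth {f : ArithmeticFunction ℝ} {G ε x : ℝ} {k a : ℕ}
    (hG : 0 ≤ G) (hε : 0 ≤ ε) (hx : 2 ≤ x)
    (hgr : ∀ n : ℕ, 1 ≤ n → f n ≤ G * (n : ℝ) ^ ε) (S : Finset ℕ) (hS : S ⊆ progression x k a) :
    ∑ n ∈ S, f n ≤ G * Real.exp (2 * ε * Real.log x) * S.card := by
  have hx0 : 0 < x := by linarith
  have h1 : ∀ n ∈ S, f n ≤ G * Real.exp (2 * ε * Real.log x) := by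
    intro n hn
    obtain ⟨h2, h3⟩ := le_of_mem_progression (hS hn)
    have hn0 : (0 : ℝ) < n := by linarith
    refine (hgr n (by exact_mod_cast hn0)).trans (mul_le_mul_of_nonneg_left ?_ hG)
    calc (n : ℝ) ^ ε ≤ (x ^ 2) ^ ε := Real.rpow_le_rpow hn0.le (by nlinarith) hε
      _ = _ := by
        rw [← Real.rpow_natCast, ← Real.rpow_mul hx0.le, Real.rpow_def_of_pos hx0]
        congr 1; push_cast; ring
  refine (Finset.sum_le_sum h1).trans (le_of_eq ?_)
  rw [Finset.sum_const, nsmul_eq_mul]; ring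

/-! ### The range of very small `Q`. -/

/-- The case `Q ≤ log x`, where there are very few smooth numbers. -/
theorem exists_sum_progression_le_of_le_log {α c K : ℝ} (hα0 : 0 < α) (hc0 : 0 < c)
    (hK : c / α < K) :
    ∃ ε x₀ : ℝ, 0 < ε ∧ ∀ x : ℝ, x₀ ≤ x → ∀ k a : ℕ, 0 < k → (k : ℝ) < x ^ (1 - α) →
      ∀ Q : ℝ, Real.log x ^ K ≤ Q → Q ≤ Real.log x →
      ∀ (f : ArithmeticFunction ℝ) (G : ℝ), (∀ n, 0 ≤ f n) → 0 ≤ G →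
      (∀ n : ℕ, 1 ≤ n → f n ≤ G * (n : ℝ) ^ ε) → SmoothSupported Q f →
      ∑ n ∈ progression x k a, f n ≤
        G * (dickman (Real.log x / Real.log Q) ^ c * (x / (k.totient * Real.log x)) *
          Real.exp (primeSum f Q k)) := by
  have hK0 : 0 < K := lt_trans (by positivity) hK
  set η : ℝ := α - c / K with hη
  have hη0 : 0 < η := by
    rw [hη, sub_pos, div_lt_iff₀ hK0]
    rw [div_lt_iff₀ hα0] at hK; linarith
  have hcK : 0 < c / K := by positivity
  -- The power `n^s` occurs twice, in the growth of `f` and in Rankin's count, each costing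
  -- `x^(2s)`; together they cost at most `x^(η/4)`.
  set s : ℝ := min (η / 16) (1 / 2) with hs
  have hs0 : 0 < s := by positivity
  have hs1 : s < 1 := lt_of_le_of_lt (min_le_right _ _) (by norm_num)
  have hsη : s ≤ η / 16 := min_le_left _ _
  obtain ⟨C, hC, hsm⟩ := exists_sum_smooth_rpow_le hs0 hs1
  -- Makes `c(1+δ)/K = c/K + η/4`. The total cost `η/2` of the sum then stays below the available `α
  -- - c/K - η/4 = 3η/4`.
  set δ : ℝ := η / (4 * (c / K)) with hδ
  have hδ0 : 0 < δ := by positivity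
  have hev := (eventually_mul_exp_rpow_le (A := 1) (C := C) (s := 1 - s) (η := η / 4) one_pos
    (by linarith) (by positivity)).and ((eventually_exp_le_dickman_rpow hc0 hδ0 hK0).and
    (Filter.eventually_ge_atTop 1))
  obtain ⟨X₀, hX₀⟩ := Filter.eventually_atTop.1 hev
  refine ⟨s, max 3 (Real.exp X₀), hs0, ?_⟩
  intro x hx k a hk hkx Q hKQ hQ f G hf0 hG hgr hsupp
  have hx3 : 3 ≤ x := (le_max_left _ _).trans hx
  have hx0 : 0 < x := by linarith
  have hXX : X₀ ≤ Real.log x := by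
    rw [Real.le_log_iff_exp_le hx0]; exact (le_max_right _ _).trans hx
  obtain ⟨hE1, hE2, hX1⟩ := hX₀ _ hXX
  set X : ℝ := Real.log x with hX
  have hX0 : 0 < X := by linarith
  have hQ0 : 0 < Q := lt_of_lt_of_le (by positivity) hKQ
  have hlQ : K * Real.log X ≤ Real.log Q := by
    rw [← Real.log_rpow hX0]; exact Real.log_le_log (by positivity) hKQ
  have hlQX : Real.log Q ≤ X :=
    (Real.log_le_log hQ0 hQ).trans ((Real.log_le_sub_one_of_pos hX0).trans (by linarith))
  have hρ := hE2 _ hlQ hlQX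
  have hφ0 : (0 : ℝ) < k.totient := by exact_mod_cast Nat.totient_pos.2 hk
  set S := (progression x k a).filter fun n => f n ≠ 0 with hS
  have hSsub : S ⊆ progression x k a := Finset.filter_subset _ _
  have hcard : (S.card : ℝ) ≤ Real.exp (2 * s * X) * Real.exp (C * X ^ (1 - s)) := by
    have h1 : ∑ n ∈ S, (n : ℝ) ^ (-s) ≤ Real.exp (C * Q ^ (1 - s)) := by
      refine hsm Q S hQ0.le fun n hn => ?_
      have hmem := hsupp (mem_filter.1 hn).2
      refine ⟨Nat.ne_zero_of_mem_smoothNumbers hmem, fun p hp hpn => ?_⟩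
      have := Nat.mem_smoothNumbers'.1 hmem p hp hpn
      exact (Nat.cast_le.2 (Nat.lt_succ_iff.1 this)).trans (Nat.floor_le hQ0.le)
    have h2 : ∀ n ∈ S, (1 : ℝ) ≤ Real.exp (2 * s * X) * (n : ℝ) ^ (-s) := by
      intro n hn
      obtain ⟨h3, h4⟩ := le_of_mem_progression (hSsub hn)
      have hn0 : (0 : ℝ) < n := by linarith
      have h5 : Real.log n ≤ 2 * X := by
        rw [hX, ← Real.log_rpow hx0]
        refine Real.log_le_log hn0 ?_
        rw [Real.rpow_two]; nlinarith
      rw [Real.rpow_def_of_pos hn0, ← Real.exp_add, Real.one_le_exp_iff]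
      nlinarith
    calc (S.card : ℝ) = ∑ n ∈ S, (1 : ℝ) := by simp
      _ ≤ ∑ n ∈ S, Real.exp (2 * s * X) * (n : ℝ) ^ (-s) := Finset.sum_le_sum h2
      _ = Real.exp (2 * s * X) * ∑ n ∈ S, (n : ℝ) ^ (-s) := by rw [Finset.mul_sum]
      _ ≤ Real.exp (2 * s * X) * Real.exp (C * X ^ (1 - s)) := by
        refine mul_le_mul_of_nonneg_left (h1.trans (Real.exp_le_exp.2 ?_)) (Real.exp_pos _).le
        refine mul_le_mul_of_nonneg_left ?_ hC.le
        exact Real.rpow_le_rpow hQ0.le hQ (by linarith)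
  have h3 := sum_progression_le_of_growth (f := f) hG hs0.le (by linarith) hgr S hSsub
  have h4 : ∑ n ∈ progression x k a, f n = ∑ n ∈ S, f n :=
    (Finset.sum_filter_ne_zero _).symm
  rw [h4]
  refine h3.trans ?_
  rw [mul_assoc]
  refine mul_le_mul_of_nonneg_left ?_ hG
  have h5 : 1 ≤ Real.exp (primeSum f Q k) := Real.one_le_exp (primeSum_nonneg hf0 Q k)
  have h6 : Real.exp (α * X) / X ≤ x / (k.totient * X) := by
    rw [← div_div]
    have := le_totient_div hx0 hk hkx
    rw [Real.rpow_def_of_pos hx0, mul_comm] at this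
    gcongr
  have h7 : c * (1 + δ) / K = c / K + η / 4 := by
    rw [hδ]; field_simp
  rw [h7] at hρ
  have hρ0 : 0 ≤ dickman (X / Real.log Q) ^ c := Real.rpow_nonneg (dickman_pos _).le _
  calc Real.exp (2 * s * X) * S.card ≤
      Real.exp (2 * s * X) * (Real.exp (2 * s * X) * Real.exp (C * X ^ (1 - s))) := by gcongr
    _ = Real.exp (4 * s * X) * (1 * X * Real.exp (C * X ^ (1 - s))) / X := by
        rw [show 4 * s * X = 2 * s * X + 2 * s * X by ring, Real.exp_add]; field_simp
    _ ≤ Real.exp (η / 4 * X) * Real.exp (η / 4 * X) / X := by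
        have : 4 * s * X ≤ η / 4 * X := mul_le_mul_of_nonneg_right (by linarith) hX0.le
        gcongr
    _ ≤ Real.exp (-((c / K + η / 4) * X)) * (Real.exp (α * X) / X) := by
        rw [← mul_div_assoc, ← Real.exp_add, ← Real.exp_add]
        refine div_le_div_of_nonneg_right (Real.exp_le_exp.2 ?_) hX0.le
        have h8 : α * X = (η + c / K) * X := by rw [hη]; ring
        have h9 : 0 < η * X := by positivity
        linarith
    _ ≤ dickman (X / Real.log Q) ^ c * (x / (k.totient * X)) := by gcongr
    _ ≤ _ := le_mul_of_one_le_right (by positivity) h5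

/-! ### The range `Q ≥ log x`: decomposition into classes. -/

/-- The integers `b ≤ e^L` prime to `k` with prime factors at most `e^{L/r}`, and `b ≥ e^{L/2}`
unless `r = 1`. -/
noncomputable def smoothClass (k : ℕ) (L : ℝ) (r : ℕ) : Finset ℕ :=
  open Classical in (Icc 1 ⌊Real.exp L⌋₊).filter fun b => b.Coprime k ∧
    (∀ p : ℕ, p.Prime → p ∣ b → (p : ℝ) ≤ Real.exp (L / r)) ∧ (r = 1 ∨ Real.exp (L / 2) ≤ b)

theorem mem_smoothClass {k b r : ℕ} {L : ℝ} : b ∈ smoothClass k L r ↔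
    b ∈ Icc 1 ⌊Real.exp L⌋₊ ∧ b.Coprime k ∧
    (∀ p : ℕ, p.Prime → p ∣ b → (p : ℝ) ≤ Real.exp (L / r)) ∧
      (r = 1 ∨ Real.exp (L / 2) ≤ b) := by
  classical
  rw [smoothClass, mem_filter]

/-- `n = b d` with `b` in the `r`-th smooth class and `d` free of primes up to `e^{L/(r+1)}`. -/
def HasClassSplitting (k : ℕ) (L : ℝ) (r n : ℕ) : Prop :=
  ∃ b d : ℕ, b ∈ smoothClass k L r ∧ b * d = n ∧ b.Coprime d ∧
    ∀ p : ℕ, p.Prime → p ∣ d → Real.exp (L / (r + 1)) < p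

/-- Split `n` at `e^L` with next prime `q`. If `q > e^(L/2)`, class 1 applies. Otherwise either `b ≤
e^(L/2)`, which forces a high power of `q` and hence a large square, or `b` is large; then `q ≤
e^(4T)` makes `b` very smooth, and for larger `q` the class is `⌊L / log q⌋`. -/
theorem smoothClass_trichotomy {k n : ℕ} {L T Q : ℝ} (hL : 0 < L) (hT : 1 ≤ T) (hTL : 4 * T < L)
    (hn : n ≠ 0) (hLn : Real.exp L < n) (hnk : n.Coprime k)
    (hnQ : ∀ p : ℕ, p.Prime → p ∣ n → (p : ℝ) ≤ Q) :
    (∃ s : ℕ, s ^ 2 ∣ n ∧ ((s ^ 2 : ℕ) : ℝ) ≤ Real.exp L ∧ Real.exp (L / 2) < (s : ℝ) ^ 3) ∨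
    (∃ b : ℕ, b ∣ n ∧ (b : ℝ) ≤ Real.exp L ∧ Real.exp (L / 2) < b ∧
      ∀ p : ℕ, p.Prime → p ∣ b → (p : ℝ) ≤ Real.exp (4 * T)) ∨
    ∃ r : ℕ, 1 ≤ r ∧ (r : ℝ) ≤ L ∧ 4 * r * T < L ∧ L < (r + 1) * Real.log Q ∧
      HasClassSplitting k L r n := by
  obtain ⟨b, d, q, e, hbd, hcop, hbL, hq, hqn, hqe, hbq, hbp, hdp⟩ :=
    exists_smooth_rough_splitting hn (Real.one_le_exp hL.le) hLn
  have hq0 : (0 : ℝ) < q := by exact_mod_cast hq.pos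
  have hlqQ : Real.log q ≤ Real.log Q := Real.log_le_log hq0 (hnQ q hq hqn)
  have hb0 : 0 < b := Nat.pos_of_ne_zero (by rintro rfl; simp at hbd; exact hn hbd.symm)
  have hb0' : (0 : ℝ) < b := by exact_mod_cast hb0
  have hbn : b ∣ n := ⟨d, hbd.symm⟩
  have hbk : b.Coprime k := hnk.coprime_dvd_left hbn
  have hbm : b ∈ Icc 1 ⌊Real.exp L⌋₊ := mem_Icc.2 ⟨hb0, Nat.le_floor hbL⟩
  have hlt : ∀ {y : ℝ}, y < Real.log q → Real.exp y < q := fun h =>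
    (Real.lt_log_iff_exp_lt hq0).1 h
  -- Here `⌊L / log q⌋` may be 0; all these `n` go into class 1, which asks for no lower bound on
  -- `b`.
  by_cases hq2 : L / 2 < Real.log q
  · refine Or.inr (Or.inr ⟨1, le_rfl, ?_, ?_, ?_, b, d, ?_, hbd, hcop, ?_⟩)
    · push_cast; linarith
    · push_cast; linarith
    · push_cast; linarith
    · refine mem_smoothClass.2 ⟨hbm, hbk, fun p hp hpb => ?_, Or.inl rfl⟩
      rw [Nat.cast_one, div_one]
      exact (Nat.cast_le.2 (Nat.le_of_dvd hb0 hpb)).trans hbL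
    · intro p hp hpd
      refine lt_of_lt_of_le (hlt ?_) (Nat.cast_le.2 (hdp p hp hpd))
      push_cast; linarith
  have hqL : (q : ℝ) ≤ Real.exp (L / 2) := by
    rw [← Real.log_le_iff_le_exp hq0]; exact not_lt.1 hq2
  have hexp2 : Real.exp L = Real.exp (L / 2) * Real.exp (L / 2) := by
    rw [← Real.exp_add]; congr 1; ring
  by_cases hb2 : (b : ℝ) ≤ Real.exp (L / 2)
  · left
    have h1 : Real.exp (L / 2) < (q : ℝ) ^ e := by
      by_contra h
      have := mul_le_mul hb2 (not_lt.1 h) (by positivity) (Real.exp_pos _).le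
      rw [← hexp2] at this
      linarith
    obtain ⟨s, h2, h3, h4⟩ := exists_large_square_dvd hq (Real.one_le_exp (by positivity)) hqL hqe h1
    exact ⟨s, h2, by rw [hexp2, ← sq]; exact h3, h4⟩
  rw [not_le] at hb2
  by_cases hqT : Real.log q ≤ 4 * T
  · refine Or.inr (Or.inl ⟨b, hbn, hbL, hb2, fun p hp hpb => ?_⟩)
    refine (Nat.cast_le.2 (hbp p hp hpb).le).trans ?_
    rwa [← Real.log_le_iff_le_exp hq0]
  rw [not_le] at hqT
  have hlq0 : 0 < Real.log q := by linarith
  set r : ℕ := ⌊L / Real.log q⌋₊ with hr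
  have hr1 : 1 ≤ r := Nat.le_floor (by rw [Nat.cast_one, le_div_iff₀ hlq0]; linarith)
  have hr1' : (1 : ℝ) ≤ r := by exact_mod_cast hr1
  have hrL : r * Real.log q ≤ L := by
    rw [← le_div_iff₀ hlq0]; exact Nat.floor_le (by positivity)
  have hLr : L < (r + 1) * Real.log q := by
    rw [← div_lt_iff₀ hlq0]; exact Nat.lt_floor_add_one _
  have h4T : 4 * r * T < L := by nlinarith
  refine Or.inr (Or.inr ⟨r, hr1, by nlinarith, h4T, ?_, b, d, ?_, hbd, hcop, ?_⟩)
  · refine hLr.trans_le ?_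
    gcongr
  · refine mem_smoothClass.2 ⟨hbm, hbk, fun p hp hpb => ?_, Or.inr hb2.le⟩
    refine (Nat.cast_le.2 (hbp p hp hpb).le).trans ?_
    rw [← Real.log_le_iff_le_exp hq0, le_div_iff₀ (by linarith)]
    linarith
  · intro p hp hpd
    refine lt_of_lt_of_le (hlt ?_) (Nat.cast_le.2 (hdp p hp hpd))
    rw [div_lt_iff₀ (by linarith)]
    linarith

theorem class_main_factor_eq {α X y φ r : ℝ} (hα : 0 < α) (hX : 0 < X) (hφ : 0 < φ)
    (hr : 0 ≤ r) :
    65 * y / (φ * (α / 2 * X / (r + 1))) = 130 / α * (r + 1) * (y / (φ * X)) := by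
  field_simp
  ring

theorem class_exponent_eq {α X r : ℝ} (hα : 0 < α) (hX : 0 < X) (hr : 0 ≤ r) :
    2 * X / (α / 2 * X / (r + 1)) = 4 * (r + 1) / α := by
  field_simp
  ring

-- Sieve bound, Rankin bound and comparison of exponents combine with `z = e^L` and `w =
-- e^(L/(r+1))`. The factor `(1/2)^r` makes the sum over the classes converge.
set_option maxHeartbeats 2000000 in
theorem exists_sum_class_le {α c A : ℝ} (hα0 : 0 < α) (hα : α < 1 / 2) (hc0 : 0 < c)
    (hc : c ≤ α / 82) (hA : 1 ≤ A) :
    ∃ B : ℝ, 0 < B ∧ ∀ (x L T : ℝ) (k a r : ℕ), 0 < Real.log x → L = α / 2 * Real.log x → 2 ≤ x →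
      8 * Real.log 2 ≤ T → T = Real.log (Real.log x) → 0 < k → (k : ℝ) < x ^ (1 - α) →
      a.Coprime k → 1 ≤ r → 4 * r * T < L →
      ∀ (Q H G : ℝ) (f : ArithmeticFunction ℝ), 1 ≤ Real.log x / Real.log Q →
      Real.log x / Real.log Q ≤ 2 / α * (r + 1) → f.IsMultiplicative → (∀ n, 0 ≤ f n) →
      1 ≤ H → 1 ≤ G → (∀ p l : ℕ, p.Prime → 1 ≤ l → f (p ^ l) ≤ H ^ l) →
      (∀ n : ℕ, 1 ≤ n → f n ≤ G * (n : ℝ) ^ (1 / 8 : ℝ)) → SmoothSupported Q f →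
      H ≤ A * (Real.log x / Real.log Q) ^ (α / 100) →
      ∀ S : Finset ℕ, S ⊆ progression x k a → (∀ n ∈ S, HasClassSplitting k L r n) →
      ∑ n ∈ S, f n ≤ B * (1 / 2) ^ r * (G *
        (dickman (Real.log x / Real.log Q) ^ c * (x / (k.totient * Real.log x)) *
          Real.exp (primeSum f Q k))) := by
  obtain ⟨C, hC, hran⟩ := exists_sum_smooth_div_le
  obtain ⟨B, hB, hfac⟩ := exists_forall_class_factor_le hα0 hα hc0 hc hA hC
  refine ⟨B, hB, ?_⟩
  intro x L T k a r hX0 hL hx2 hT hTX hk hkx hak hr hrT Q H G f hu1 hur hf hf0 hH hG hpp hgr hsupp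
    hHu S hS hSr
  set X := Real.log x with hX
  have hx0 : 0 < x := by linarith
  have hL0 : 0 < L := by rw [hL]; positivity
  have hr1 : (1 : ℝ) ≤ r := by exact_mod_cast hr
  have hr0 : (0 : ℝ) < r := by linarith
  have hl2 : 0 < Real.log 2 := Real.log_pos (by norm_num)
  have hl21 : (1 / 2 : ℝ) < Real.log 2 := by have := Real.log_two_gt_d9; linarith
  have hT1 : 1 ≤ T := by linarith
  have hφ0 : (0 : ℝ) < k.totient := by exact_mod_cast Nat.totient_pos.2 hk
  have hrX : (r : ℝ) ≤ X := by
    have h1 : (r : ℝ) * 1 ≤ r * T := by gcongr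
    have h2 : L ≤ X := by rw [hL]; nlinarith
    nlinarith
  have hlrT : Real.log r ≤ T := by rw [hTX]; exact Real.log_le_log hr0 hrX
  -- The cutoff `4 r T < L` is designed for this bound, which keeps Rankin's exponent at most `1/8`;
  -- it also keeps `w` above `2^16` below.
  have hrlr : r * Real.log r ≤ L / 4 := by
    have : (r : ℝ) * Real.log r ≤ r * T := by gcongr
    linarith
  have hw16 : (2 : ℝ) ^ 16 ≤ Real.exp (L / (r + 1)) := by
    rw [← Real.log_le_iff_le_exp (by positivity), Real.log_pow, le_div_iff₀ (by positivity)]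
    push_cast
    nlinarith
  have hLr : L / (r + 1) ≤ α / 4 * X := by
    rw [div_le_iff₀ (by positivity), hL]
    have : 0 ≤ α * X * (r - 1) := mul_nonneg (by positivity) (by linarith)
    nlinarith
  -- The three factors are at most `x^(1-α)`, `x^(α/2)` and `x^(α/4)`; this is why `L` carries the
  -- factor `α/2`.
  have hkzw : k * Real.exp L * Real.exp (L / (r + 1)) ≤ x := by
    have hk1 : (k : ℝ) ≤ Real.exp ((1 - α) * X) := by
      rw [Real.rpow_def_of_pos hx0, mul_comm] at hkx; exact hkx.le
    calc k * Real.exp L * Real.exp (L / (r + 1)) ≤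
        Real.exp ((1 - α) * X) * Real.exp L * Real.exp (α / 4 * X) := by gcongr
      _ = Real.exp ((1 - α / 4) * X) := by
        rw [← Real.exp_add, ← Real.exp_add, hL]; congr 1; ring
      _ ≤ Real.exp X := Real.exp_le_exp.2 (by nlinarith)
      _ = x := Real.exp_log hx0
  have h1 := sum_smooth_mul_rough_le hf hf0 hH hpp hw16 (by linarith) hk hak hkzw S
    (smoothClass k L r) hS (fun b hb => by
      have h2 := mem_Icc.1 (mem_smoothClass.1 hb).1
      exact ⟨by omega, (Nat.cast_le.2 h2.2).trans (Nat.floor_le (Real.exp_pos _).le)⟩) hSr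
  have h2 := hran f H G hf hf0 hH hG hpp hgr Q hsupp k r L (smoothClass k L r) hr hL0 hrlr
    (fun b hb => by
      obtain ⟨h3, h4, h5, -⟩ := mem_smoothClass.1 hb
      have := (mem_Icc.1 h3).1
      exact ⟨by omega, h4, h5⟩) (by
      by_cases h : r = 1
      · exact Or.inl h
      · exact Or.inr fun b hb => ((mem_smoothClass.1 hb).2.2.2).resolve_left h)
  have h3 := hfac r _ H hr hu1 hur hH hHu
  set P := primeSum f Q k with hP
  set u := X / Real.log Q with hu
  rw [Real.log_exp] at h1
  have h4 : H ^ (Real.log (2 * x) / (L / (r + 1))) ≤ H ^ (4 * (r + 1) / α) := by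
    refine Real.rpow_le_rpow_of_exponent_le hH ?_
    have h5 : Real.log (2 * x) ≤ 2 * X := by
      rw [hX, ← Real.log_rpow hx0, Real.rpow_two]
      exact Real.log_le_log (by positivity) (by nlinarith)
    calc Real.log (2 * x) / (L / (r + 1)) ≤ 2 * X / (L / (r + 1)) := by gcongr
      _ = _ := by rw [hL]; exact class_exponent_eq hα0 hX0 hr0.le
  have h5 : 65 * x / (k.totient * (L / (r + 1))) = 130 / α * (r + 1) * (x / (k.totient * X)) := by
    rw [hL]; exact class_main_factor_eq hα0 hX0 hφ0 hr0.le
  have h6 : Real.exp (C * H * √r + P - r * Real.log r / 4) =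
      Real.exp (C * H * √r - r * Real.log r / 4) * Real.exp P := by
    rw [← Real.exp_add]; congr 1; ring
  calc ∑ n ∈ S, f n ≤ _ := h1
    _ ≤ 130 / α * (r + 1) * (x / (k.totient * X)) * H ^ (4 * (r + 1) / α) *
        (G * Real.exp (C * H * √r + P - r * Real.log r / 4)) := by
        rw [h5]
        refine mul_le_mul (mul_le_mul_of_nonneg_left h4 (by positivity)) h2
          (Finset.sum_nonneg fun b _ => div_nonneg (hf0 b) (Nat.cast_nonneg b)) (by positivity)
    _ = (130 / α * (r + 1) * H ^ (4 * (r + 1) / α) *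
        Real.exp (C * H * √r - r * Real.log r / 4)) * (G * (x / (k.totient * X) * Real.exp P)) := by
        rw [h6]; ring
    _ ≤ (B * (1 / 2) ^ r * dickman u ^ c) * (G * (x / (k.totient * X) * Real.exp P)) := by
        gcongr
    _ = _ := by ring

theorem three_mul_div_eq {X y k : ℝ} (hX : 0 < X) (hk : 0 < k) :
    3 * y / k = 3 * X * (y / (k * X)) := by
  field_simp

set_option maxHeartbeats 2000000 in
/-- The case `log x ≤ Q ≤ x`. -/
theorem exists_sum_progression_le_of_log_le {α c A : ℝ} (hα0 : 0 < α) (hα : α < 1 / 2)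
    (hc0 : 0 < c) (hc : c ≤ α / 82) (hA : 1 ≤ A) :
    ∃ B x₀ : ℝ, 0 < B ∧ ∀ x : ℝ, x₀ ≤ x → ∀ k a : ℕ, 0 < k → (k : ℝ) < x ^ (1 - α) →
      a.Coprime k → ∀ Q : ℝ, Real.log x ≤ Q → Q ≤ x →
      ∀ (f : ArithmeticFunction ℝ) (H G : ℝ), f.IsMultiplicative → (∀ n, 0 ≤ f n) → 1 ≤ H → 1 ≤ G →
      (∀ p l : ℕ, p.Prime → 1 ≤ l → f (p ^ l) ≤ H ^ l) →
      (∀ n : ℕ, 1 ≤ n → f n ≤ G * (n : ℝ) ^ (α / 1000)) → SmoothSupported Q f →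
      H ≤ A * (Real.log x / Real.log Q) ^ (α / 100) →
      ∑ n ∈ progression x k a, f n ≤
        B * (G * (dickman (Real.log x / Real.log Q) ^ c * (x / (k.totient * Real.log x)) *
          Real.exp (primeSum f Q k))) := by
  classical
  obtain ⟨B, hB, hclass⟩ := exists_sum_class_le hα0 hα hc0 hc hA
  obtain ⟨Z, hZ, hsq⟩ := exists_sum_inv_sq_le
  obtain ⟨C, hC, hsm⟩ := exists_sum_smooth_inv_le
  -- The budget, in exponents of `x` divided by `α`: `ρ(u)^c` loses at most `3/164 < 1/40`, and the
  -- growth of `f` costs `2/1000`, so the divisor sums must save `27/1000`. Squares save `1/24 -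
  -- 7/500` and smooth divisors `1/32 - 1/250`; both suffice.
  have hev := (eventually_exp_le_dickman_rpow (δ := 1 / 2) hc0 (by norm_num) one_pos).and
    ((eventually_mul_exp_rpow_le (A := 3 * Z) (C := 0) (s := 0) (η := α * (7 / 500)) (by positivity)
      (by norm_num) (by positivity)).and
    ((eventually_mul_exp_rpow_le (A := 3) (C := C) (s := 1 / 2) (η := α * (1 / 250)) (by norm_num)
      (by norm_num) (by positivity)).and
    ((Real.tendsto_log_atTop.eventually_ge_atTop (8 * Real.log 2)).and
    (((Real.isLittleO_log_id_atTop.bound (show 0 < α / 16 by positivity))).and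
    (Filter.eventually_ge_atTop 1)))))
  obtain ⟨X₀, hX₀⟩ := Filter.eventually_atTop.1 hev
  refine ⟨2 + B * 2, max 3 (Real.exp X₀), by positivity, ?_⟩
  intro x hx k a hk hkx hak Q hXQ hQx f H G hf hf0 hH hG hpp hgr hsupp hHu
  have hx3 : 3 ≤ x := (le_max_left _ _).trans hx
  have hx0 : 0 < x := by linarith
  have hXX : X₀ ≤ Real.log x := by
    rw [Real.le_log_iff_exp_le hx0]; exact (le_max_right _ _).trans hx
  obtain ⟨hE1, hE2, hE3, hE4, hE5, hX1⟩ := hX₀ _ hXX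
  set X : ℝ := Real.log x with hX
  set T : ℝ := Real.log X with hT
  set L : ℝ := α / 2 * X with hL
  have hX0 : 0 < X := by linarith
  have hL0 : 0 < L := by positivity
  have hl21 : (1 / 2 : ℝ) < Real.log 2 := by have := Real.log_two_gt_d9; linarith
  have hT1 : 1 ≤ T := by linarith
  have hTL : 4 * T < L := by
    simp only [id, Real.norm_eq_abs] at hE5
    rw [abs_of_pos (by linarith), abs_of_pos hX0] at hE5
    rw [hL]; nlinarith
  have hQ0 : 0 < Q := by linarith
  have hlQT : T ≤ Real.log Q := Real.log_le_log hX0 hXQ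
  have hlQ0 : 0 < Real.log Q := by linarith
  have hlQX : Real.log Q ≤ X := Real.log_le_log hQ0 hQx
  have hu1 : 1 ≤ X / Real.log Q := by rw [le_div_iff₀ hlQ0]; linarith
  have hρ := hE1 _ (by rw [one_mul]; exact hlQT) hlQX
  set u := X / Real.log Q with hu
  have hφ0 : (0 : ℝ) < k.totient := by exact_mod_cast Nat.totient_pos.2 hk
  have hφk : (k.totient : ℝ) ≤ k := by exact_mod_cast Nat.totient_le k
  have hk0 : (0 : ℝ) < k := by exact_mod_cast hk
  set P := primeSum f Q k with hP
  have hP1 : 1 ≤ Real.exp P := Real.one_le_exp (primeSum_nonneg hf0 Q k)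
  have hρ0 : 0 ≤ dickman u ^ c := Real.rpow_nonneg (dickman_pos _).le _
  set E := dickman u ^ c * (x / (k.totient * X)) * Real.exp P with hE
  -- a lower bound for the right-hand side
  have hElow : Real.exp (-(α / 40 * X)) * (x / (k * X)) ≤ E := by
    have h1 : Real.exp (-(α / 40 * X)) ≤ dickman u ^ c := by
      refine le_trans (Real.exp_le_exp.2 ?_) hρ
      rw [neg_le_neg_iff]
      refine mul_le_mul_of_nonneg_right ?_ hX0.le
      linarith
    calc Real.exp (-(α / 40 * X)) * (x / (k * X)) ≤ dickman u ^ c * (x / (k.totient * X)) := by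
          gcongr
      _ ≤ E := le_mul_of_one_le_right (by positivity) hP1
  have hexpL : Real.exp L * k ≤ x := by
    have hk1 : (k : ℝ) ≤ Real.exp ((1 - α) * X) := by
      rw [Real.rpow_def_of_pos hx0, mul_comm] at hkx; exact hkx.le
    calc Real.exp L * k ≤ Real.exp L * Real.exp ((1 - α) * X) := by gcongr
      _ = Real.exp ((1 - α / 2) * X) := by rw [← Real.exp_add, hL]; congr 1; ring
      _ ≤ Real.exp X := Real.exp_le_exp.2 (by nlinarith)
      _ = x := Real.exp_log hx0
  set S := (progression x k a).filter fun n => f n ≠ 0 with hS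
  have hSsub : S ⊆ progression x k a := Finset.filter_subset _ _
  have hgr8 : ∀ n : ℕ, 1 ≤ n → f n ≤ G * (n : ℝ) ^ (1 / 8 : ℝ) := by
    intro n hn
    refine (hgr n hn).trans (mul_le_mul_of_nonneg_left ?_ (by linarith))
    exact Real.rpow_le_rpow_of_exponent_le (by exact_mod_cast hn) (by linarith)
  -- the three kinds of integers
  set P₂ : ℕ → Prop := fun n => ∃ s : ℕ, s ^ 2 ∣ n ∧ ((s ^ 2 : ℕ) : ℝ) ≤ Real.exp L ∧
    Real.exp (L / 2) < (s : ℝ) ^ 3 with hP₂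
  set P₃ : ℕ → Prop := fun n => ∃ b : ℕ, b ∣ n ∧ (b : ℝ) ≤ Real.exp L ∧ Real.exp (L / 2) < b ∧
    ∀ p : ℕ, p.Prime → p ∣ b → (p : ℝ) ≤ Real.exp (4 * T) with hP₃
  set P₄ : ℕ → ℕ → Prop := fun r n => 4 * r * T < L ∧ L < (r + 1) * Real.log Q ∧
    HasClassSplitting k L r n with hP₄
  set N := ⌊L⌋₊ with hN
  have hcover : ∀ n ∈ S, f n ≤ (if P₂ n then f n else 0) + (if P₃ n then f n else 0) +
      ∑ r ∈ Icc 1 N, if P₄ r n then f n else 0 := by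
    intro n hn
    obtain ⟨hnP, hfn⟩ := mem_filter.1 hn
    obtain ⟨hxn, -⟩ := le_of_mem_progression hnP
    have hn0 : (0 : ℝ) < n := by linarith
    have hLn : Real.exp L < n := by
      refine lt_of_lt_of_le ?_ hxn
      rw [← Real.exp_log hx0]
      exact Real.exp_lt_exp.2 (by rw [hL]; nlinarith)
    have hmem := hsupp hfn
    have ht := smoothClass_trichotomy (k := k) (n := n) hL0 hT1 hTL
      (Nat.ne_zero_of_mem_smoothNumbers hmem) hLn (coprime_of_mem_progression hak hnP) (by
        intro p hp hpn
        have := Nat.mem_smoothNumbers'.1 hmem p hp hpn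
        exact (Nat.cast_le.2 (Nat.lt_succ_iff.1 this)).trans (Nat.floor_le hQ0.le))
    have h0 : ∀ (R : Prop) [Decidable R], 0 ≤ if R then f n else 0 := fun R _ => by
      split_ifs
      · exact hf0 n
      · exact le_rfl
    have h0s : 0 ≤ ∑ r ∈ Icc 1 N, if P₄ r n then f n else 0 :=
      Finset.sum_nonneg fun r _ => h0 _
    rcases ht with h | h | ⟨r, hr1, hrL, h⟩
    · have := h0 (P₃ n)
      rw [if_pos (show P₂ n from h)]; linarith
    · have := h0 (P₂ n)
      rw [if_pos (show P₃ n from h)]; linarith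
    · have h2 := h0 (P₂ n)
      have h3 := h0 (P₃ n)
      have h4 := Finset.single_le_sum (f := fun r => if P₄ r n then f n else 0)
        (fun r _ => h0 _) (mem_Icc.2 ⟨hr1, Nat.le_floor hrL⟩)
      rw [if_pos (show P₄ r n from h)] at h4
      linarith
  have hsum : ∑ n ∈ progression x k a, f n ≤ ∑ n ∈ S.filter P₂, f n + ∑ n ∈ S.filter P₃, f n +
      ∑ r ∈ Icc 1 N, ∑ n ∈ S.filter (P₄ r), f n := by
    have h1 : ∑ n ∈ progression x k a, f n = ∑ n ∈ S, f n := (Finset.sum_filter_ne_zero _).symm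
    rw [h1]
    refine (Finset.sum_le_sum hcover).trans (le_of_eq ?_)
    rw [Finset.sum_add_distrib, Finset.sum_add_distrib, Finset.sum_comm]
    simp only [Finset.sum_filter]
  -- Common treatment of both exceptional sets: the crude growth bound for `f` times a union bound
  -- over the divisors in `D`, measured against the lower bound for the target.
  have hlow : ∀ S' : Finset ℕ, S' ⊆ S → ∀ D : Finset ℕ,
      (∀ m ∈ D, 0 < m ∧ (m : ℝ) ≤ Real.exp L) → (∀ n ∈ S', ∃ m ∈ D, m ∣ n) →
      3 * X * ∑ m ∈ D, 1 / (m : ℝ) ≤ Real.exp (-(α * (27 / 1000) * X)) →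
      ∑ n ∈ S', f n ≤ G * E := by
    intro S' hS' D hD hSD hDs
    have h1 := sum_progression_le_of_growth (f := f) (ε := α / 1000) (by linarith) (by positivity)
      (by linarith) hgr S' (hS'.trans hSsub)
    have h2 := card_exists_dvd_progression_le (by linarith) hk hak S' D (hS'.trans hSsub)
      (fun m hm => ⟨(hD m hm).1, by
        refine le_trans ?_ hexpL
        rw [mul_comm]
        exact mul_le_mul_of_nonneg_right (hD m hm).2 hk0.le⟩) hSD
    refine h1.trans ?_
    rw [mul_assoc]
    refine mul_le_mul_of_nonneg_left (le_trans ?_ hElow) (by linarith)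
    calc Real.exp (2 * (α / 1000) * X) * S'.card ≤
        Real.exp (2 * (α / 1000) * X) * (3 * x / k * ∑ m ∈ D, 1 / (m : ℝ)) := by gcongr
      _ = Real.exp (2 * (α / 1000) * X) * (3 * X * ∑ m ∈ D, 1 / (m : ℝ)) * (x / (k * X)) := by
          rw [show 3 * x / k = 3 * X * (x / (k * X)) from
            three_mul_div_eq hX0 hk0]; ring
      _ ≤ Real.exp (2 * (α / 1000) * X) * Real.exp (-(α * (27 / 1000) * X)) * (x / (k * X)) := by
          gcongr
      _ = _ := by rw [← Real.exp_add]; congr 2; ring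
  have hII : ∑ n ∈ S.filter P₂, f n ≤ G * E := by
    set D₀ := (Icc 1 ⌊Real.exp L⌋₊).filter fun s : ℕ => ((s ^ 2 : ℕ) : ℝ) ≤ Real.exp L ∧
      Real.exp (L / 2) < (s : ℝ) ^ 3 with hD₀
    refine hlow _ (Finset.filter_subset _ _) (D₀.image (· ^ 2)) ?_ ?_ ?_
    · intro m hm
      obtain ⟨s, hs, rfl⟩ := mem_image.1 hm
      obtain ⟨h1, h2, -⟩ := mem_filter.1 hs
      exact ⟨pow_pos (mem_Icc.1 h1).1 2, h2⟩
    · intro n hn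
      obtain ⟨s, h1, h2, h3⟩ := (mem_filter.1 hn).2
      have hs1 : 1 ≤ s := by
        rcases Nat.eq_zero_or_pos s with h | h
        · rw [h] at h3; norm_num at h3; linarith [Real.exp_pos (L / 2)]
        · exact h
      refine ⟨s ^ 2, mem_image_of_mem _ (mem_filter.2 ⟨mem_Icc.2 ⟨hs1, ?_⟩, h2, h3⟩), h1⟩
      have h4 : s ≤ s ^ 2 := Nat.le_self_pow two_ne_zero s
      exact h4.trans (Nat.le_floor h2)
    · have hinj : Set.InjOn (fun s : ℕ => s ^ 2) (D₀ : Set ℕ) := fun s _ t _ h =>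
        Nat.pow_left_injective two_ne_zero h
      rw [Finset.sum_image hinj]
      have h1 := hsq L D₀ fun s hs => (mem_filter.1 hs).2.2
      calc 3 * X * ∑ s ∈ D₀, 1 / ((s ^ 2 : ℕ) : ℝ) ≤ 3 * X * (Z * Real.exp (-(L / 12))) := by gcongr
        _ = 3 * Z * X * Real.exp (0 * X ^ (0 : ℝ)) * Real.exp (-(L / 12)) := by simp; ring
        _ ≤ Real.exp (α * (7 / 500) * X) * Real.exp (-(L / 12)) := by gcongr
        _ ≤ _ := by
          rw [← Real.exp_add, Real.exp_le_exp, hL]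
          have : 0 < α * X := by positivity
          linarith
  have hIII : ∑ n ∈ S.filter P₃, f n ≤ G * E := by
    set D := (Icc 1 ⌊Real.exp L⌋₊).filter fun b : ℕ => Real.exp (L / 2) < b ∧
      ∀ p : ℕ, p.Prime → p ∣ b → (p : ℝ) ≤ Real.exp (4 * T) with hD
    refine hlow _ (Finset.filter_subset _ _) D ?_ ?_ ?_
    · intro m hm
      have h1 := mem_Icc.1 (mem_filter.1 hm).1
      exact ⟨h1.1, (Nat.cast_le.2 h1.2).trans (Nat.floor_le (Real.exp_pos _).le)⟩
    · intro n hn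
      obtain ⟨b, h1, h2, h3, h4⟩ := (mem_filter.1 hn).2
      have hb : (0 : ℝ) < b := (Real.exp_pos _).trans h3
      exact ⟨b, mem_filter.2 ⟨mem_Icc.2 ⟨by exact_mod_cast hb, Nat.le_floor h2⟩, h3, h4⟩, h1⟩
    · have h1 := hsm L (Real.exp (4 * T)) D (Real.exp_pos _).le fun b hb => (mem_filter.1 hb).2
      have h2 : Real.exp (4 * T) ^ (1 / 8 : ℝ) = X ^ (1 / 2 : ℝ) := by
        rw [← Real.exp_mul, Real.rpow_def_of_pos hX0]; congr 1; ring
      rw [h2] at h1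
      calc 3 * X * ∑ b ∈ D, 1 / (b : ℝ) ≤
          3 * X * (Real.exp (C * X ^ (1 / 2 : ℝ)) * Real.exp (-(L / 16))) := by gcongr
        _ = 3 * X * Real.exp (C * X ^ (1 / 2 : ℝ)) * Real.exp (-(L / 16)) := by ring
        _ ≤ Real.exp (α * (1 / 250) * X) * Real.exp (-(L / 16)) := by gcongr
        _ ≤ _ := by
          rw [← Real.exp_add, Real.exp_le_exp, hL]
          have : 0 < α * X := by positivity
          linarith
  have hIV : ∀ r ∈ Icc 1 N, ∑ n ∈ S.filter (P₄ r), f n ≤ (1 / 2) ^ r * (B * (G * E)) := by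
    intro r hr
    -- The size conditions on `r` do not involve `n`, so any single member of the class supplies
    -- them; an empty class contributes nothing.
    rcases (S.filter (P₄ r)).eq_empty_or_nonempty with h0 | ⟨n₀, hn₀⟩
    · rw [h0, Finset.sum_empty]; positivity
    obtain ⟨h1, h2, -⟩ := (mem_filter.1 hn₀).2
    have h3 := hclass x L T k a r hX0 rfl (by linarith) hE4 rfl hk hkx hak (mem_Icc.1 hr).1 h1 Q H G
      f hu1 (by
        rw [← hX, div_le_iff₀ hlQ0, div_mul_eq_mul_div, div_mul_eq_mul_div, le_div_iff₀ hα0]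
        rw [hL] at h2
        linarith) hf hf0 hH hG hpp hgr8 hsupp hHu (S.filter (P₄ r))
      ((Finset.filter_subset _ _).trans hSsub) fun n hn => (mem_filter.1 hn).2.2.2
    refine h3.trans (le_of_eq ?_)
    ring
  have hGE : 0 ≤ G * E := by positivity
  have hgeom : ∑ r ∈ Icc 1 N, ((1 : ℝ) / 2) ^ r ≤ 2 := by
    refine le_trans (Finset.sum_le_sum_of_subset_of_nonneg (t := range (N + 1)) ?_ ?_)
      (sum_geometric_two_le _)
    · intro r hr
      have := (mem_Icc.1 hr).2
      exact mem_range.2 (by omega)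
    · intro r _ _; positivity
  have hIVs : ∑ r ∈ Icc 1 N, ∑ n ∈ S.filter (P₄ r), f n ≤ 2 * (B * (G * E)) := by
    refine (Finset.sum_le_sum hIV).trans ?_
    rw [← Finset.sum_mul]
    exact mul_le_mul_of_nonneg_right hgeom (by positivity)
  calc ∑ n ∈ progression x k a, f n ≤ _ := hsum
    _ ≤ G * E + G * E + 2 * (B * (G * E)) := add_le_add (add_le_add hII hIII) hIVs
    _ = _ := by ring

/-! ### Combining the ranges and deducing the theorem. -/

/-- The growth exponent `ε'` may be any sufficiently small number, so that part (2) can match it to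
the prescribed `ε`. The restriction on `H` is needed only for `Q ≥ log x`, where the class argument
uses it. -/
theorem exists_sum_progression_le {α c A K : ℝ} (hα0 : 0 < α) (hα : α < 1 / 2)
    (hc0 : 0 < c) (hc : c ≤ α / 82) (hA : 1 ≤ A) (hK : c / α < K) :
    ∃ ε : ℝ, 0 < ε ∧ ∀ ε' : ℝ, 0 < ε' → ε' ≤ ε → ∃ B x₀ : ℝ, 0 < B ∧ ∀ x : ℝ, x₀ ≤ x →
      ∀ k a : ℕ, 0 < k → (k : ℝ) < x ^ (1 - α) →
      a.Coprime k → ∀ Q : ℝ, Real.log x ^ K ≤ Q → Q ≤ x →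
      ∀ (f : ArithmeticFunction ℝ) (H G : ℝ), f.IsMultiplicative → (∀ n, 0 ≤ f n) → 1 ≤ H → 1 ≤ G →
      (∀ p l : ℕ, p.Prime → 1 ≤ l → f (p ^ l) ≤ H ^ l) →
      (∀ n : ℕ, 1 ≤ n → f n ≤ G * (n : ℝ) ^ ε') → SmoothSupported Q f →
      (Real.log x ≤ Q → H ≤ A * (Real.log x / Real.log Q) ^ (α / 100)) →
      ∑ n ∈ progression x k a, f n ≤
        B * (G * (dickman (Real.log x / Real.log Q) ^ c * (x / (k.totient * Real.log x)) *
          Real.exp (primeSum f Q k))) := by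
  obtain ⟨ε₁, x₁, hε₁, h₁⟩ := exists_sum_progression_le_of_le_log hα0 hc0 hK
  obtain ⟨B, x₂, hB, h₂⟩ := exists_sum_progression_le_of_log_le hα0 hα hc0 hc hA
  refine ⟨min ε₁ (α / 1000), by positivity, fun ε' hε'0 hε' => ?_⟩
  refine ⟨max 1 B, max 3 (max x₁ x₂), by positivity, ?_⟩
  intro x hx k a hk hkx hak Q hKQ hQx f H G hf hf0 hH hG hpp hgr hsupp hHu
  have hx3 : 3 ≤ x := (le_max_left _ _).trans hx
  have hx1 : x₁ ≤ x := (le_max_left _ _).trans ((le_max_right _ _).trans hx)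
  have hx2 : x₂ ≤ x := (le_max_right _ _).trans ((le_max_right _ _).trans hx)
  have hX0 : 0 < Real.log x := Real.log_pos (by linarith)
  have hgr' : ∀ δ : ℝ, ε' ≤ δ → ∀ n : ℕ, 1 ≤ n → f n ≤ G * (n : ℝ) ^ δ := by
    intro δ hδ n hn
    refine (hgr n hn).trans (mul_le_mul_of_nonneg_left ?_ (by linarith))
    exact Real.rpow_le_rpow_of_exponent_le (by exact_mod_cast hn) hδ
  have hE : 0 ≤ G * (dickman (Real.log x / Real.log Q) ^ c * (x / (k.totient * Real.log x)) *
          Real.exp (primeSum f Q k)) := by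
    have := (dickman_pos (Real.log x / Real.log Q)).le
    positivity
  rcases le_total Q (Real.log x) with h | h
  · refine (h₁ x hx1 k a hk hkx Q hKQ h f G hf0 (by linarith)
      (hgr' _ (hε'.trans (min_le_left _ _))) hsupp).trans ?_
    exact le_mul_of_one_le_left hE (le_max_left _ _)
  · refine (h₂ x hx2 k a hk hkx hak Q h hQx f H G hf hf0 hH hG hpp
      (hgr' _ (hε'.trans (min_le_right _ _))) hsupp (hHu h)).trans ?_
    exact mul_le_mul_of_nonneg_right (le_max_right _ _) hE

theorem progressionSum_le_sum_progression {f : ArithmeticFunction ℝ} (hf0 : ∀ n, 0 ≤ f n)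
    {x y : ℝ} (hyx : y ≤ x) (k a : ℕ) :
    progressionSum f x y k a ≤ ∑ n ∈ progression x k a, f n := by
  refine Finset.sum_le_sum_of_subset_of_nonneg (Finset.filter_subset_filter _ ?_) fun n _ _ => hf0 n
  exact Finset.Ico_subset_Ico_right (Nat.ceil_le_ceil (by linarith))

theorem log_le_sqrt {t : ℝ} (ht : 0 < t) : Real.log t ≤ √t := by
  have h := Real.log_le_sub_one_of_pos (show 0 < √t / 2 by positivity)
  rw [Real.log_div (by positivity) (by norm_num), Real.log_sqrt ht.le] at h
  have := Real.log_two_lt_d9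
  linarith

end

theorem mainTheorem2 (α κ : ℝ) (hα₀ : 0 < α) (hα : α < 1 / 2) (hκ₀ : 0 < κ) (hκ : κ < 1 / 2) :
    (∀ K : ℝ, expC₁ α κ / α < K → ∀ (A₁ : ℝ) (A₂ : ℝ → ℝ),
      ∃ B x₀ : ℝ, ∀ x y : ℝ, x₀ ≤ x → x ^ κ ≤ y → y ≤ x →
        ∀ k a : ℕ, 0 < k → (k : ℝ) < y ^ (1 - α) → a.Coprime k →
        ∀ Q : ℝ, Real.log x ^ K ≤ Q → Q ≤ x →
        ∀ f : ArithmeticFunction ℝ, ShiuClass A₁ A₂ f → SmoothSupported Q f →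
          progressionSum f x y k a ≤
            B * (dickman (Real.log x / Real.log Q) ^ expC₁ α κ *
              (x / ((k.totient : ℝ) * Real.log x)) * Real.exp (primeSum f Q k))) ∧
    (∃ β : ℝ, 0 < β ∧ β < α * κ / 41 ∧
      ∀ ε : ℝ, 0 < ε → ∀ K : ℝ, expC₂ α κ / α < K → ∀ (A₁ : ℝ) (A₂ A₃ : ℝ → ℝ),
      ∃ B x₀ : ℝ, ∀ x y : ℝ, x₀ ≤ x → x ^ κ ≤ y → y ≤ x →
        ∀ k a : ℕ, 0 < k → (k : ℝ) < y ^ (1 - α) → a.Coprime k →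
        ∀ Q : ℝ, Real.log x ^ K ≤ Q → Q ≤ x →
          Q ≤ Real.exp (Real.log x * Real.log (Real.log (Real.log x)) /
            Real.log (Real.log x)) →
        ∀ f : ArithmeticFunction ℝ, LargeShiuClass β A₁ A₂ A₃ x f → SmoothSupported Q f →
          progressionSum f x y k a ≤
            B * (dickman (Real.log x / Real.log Q) ^ expC₂ α κ *
              (x / ((k.totient : ℝ) * Real.log x ^ (1 - ε))) *
              Real.exp (primeSum f Q k))) := by
  have hακ : 0 < α * κ := mul_pos hα₀ hκ₀
  -- This puts both exponents below the threshold `α/82` of the core estimate.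
  have hακ2 : α * κ < α / 2 := by nlinarith
  have hkx : ∀ {x y : ℝ} {k : ℕ}, 0 < x → x ^ κ ≤ y → y ≤ x → (k : ℝ) < y ^ (1 - α) →
      (k : ℝ) < x ^ (1 - α) := by
    intro x y k hx hxy hyx hk
    have hy0 : 0 ≤ y := (Real.rpow_nonneg hx.le κ).trans hxy
    exact hk.trans_le (Real.rpow_le_rpow hy0 hyx (by linarith))
  constructor
  · intro K hK A₁ A₂
    have hc0 : 0 < expC₁ α κ := by rw [expC₁]; positivity
    have hc : expC₁ α κ ≤ α / 82 := by rw [expC₁]; linarith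
    obtain ⟨ε, hε, h⟩ := exists_sum_progression_le hα₀ hα hc0 hc (le_max_right A₁ 1) hK
    obtain ⟨B, x₀, hB, h⟩ := h ε hε le_rfl
    refine ⟨B * A₂ ε, max 3 x₀, ?_⟩
    intro x y hx hxy hyx k a hk hky hak Q hKQ hQx f hf hsupp
    have hx3 : 3 ≤ x := (le_max_left _ _).trans hx
    have hX1 : 1 < Real.log x := by
      rw [Real.lt_log_iff_exp_lt (by linarith)]
      have := Real.exp_one_lt_d9
      linarith
    have hA₁ : 0 ≤ A₁ := by
      have := (hf.nonneg (2 ^ 1)).trans (hf.prime_pow_le 2 1 Nat.prime_two le_rfl)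
      simpa using this
    have hA₂ : 1 ≤ A₂ ε := by
      have := hf.growth ε hε 1 le_rfl
      rw [hf.multiplicative.map_one] at this
      simpa using this
    refine (progressionSum_le_sum_progression hf.nonneg hyx k a).trans ?_
    rw [mul_assoc B]
    refine h x ((le_max_right _ _).trans hx) k a hk (hkx (by linarith) hxy hyx hky) hak Q hKQ hQx f
      (max A₁ 1) (A₂ ε) hf.multiplicative hf.nonneg (le_max_right _ _) hA₂ ?_ (hf.growth ε hε) hsupp
      ?_
    · intro p l hp hl
      exact (hf.prime_pow_le p l hp hl).trans (pow_le_pow_left₀ hA₁ (le_max_left _ _) l)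
    · intro hXQ
      have hlQ : 0 < Real.log Q := Real.log_pos (by linarith)
      refine le_mul_of_one_le_right (zero_le_one.trans (le_max_right _ _)) ?_
      refine Real.one_le_rpow ?_ (by positivity)
      rw [le_div_iff₀ hlQ, one_mul]
      exact Real.log_le_log (by linarith) hQx
  -- Since `κ < 1`, this `β` is at most `α/200`, half of the admissible exponent `α/100`; the half
  -- matches the bound `u ≥ √(log log x)`.
  · refine ⟨α * κ / 200, by positivity, by linarith, ?_⟩
    intro ε hε K hK A₁ A₂ A₃
    have hc0 : 0 < expC₂ α κ := by
      rw [expC₂]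
      have : 0 < 1 - α * κ / 20 := by linarith
      positivity
    have hc : expC₂ α κ ≤ α / 82 := by rw [expC₂]; nlinarith
    obtain ⟨ε₀, hε₀, h⟩ := exists_sum_progression_le hα₀ hα hc0 hc (le_max_left 1 A₁) hK
    -- Small enough for the core estimate, and small enough that the resulting factor `(log x)^δ`
    -- fits in `(log x)^ε`.
    set δ : ℝ := min ε₀ ε with hδ
    have hδ0 : 0 < δ := lt_min hε₀ hε
    obtain ⟨B, x₀, hB, h⟩ := h δ hδ0 (min_le_left _ _)
    set M : ℝ := max 1 (max (A₂ δ) (A₃ δ)) with hM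
    have hM1 : 1 ≤ M := le_max_left _ _
    refine ⟨B * M, max (Real.exp (Real.exp 2)) x₀, ?_⟩
    intro x y hx hxy hyx k a hk hky hak Q hKQ hQx hQ f hf hsupp
    have hxe : Real.exp (Real.exp 2) ≤ x := (le_max_left _ _).trans hx
    have hx0 : 0 < x := (Real.exp_pos _).trans_le hxe
    have hXe : Real.exp 2 ≤ Real.log x := by rwa [Real.le_log_iff_exp_le hx0]
    set X : ℝ := Real.log x with hX
    have hX3 : 3 ≤ X := by have := Real.add_one_le_exp 2; linarith
    have hX0 : 0 < X := by linarith
    have hT2 : 2 ≤ Real.log X := by rwa [Real.le_log_iff_exp_le hX0]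
    set T : ℝ := Real.log X with hT
    have hT0 : 0 < T := by linarith
    have hlT : 0 < Real.log T := Real.log_pos (by linarith)
    have hA₁ : 0 ≤ A₁ := by
      have h1 := (hf.nonneg (2 ^ 1)).trans (hf.prime_pow_le 2 1 Nat.prime_two le_rfl)
      rw [pow_one] at h1
      exact nonneg_of_mul_nonneg_left h1 (by positivity)
    set β : ℝ := α * κ / 200 with hβ
    -- The constant `G = M (log x)^δ` dominates both alternatives in the growth condition of the
    -- class.
    have hG1 : 1 ≤ M * X ^ δ :=
      one_le_mul_of_one_le_of_one_le hM1 (Real.one_le_rpow (by linarith) hδ0.le)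
    have hsum := h x ((le_max_right _ _).trans hx) k a hk (hkx hx0 hxy hyx hky) hak Q hKQ hQx f
      (max 1 (A₁ * T ^ β)) (M * X ^ δ) hf.multiplicative hf.nonneg (le_max_left _ _) hG1 (by
        intro p l hp hl
        refine (hf.prime_pow_le p l hp hl).trans ?_
        rw [Real.rpow_mul hT0.le, Real.rpow_natCast, ← mul_pow]
        exact pow_le_pow_left₀ (by positivity) (le_max_right _ _) l) (by
        intro n hn
        have hn1 : (1 : ℝ) ≤ n := by exact_mod_cast hn
        have h1 : 1 ≤ X ^ δ := Real.one_le_rpow (by linarith) hδ0.le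
        have h2 : 1 ≤ (n : ℝ) ^ δ := Real.one_le_rpow hn1 hδ0.le
        have h3 : A₂ δ ≤ M := (le_max_left _ _).trans (le_max_right _ _)
        have h4 : A₃ δ ≤ M := (le_max_right _ _).trans (le_max_right _ _)
        refine (hf.growth δ hδ0 n hn).trans (max_le ?_ ?_)
        · refine mul_le_mul_of_nonneg_right (h3.trans ?_) (by positivity)
          exact le_mul_of_one_le_right (by linarith) h1
        · calc A₃ δ * X ^ δ ≤ M * X ^ δ := mul_le_mul_of_nonneg_right h4 (by positivity)
            _ ≤ _ := le_mul_of_one_le_right (by linarith) h2) hsupp (by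
        intro hXQ
        have hlQ : 0 < Real.log Q := Real.log_pos (by linarith)
        have hlQ2 : Real.log Q ≤ X * Real.log T / T := by
          rw [Real.log_le_iff_le_exp (by linarith)]; exact hQ
        -- The upper limit on `Q` gives `u ≥ T / log T` with `T = log log x`, and `log T ≤ √T`.
        have hu : √T ≤ X / Real.log Q := by
          rw [le_div_iff₀ hlQ]
          calc √T * Real.log Q ≤ √T * (X * √T / T) := by
                refine mul_le_mul_of_nonneg_left (hlQ2.trans ?_) (Real.sqrt_nonneg T)
                have := log_le_sqrt hT0
                gcongr
            _ = X * (√T * √T) / T := by ring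
            _ = X := by rw [Real.mul_self_sqrt hT0.le]; field_simp
        have hT1 : T ^ β ≤ (X / Real.log Q) ^ (α / 100) := by
          calc T ^ β ≤ T ^ (1 / 2 * (α / 100)) :=
                Real.rpow_le_rpow_of_exponent_le (by linarith) (by rw [hβ]; linarith)
            _ = (√T) ^ (α / 100) := by rw [Real.rpow_mul hT0.le, Real.sqrt_eq_rpow]
            _ ≤ _ := Real.rpow_le_rpow (Real.sqrt_nonneg T) hu (by positivity)
        have hT1' : 1 ≤ T ^ β := Real.one_le_rpow (by linarith) (by positivity)
        refine max_le ?_ ?_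
        · exact one_le_mul_of_one_le_of_one_le (le_max_left _ _) (hT1'.trans hT1)
        · exact mul_le_mul (le_max_right _ _) hT1 (by linarith)
            (zero_le_one.trans (le_max_left _ _)))
    refine (progressionSum_le_sum_progression hf.nonneg hyx k a).trans (hsum.trans ?_)
    have hφ0 : (0 : ℝ) < k.totient := by exact_mod_cast Nat.totient_pos.2 hk
    have hXε : X ^ δ / X ≤ 1 / X ^ (1 - ε) := by
      rw [Real.rpow_sub hX0, Real.rpow_one, one_div_div]
      refine div_le_div_of_nonneg_right ?_ hX0.le
      exact Real.rpow_le_rpow_of_exponent_le (by linarith) (min_le_right _ _)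
    have hρ := Real.rpow_nonneg (dickman_pos (X / Real.log Q)).le (expC₂ α κ)
    calc B * (M * X ^ δ * (dickman (X / Real.log Q) ^ expC₂ α κ * (x / (k.totient * X)) *
          Real.exp (primeSum f Q k))) =
        B * M * (dickman (X / Real.log Q) ^ expC₂ α κ * (x / k.totient * (X ^ δ / X)) *
          Real.exp (primeSum f Q k)) := by field_simp
      _ ≤ B * M * (dickman (X / Real.log Q) ^ expC₂ α κ * (x / k.totient * (1 / X ^ (1 - ε))) *
          Real.exp (primeSum f Q k)) := by gcongr
      _ = _ := by rw [div_mul_div_comm, mul_one]
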